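/- Let $\Sigma$ be a real-analytic surface, $\gamma_{ab}=e^{\lambda}\sigma_{ab}$ a time-dependent Riemannian metric on $\Sigma$, and $N=e^{\lambda}$. Consider the $2+1$ Einstein–scalar field evolution equations $$\partial_t\gamma_{ab}=-2e^{\lambda}k_{ab},\qquad \partial_t k_{ab}=NR_{ab}-2Nk_{ac}k^c_b+N\tau k_{ab}-\nabla_a\partial_bN-2N\partial_a\phi\,\partial_b\phi,$$ $$\partial_t\phi=e^{\lambda}p,\qquad \partial_tp=-\tfrac12p\,\sigma^{ab}\partial_t\sigma_{ab}-p\,\partial_t\lambda+e^{\lambda}\gamma^{ab}(\nabla_a\nabla_b\phi+\nabla_b\phi\,\partial_a\lambda),$$ where $\tau=\gamma^{ab}k_{ab}$ and $\nabla$, $R_{ab}$, $R$ belong to $\gamma$, and the constraint functions $$C_0=-\tfrac12\left[R-k^a_bk^b_a+\tau^2-2p^2-2|\nabla\phi|^2\right],\qquad C_a=-\left[\nabla_bk^b_a-\nabla_a\tau+2p\nabla_a\phi\right].$$ Let $\mathcal A_0=(\tilde\sigma,\tilde\phi,\tilde\lambda,\tilde v,\tilde w)$ be analytic asymptotic data on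 $\Sigma$ ($\tilde\sigma$ a Riemannian metric) that satisfy the asymptotic constraints $$e^{-2(\tilde\lambda-\tilde vt)}\left(\tfrac12\tilde v^2-2\tilde w^2\right)=0,\qquad -\tilde v(\partial_b\tilde\lambda-t\,\partial_b\tilde v)+\partial_b\tilde v+4\tilde w\,\partial_b(\tilde\phi-\tilde wt)=0\quad\text{for all }t.$$ Let $\epsilon_\sigma,\epsilon_k,\epsilon_{\sigma'},\epsilon_\phi,\epsilon_p,\epsilon_{\phi'}$ be positive constants with $\tilde v(x)>\epsilon_k>\max\{\epsilon_\sigma,\epsilon_{\sigma'},\epsilon_p\}$ for all $x\in\Sigma$ and $\epsilon_p>\max\{\epsilon_\phi,\epsilon_{\phi'}\}$. Let $\mathcal S_{\mathcal A_0}=(\sigma_{ab},k_{ab},\phi,p)$ be an analytic solution of the evolution equations for $t>T$, in the gauge $\lambda=\tilde\lambda-\tilde vt$, that is AVTD with data $\mathcal A_0$: the remainder fields defined by $$\sigma^{ab}=\tilde\sigma^{ab}+e^{-\epsilon_\sigma t}\delta\sigma^{ab},\quad k_a^b=e^{-\lambda}\left(\tfrac12\tilde v\,\delta_a^b+e^{-\epsilon_kt}\delta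 k_a^b\right),\quad \phi=\tilde\phi-\tilde wt+e^{-\epsilon_\phi t}\delta\phi,\quad p=e^{-\lambda}\left(-\tilde w+e^{-\epsilon_pt}\delta p\right),$$ $$\tilde\nabla_c\sigma^{ab}=e^{-\epsilon_{\sigma'}t}\delta\sigma^{ab}_{[c]},\qquad \partial_c\phi=\partial_c\tilde\phi-t\,\partial_c\tilde w+e^{-\epsilon_{\phi'}t}\delta\phi_{[c]}$$ tend to $0$ as $t\to\infty$, locally uniformly on $\Sigma$ together with all their spatial derivatives. Then the following hold. (i) $E_0=e^{2\lambda}C_0$ and $E_a=e^{\lambda}C_a$ satisfy, for $t>T$, the constraint-propagation system (a consequence of the contracted Bianchi identity) $$\partial_tE_0+2\tilde vE_0-2e^{\lambda}\tau E_0=-e^{\lambda}\sigma^{ab}\left(\nabla_aE_b+(\nabla_a\lambda)E_b\right),\qquad \partial_tE_a+\tilde vE_a-e^{\lambda}\tau E_a=-\nabla_aE_0.$$ (ii) This linear system, with coefficients built from $\mathcal S_{\mathcal A_0}$, is of Fuchsian form in the remainder fields $U=(\delta E_0,\delta E_a)$ given by $E_0=e^{-\varepsilon_0t}\delta E_0$,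 $E_a=e^{-\varepsilon_1t}\delta E_a$, for all constants $0<\varepsilon_1<\varepsilon_0<\epsilon_k$. That is, there is $\mu>0$ such that in every analytic coordinate system the system for an arbitrary unknown $U$ is equivalent to $$\partial_tU-LU=e^{-\mu t}F(x,t,U,\partial_aU),$$ where $L$ is a $t$-independent linear operator with positive eigenvalues, and $F$ is analytic in $(x,t)$, bounded at $(U,\partial_a U)=(0,0)$, and Lipschitz in $(U,\partial_aU)$ as long as these are bounded; the bounds are uniform on $K\times[T',\infty)$ for every compact set $K$ in the coordinate domain and every $T'>T$. (iii) The constraints vanish identically: $C_0=0$ and $C_a=0$ on $\Sigma$ for all $t>T$. -/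

import Mathlib

open Set Filter Topology
open scoped Manifold ContDiff Matrix

noncomputable section

/-- The model space of a surface. -/
abbrev Plane : Type := EuclideanSpace ℝ (Fin 2)

/-! ### Riemannian geometry of a surface in local coordinates

A metric is given by its component matrix `g u a b = g_{ab}(u)`; `(g u)⁻¹` has the entries `g^{ab}`. -/

/-- The coordinate derivative `∂_i f` at `u`. -/
def partialD (i : Fin 2) (f : Plane → ℝ) (u : Plane) : ℝ :=
  fderiv ℝ f u (EuclideanSpace.single i 1)

/-- The Christoffel symbol `Γ^c_{ab}(g)`. -/
def christoffel (g : Plane → Matrix (Fin 2) (Fin 2) ℝ) (c a b : Fin 2) (u : Plane) : ℝ :=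
  (1 / 2) * ∑ d, (g u)⁻¹ c d *
    (partialD a (fun y => g y d b) u + partialD b (fun y => g y d a) u
      - partialD d (fun y => g y a b) u)

/-- The Ricci tensor `R_{ab}(g)`. -/
def ricci (g : Plane → Matrix (Fin 2) (Fin 2) ℝ) (a b : Fin 2) (u : Plane) : ℝ :=
  ∑ c, (partialD c (christoffel g c a b) u - partialD b (christoffel g c a c) u
    + ∑ d, (christoffel g c c d u * christoffel g d a b u
      - christoffel g c b d u * christoffel g d a c u))

/-- The scalar curvature `R(g) = g^{ab} R_{ab}`. -/
def scalarCurv (g : Plane → Matrix (Fin 2) (Fin 2) ℝ) (u : Plane) : ℝ :=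
  ∑ a, ∑ b, (g u)⁻¹ a b * ricci g a b u

/-- The covariant derivative `∇_a W_b` of a covector field. -/
def covDCovector (g : Plane → Matrix (Fin 2) (Fin 2) ℝ) (W : Plane → Fin 2 → ℝ)
    (a b : Fin 2) (u : Plane) : ℝ :=
  partialD a (fun y => W y b) u - ∑ c, christoffel g c a b u * W u c

/-- The Hessian `∇_a ∂_b f`. -/
def hessian (g : Plane → Matrix (Fin 2) (Fin 2) ℝ) (f : Plane → ℝ) (a b : Fin 2)
    (u : Plane) : ℝ :=
  covDCovector g (fun y c => partialD c f y) a b u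

/-- The divergence `∇_b m_a^b` of a mixed tensor field with components `m u a b = m_a^b`. -/
def divMixed (g m : Plane → Matrix (Fin 2) (Fin 2) ℝ) (a : Fin 2) (u : Plane) : ℝ :=
  ∑ b, (partialD b (fun y => m y a b) u
    + ∑ c, (christoffel g b b c u * m u a c - christoffel g c b a u * m u c b))

/-- The covariant derivative `∇_c s^{ab}` of a contravariant 2-tensor field. -/
def covDContra (g s : Plane → Matrix (Fin 2) (Fin 2) ℝ) (c a b : Fin 2) (u : Plane) : ℝ :=
  partialD c (fun y => s y a b) u
    + ∑ d, (christoffel g a c d u * s u d b + christoffel g b c d u * s u a d)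

/-! ### The reduced Einstein–scalar field system in local coordinates -/

/-- Local components of the asymptotic data `(σ̃_{ab}, φ̃, λ̃, ṽ, w̃)`. -/
structure LocalData where
  sig : Plane → Matrix (Fin 2) (Fin 2) ℝ
  phi : Plane → ℝ
  lam : Plane → ℝ
  v : Plane → ℝ
  w : Plane → ℝ

/-- Local components of the time-dependent fields `(σ_{ab}, k_{ab}, φ, p)` and of `λ`;
the first argument is the time. -/
structure LocalState where
  sig : ℝ → Plane → Matrix (Fin 2) (Fin 2) ℝ
  k : ℝ → Plane → Matrix (Fin 2) (Fin 2) ℝ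
  phi : ℝ → Plane → ℝ
  p : ℝ → Plane → ℝ
  lam : ℝ → Plane → ℝ

namespace LocalState

variable (S : LocalState)

/-- The lapse `N = e^λ`. -/
def lapse (t : ℝ) (u : Plane) : ℝ := Real.exp (S.lam t u)

/-- The spatial metric `γ_{ab} = e^λ σ_{ab}`. -/
def gam (t : ℝ) (u : Plane) : Matrix (Fin 2) (Fin 2) ℝ := Real.exp (S.lam t u) • S.sig t u

/-- The mixed components `k_a^b = γ^{bc} k_{ac}`. -/
def kMixed (t : ℝ) (u : Plane) : Matrix (Fin 2) (Fin 2) ℝ :=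
  Matrix.of fun a b => ∑ c, (S.gam t u)⁻¹ b c * S.k t u a c

/-- The mean curvature `τ = γ^{ab} k_{ab}`. -/
def tau (t : ℝ) (u : Plane) : ℝ := ∑ a, ∑ b, (S.gam t u)⁻¹ a b * S.k t u a b

/-- `ψ = σ^{ab} ∂_t σ_{ab}`. -/
def psi (t : ℝ) (u : Plane) : ℝ :=
  ∑ a, ∑ b, (S.sig t u)⁻¹ a b * deriv (fun s => S.sig s u a b) t

/-- The evolution equations on `(T, ∞) × V`. -/
structure SolvesEvolution (T : ℝ) (V : Set Plane) : Prop where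
  evol_gam : ∀ t > T, ∀ u ∈ V, ∀ a b,
    deriv (fun s => S.gam s u a b) t = -2 * Real.exp (S.lam t u) * S.k t u a b
  evol_k : ∀ t > T, ∀ u ∈ V, ∀ a b,
    deriv (fun s => S.k s u a b) t =
      S.lapse t u * ricci (S.gam t) a b u
      - 2 * S.lapse t u * ∑ c, S.k t u a c * S.kMixed t u b c
      + S.lapse t u * S.tau t u * S.k t u a b
      - hessian (S.gam t) (S.lapse t) a b u
      - 2 * S.lapse t u * (partialD a (S.phi t) u * partialD b (S.phi t) u)
  evol_phi : ∀ t > T, ∀ u ∈ V,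
    deriv (fun s => S.phi s u) t = Real.exp (S.lam t u) * S.p t u
  evol_p : ∀ t > T, ∀ u ∈ V,
    deriv (fun s => S.p s u) t =
      -(1 / 2) * S.p t u * S.psi t u - S.p t u * deriv (fun s => S.lam s u) t
      + Real.exp (S.lam t u) * ∑ a, ∑ b, (S.gam t u)⁻¹ a b *
          (hessian (S.gam t) (S.phi t) a b u + partialD b (S.phi t) u * partialD a (S.lam t) u)

/-- The Hamiltonian constraint function
`C₀ = -½ [R(γ) - k^a_b k^b_a + τ² - 2p² - 2|∇φ|²]`. -/
def C0 (t : ℝ) (u : Plane) : ℝ :=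
  -(1 / 2) * (scalarCurv (S.gam t) u - (∑ a, ∑ b, S.kMixed t u a b * S.kMixed t u b a)
    + S.tau t u ^ 2 - 2 * S.p t u ^ 2
    - 2 * ∑ a, ∑ b, (S.gam t u)⁻¹ a b * (partialD a (S.phi t) u * partialD b (S.phi t) u))

/-- The momentum constraint functions `C_a = -[∇_b k_a^b - ∇_a τ + 2 p ∇_a φ]`. -/
def Cvec (t : ℝ) (u : Plane) (a : Fin 2) : ℝ :=
  -(divMixed (S.gam t) (S.kMixed t) a u - partialD a (S.tau t) u
    + 2 * S.p t u * partialD a (S.phi t) u)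

/-- `E₀ = e^{2λ} C₀`. -/
def E0 (t : ℝ) (u : Plane) : ℝ := Real.exp (2 * S.lam t u) * S.C0 t u

/-- `E_a = e^{λ} C_a`. -/
def Evec (t : ℝ) (u : Plane) (a : Fin 2) : ℝ := Real.exp (S.lam t u) * S.Cvec t u a

/-- The constraint-propagation system on `(T, ∞) × V` for unknown fields `(W₀, W_a)`, with
coefficients built from the fields `S` and the velocity `v = -∂_t λ`:
`∂_t W₀ + 2 v W₀ - 2 e^λ τ W₀ = -(e^λ σ^{ab} ∇_a W_b + σ^{ab} e^λ (∇_a λ) W_b)`,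
`∂_t W_a + v W_a - e^λ τ W_a = -∇_a W₀`. -/
structure SolvesPropagation (v : Plane → ℝ) (T : ℝ) (V : Set Plane)
    (W0 : ℝ → Plane → ℝ) (W : ℝ → Plane → Fin 2 → ℝ) : Prop where
  eq0 : ∀ t > T, ∀ u ∈ V,
    deriv (fun s => W0 s u) t + 2 * v u * W0 t u
        - 2 * Real.exp (S.lam t u) * S.tau t u * W0 t u =
      -(Real.exp (S.lam t u) * (∑ a, ∑ b, (S.sig t u)⁻¹ a b * covDCovector (S.gam t) (W t) a b u)
        + ∑ a, ∑ b, (S.sig t u)⁻¹ a b * Real.exp (S.lam t u) * partialD a (S.lam t) u * W t u b)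
  eqa : ∀ t > T, ∀ u ∈ V, ∀ a,
    deriv (fun s => W s u a) t + v u * W t u a - Real.exp (S.lam t u) * S.tau t u * W t u a =
      -partialD a (W0 t) u

/-! The remainder fields, defined by the expansions
`σ^{ab} = σ̃^{ab} + e^{-εt} δσ^{ab}`, `φ = φ̃ - w̃ t + e^{-εt} δφ`,
`k_a^b = e^{-λ} (½ ṽ δ_a^b + e^{-εt} δk_a^b)`, `p = e^{-λ} (-w̃ + e^{-εt} δp)`,
`∇̃_c σ^{ab} = e^{-εt} δσ_{[c]}^{ab}`, `∂_c φ = ∂_c φ̃ - t ∂_c w̃ + e^{-εt} δφ_{[c]}`. -/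

variable (D : LocalData)

def remSigma (ε : ℝ) (a b : Fin 2) (t : ℝ) (u : Plane) : ℝ :=
  Real.exp (ε * t) * ((S.sig t u)⁻¹ a b - (D.sig u)⁻¹ a b)

def remPhi (ε : ℝ) (t : ℝ) (u : Plane) : ℝ :=
  Real.exp (ε * t) * (S.phi t u - (D.phi u - D.w u * t))

def remK (ε : ℝ) (a b : Fin 2) (t : ℝ) (u : Plane) : ℝ :=
  Real.exp (ε * t) *
    (Real.exp (S.lam t u) * S.kMixed t u a b - (1 / 2) * D.v u * (1 : Matrix _ _ ℝ) a b)

def remP (ε : ℝ) (t : ℝ) (u : Plane) : ℝ :=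
  Real.exp (ε * t) * (Real.exp (S.lam t u) * S.p t u + D.w u)

def remSigmaD (ε : ℝ) (c a b : Fin 2) (t : ℝ) (u : Plane) : ℝ :=
  Real.exp (ε * t) * covDContra D.sig (fun y => (S.sig t y)⁻¹) c a b u

def remPhiD (ε : ℝ) (c : Fin 2) (t : ℝ) (u : Plane) : ℝ :=
  Real.exp (ε * t) * (partialD c (S.phi t) u - (partialD c D.phi u - partialD c D.w u * t))

end LocalState

/-- `f t → 0` as `t → ∞`, locally uniformly on `V` together with all spatial derivatives. -/
def TendsToZeroOn (V : Set Plane) (f : ℝ → Plane → ℝ) : Prop :=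
  ∀ (n : ℕ) (K : Set Plane), K ⊆ V → IsCompact K →
    TendstoUniformlyOn (fun t u => iteratedFDeriv ℝ n (f t) u) (fun _ => 0) atTop K

/-- Decay exponents `ε_σ, ε_k, ε_{σ'}, ε_φ, ε_p, ε_{φ'}`: positive numbers with
`ε_k > max (ε_σ, ε_{σ'}, ε_p)` and `ε_p > max (ε_φ, ε_{φ'})`. -/
structure Exponents where
  sig : ℝ
  k : ℝ
  sigD : ℝ
  phi : ℝ
  p : ℝ
  phiD : ℝ
  sig_pos : 0 < sig
  k_pos : 0 < k
  sigD_pos : 0 < sigD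
  phi_pos : 0 < phi
  p_pos : 0 < p
  phiD_pos : 0 < phiD
  lt_k : max sig (max sigD p) < k
  lt_p : max phi phiD < p

/-- All remainder fields tend to `0`. -/
structure RemaindersTendToZero (ε : Exponents) (D : LocalData) (S : LocalState)
    (V : Set Plane) : Prop where
  sig : ∀ a b, TendsToZeroOn V (S.remSigma D ε.sig a b)
  phi : TendsToZeroOn V (S.remPhi D ε.phi)
  k : ∀ a b, TendsToZeroOn V (S.remK D ε.k a b)
  p : TendsToZeroOn V (S.remP D ε.p)
  sigD : ∀ c a b, TendsToZeroOn V (S.remSigmaD D ε.sigD c a b)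
  phiD : ∀ c, TendsToZeroOn V (S.remPhiD D ε.phiD c)

/-! ### Fuchsian systems -/

/-- The right-hand side `e^{-μt} F(x, t, U, ∂U)` and the operator `L` of a Fuchsian system
`∂_t U - L U = e^{-μt} F(x, t, U, ∂U)` on `V` for `t > T`: `L` does not depend on `t` and has
positive eigenvalues, `μ > 0`, and `F` is analytic in `(x, t)`, bounded at `(U, ∂U) = 0` and
Lipschitz in `(U, ∂U)` on bounded sets, uniformly in `t` up to `∞` and locally uniformly in `x`. -/
structure IsFuchsianForm {ι : Type} [Fintype ι] [DecidableEq ι] (T : ℝ) (V : Set Plane)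
    (L : Plane → Matrix ι ι ℝ) (μ : ℝ)
    (F : Plane → ℝ → (ι → ℝ) → (Fin 2 → ι → ℝ) → ι → ℝ) : Prop where
  mu_pos : 0 < μ
  L_analytic : ∀ i j, AnalyticOnNhd ℝ (fun u => L u i j) V
  L_pos : ∀ u ∈ V, ∀ z ∈ spectrum ℂ ((L u).map (fun r : ℝ => (r : ℂ))), z.im = 0 ∧ 0 < z.re
  F_analytic : ∀ U W i, AnalyticOnNhd ℝ (fun q : Plane × ℝ => F q.1 q.2 U W i) (V ×ˢ Ioi T)
  F_bounded : ∀ K ⊆ V, IsCompact K → ∀ T' > T, ∃ C : ℝ, ∀ u ∈ K, ∀ t ≥ T', ‖F u t 0 0‖ ≤ C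
  F_lipschitz : ∀ K ⊆ V, IsCompact K → ∀ T' > T, ∀ R : ℝ, ∃ C : ℝ, ∀ u ∈ K, ∀ t ≥ T',
    ∀ U U' : ι → ℝ, ∀ W W' : Fin 2 → ι → ℝ, ‖U‖ ≤ R → ‖U'‖ ≤ R → ‖W‖ ≤ R → ‖W'‖ ≤ R →
      ‖F u t U W - F u t U' W'‖ ≤ C * (‖U - U'‖ + ‖W - W'‖)

/-- The system of equations `P` for an unknown `U = U(t, x)` on `(T, ∞) × V` is equivalent, for
differentiable `U`, to a Fuchsian system with decay rate `μ`. -/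
def IsFuchsianSystem {ι : Type} [Fintype ι] [DecidableEq ι] (T : ℝ) (V : Set Plane) (μ : ℝ)
    (P : (ℝ → Plane → ι → ℝ) → Prop) : Prop :=
  ∃ (L : Plane → Matrix ι ι ℝ) (F : Plane → ℝ → (ι → ℝ) → (Fin 2 → ι → ℝ) → ι → ℝ),
    IsFuchsianForm T V L μ F ∧
    ∀ U : ℝ → Plane → ι → ℝ,
      DifferentiableOn ℝ (fun q : ℝ × Plane => U q.1 q.2) (Ioi T ×ˢ V) →
      (P U ↔ ∀ t > T, ∀ u ∈ V, ∀ i,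
        deriv (fun s => U s u i) t - (L u *ᵥ U t u) i =
          Real.exp (-μ * t) *
            F u t (U t u) (fun a j => partialD a (fun y => U t y j) u) i)

/-- The constraint-propagation system as a system for remainder fields `U = (U₀, U₁, U₂)`, where
`W₀ = e^{-ε₀ t} U₀` and `W_a = e^{-ε₁ t} U_a`. -/
def LocalState.RescaledPropagation (S : LocalState) (v : Plane → ℝ) (T : ℝ) (V : Set Plane)
    (ε₀ ε₁ : ℝ) (U : ℝ → Plane → Fin 3 → ℝ) : Prop :=
  S.SolvesPropagation v T V (fun t u => Real.exp (-ε₀ * t) * U t u 0)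
    (fun t u a => Real.exp (-ε₁ * t) * U t u a.succ)

/-! ### Fields on a surface -/

section Surface

variable (M : Type*) [TopologicalSpace M] [ChartedSpace Plane M]

/-- Covariant 2-tensor fields. -/
abbrev Tensor2 : Type _ :=
  (x : M) → TangentSpace (𝓡 2) x →L[ℝ] TangentSpace (𝓡 2) x →L[ℝ] ℝ

variable {M}

/-- The components `h(∂_a, ∂_b)` of a tensor field in the chart `e`. -/
def Tensor2.comp (h : Tensor2 M) (e : OpenPartialHomeomorph M Plane) (u : Plane) :
    Matrix (Fin 2) (Fin 2) ℝ :=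
  Matrix.of fun a b => h (e.symm u)
    (mfderiv (𝓡 2) (𝓡 2) e.symm u (EuclideanSpace.single a 1 : Plane))
    (mfderiv (𝓡 2) (𝓡 2) e.symm u (EuclideanSpace.single b 1 : Plane))

/-- Symmetric and positive definite at every point. -/
def Tensor2.IsMetric (h : Tensor2 M) : Prop :=
  (∀ x, ∀ X Y : TangentSpace (𝓡 2) x, h x X Y = h x Y X) ∧
    ∀ x, ∀ X : TangentSpace (𝓡 2) x, X ≠ 0 → 0 < h x X X

variable (M)

/-- The local coordinate systems of the real-analytic surface `M`. -/
def coords : Set (OpenPartialHomeomorph M Plane) := IsManifold.maximalAtlas (𝓡 2) ω M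

/-- Asymptotic data: a metric `σ̃` and functions `φ̃, λ̃, ṽ, w̃` on the surface. -/
structure AsymptoticData where
  sig : Tensor2 M
  phi : M → ℝ
  lam : M → ℝ
  v : M → ℝ
  w : M → ℝ

/-- Time-dependent fields `σ_{ab}(t), k_{ab}(t), φ(t), p(t)` on the surface. -/
structure SurfaceState where
  sig : ℝ → Tensor2 M
  k : ℝ → Tensor2 M
  phi : ℝ → M → ℝ
  p : ℝ → M → ℝ

variable {M}

/-- Local components of the asymptotic data. -/
def AsymptoticData.toLocal (A : AsymptoticData M) (e : OpenPartialHomeomorph M Plane) :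
    LocalData where
  sig := A.sig.comp e
  phi := fun u => A.phi (e.symm u)
  lam := fun u => A.lam (e.symm u)
  v := fun u => A.v (e.symm u)
  w := fun u => A.w (e.symm u)

/-- Local components of the fields, in the gauge `λ = λ̃ - ṽ t`. -/
def SurfaceState.toLocal (S : SurfaceState M) (A : AsymptoticData M)
    (e : OpenPartialHomeomorph M Plane) : LocalState where
  sig := fun t => (S.sig t).comp e
  k := fun t => (S.k t).comp e
  phi := fun t u => S.phi t (e.symm u)
  p := fun t u => S.p t (e.symm u)
  lam := fun t u => A.lam (e.symm u) - A.v (e.symm u) * t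

/-- The asymptotic data are real-analytic, and `σ̃` is a Riemannian metric. -/
structure AsymptoticData.IsAnalytic (A : AsymptoticData M) : Prop where
  metric : A.sig.IsMetric
  sig : ∀ e ∈ coords M, ∀ a b, AnalyticOnNhd ℝ (fun u => (A.toLocal e).sig u a b) e.target
  phi : ∀ e ∈ coords M, AnalyticOnNhd ℝ (A.toLocal e).phi e.target
  lam : ∀ e ∈ coords M, AnalyticOnNhd ℝ (A.toLocal e).lam e.target
  v : ∀ e ∈ coords M, AnalyticOnNhd ℝ (A.toLocal e).v e.target
  w : ∀ e ∈ coords M, AnalyticOnNhd ℝ (A.toLocal e).w e.target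

/-- The asymptotic (velocity term dominated) constraints vanish:
`e^{-2(λ̃ - ṽt)} (½ ṽ² - 2 w̃²) = 0` and
`-ṽ (∂_b λ̃ - t ∂_b ṽ) + ∂_b ṽ + 4 w̃ ∂_b (φ̃ - w̃ t) = 0`. -/
structure AsymptoticData.SatisfiesConstraints (A : AsymptoticData M) : Prop where
  ham : ∀ x, ∀ t : ℝ,
    Real.exp (-2 * (A.lam x - A.v x * t)) * ((1 / 2) * A.v x ^ 2 - 2 * A.w x ^ 2) = 0
  mom : ∀ e ∈ coords M, ∀ u ∈ e.target, ∀ t : ℝ, ∀ b,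
    -(A.toLocal e).v u * (partialD b (A.toLocal e).lam u - partialD b (A.toLocal e).v u * t)
      + partialD b (A.toLocal e).v u
      + 4 * (A.toLocal e).w u *
        partialD b (fun y => (A.toLocal e).phi y - (A.toLocal e).w y * t) u = 0

/-- `S` is the AVTD solution with asymptotic data `A`, defined for `t > T`: it is analytic,
`σ(t)` is a Riemannian metric, the evolution equations hold in the gauge `λ = λ̃ - ṽ t`, and all
remainder fields tend to `0` as `t → ∞`. -/
structure IsAVTDSolution (ε : Exponents) (A : AsymptoticData M) (T : ℝ)
    (S : SurfaceState M) : Prop where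
  metric : ∀ t > T, (S.sig t).IsMetric
  analytic_sig : ∀ e ∈ coords M, ∀ a b,
    AnalyticOnNhd ℝ (fun q : ℝ × Plane => (S.toLocal A e).sig q.1 q.2 a b) (Ioi T ×ˢ e.target)
  analytic_k : ∀ e ∈ coords M, ∀ a b,
    AnalyticOnNhd ℝ (fun q : ℝ × Plane => (S.toLocal A e).k q.1 q.2 a b) (Ioi T ×ˢ e.target)
  analytic_phi : ∀ e ∈ coords M,
    AnalyticOnNhd ℝ (fun q : ℝ × Plane => (S.toLocal A e).phi q.1 q.2) (Ioi T ×ˢ e.target)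
  analytic_p : ∀ e ∈ coords M,
    AnalyticOnNhd ℝ (fun q : ℝ × Plane => (S.toLocal A e).p q.1 q.2) (Ioi T ×ˢ e.target)
  evolution : ∀ e ∈ coords M, (S.toLocal A e).SolvesEvolution T e.target
  remainders : ∀ e ∈ coords M,
    RemaindersTendToZero ε (A.toLocal e) (S.toLocal A e) e.target

end Surface

end

/-!
The three assertions are local, and `IsAVTDSolution.isLocalAVTD` reduces them to a solution in a
coordinate domain `V`.

**Propagation of the constraints.** Both propagation equations are consequences of polynomial
identities between a metric, its curvature, the fields and their derivatives. They are proved in a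
commutative `ℝ`-algebra with two commuting derivations `D 0`, `D 1` and a further derivation `t`
which commutes with them (`FormalMetric`, `FormalSolution`). There, `FormalMetric.variation_scal`
computes the variation of the scalar curvature with the metric, and in dimension two the Ricci
tensor is half the scalar curvature times the metric (`FormalMetric.two_ric`), which takes the place
of the contracted Bianchi identity. The time derivatives of the two constraint functions are
`FormalSolution.t_H` and `FormalSolution.two_t_C`. Real-analytic functions on `(T, ∞) × V` form
such an algebra (`analyticAlgebra`), and evaluation at a point gives the equations for the fields
(`IsLocalSolution.solvesPropagation`).

**Fuchsian form.** A family `f t` has `Rate T V n r f` if its space derivatives of order at most `n`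
are `O(e^{rt})`, locally uniformly in space. The convergence of the remainder fields says that
`σ^{ab}` is bounded, that `e^λ τ - ṽ` is `O(e^{-ε_k t})`, and that `∂λ` and the Christoffel symbols
grow at most linearly in `t`, so that they have every positive rate. Moreover
`e^λ = O(e^{-ε_k t})`, since `ṽ > ε_k`. With `L = diag(ε₀, ε₁, ε₁)` the remaining coefficients of
the rescaled linear system are therefore `O(e^{-μt})` for `μ = min (ε₀ - ε₁) ε₁`, and
`isFuchsianForm_linear` applies (`IsLocalAVTD.isFuchsianSystem`).

**Vanishing of the constraints.** The asymptotic constraints say that the leading terms of `E₀` and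
`E_a` cancel, so `E₀` and `E_a` decay exponentially (`IsLocalAVTD.rate_E0`,
`IsLocalAVTD.rate_Evec`). The propagation system is symmetric hyperbolic, with the energy density
`e^{-λ} E₀² + σ^{ab} E_a E_b`. As `E₀ det σ` is the integral from `t` to `∞` of a source with the
factor `e^λ`, the quantity `E₀` decays almost as fast as `e^λ`
(`IsLocalAVTD.expBound_exp_mul_E0`), and so the energy density tends to `0`. Up to a nonnegative
term, its derivative is a divergence plus a term bounded, like the flux, by an exponentially small
multiple of the density (`IsLocalAVTD.deriv_energy`). The flux is small because
`|E₀| |E_a| ≤ e^{λ/2} (e^{-λ} E₀² + E_a²)` and `e^{λ/2}` decays: the total distance which a signal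
travels between `t` and `∞` is small for large `t`. Hence the energy in balls which expand to a
fixed ball as `t → ∞`, measured with a cutoff function, satisfies a Grönwall inequality from
`t = ∞` and vanishes (`energy_eq_zero`). The constraint functions thus vanish at large times, and
at all `t > T` because they are analytic in `t`. No appeal to the uniqueness theorem for Fuchsian
systems is needed.
-/

noncomputable section

/-! ### Metrics over a commutative algebra with derivations -/

/-- The algebraic content of a Riemannian metric in two coordinates: commuting derivations `D a` of
a commutative algebra (the coordinate derivatives), a metric `g` with inverse `G`, and symbols `Γ`
of a torsion-free metric connection. Over such an algebra, tensor identities become polynomial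
identities. -/
structure FormalMetric (A : Type*) [CommRing A] [Algebra ℝ A] where
  D : Fin 2 → Derivation ℝ A A
  g : Fin 2 → Fin 2 → A
  G : Fin 2 → Fin 2 → A
  Γ : Fin 2 → Fin 2 → Fin 2 → A
  D_comm : ∀ a b x, D a (D b x) = D b (D a x)
  g_symm : ∀ a b, g a b = g b a
  G_symm : ∀ a b, G a b = G b a
  G_mul_g : ∀ a b, ∑ c, G a c * g c b = if a = b then 1 else 0
  Γ_symm : ∀ c a b, Γ c a b = Γ c b a
  D_g : ∀ c a b, D c (g a b) = ∑ d, (Γ d c a * g d b + Γ d c b * g a d)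

namespace FormalMetric

variable {A : Type*} [CommRing A] [Algebra ℝ A] (M : FormalMetric A)

theorem g10 : M.g 1 0 = M.g 0 1 := M.g_symm 1 0

theorem G10 : M.G 1 0 = M.G 0 1 := M.G_symm 1 0

theorem Γ10 (c) : M.Γ c 1 0 = M.Γ c 0 1 := M.Γ_symm c 1 0

theorem G_mul_g00 : M.G 0 0 * M.g 0 0 + M.G 0 1 * M.g 0 1 = 1 := by
  simpa [Fin.sum_univ_two, g10] using M.G_mul_g 0 0

theorem G_mul_g01 : M.G 0 0 * M.g 0 1 + M.G 0 1 * M.g 1 1 = 0 := by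
  simpa [Fin.sum_univ_two] using M.G_mul_g 0 1

theorem G_mul_g10 : M.G 0 1 * M.g 0 0 + M.G 1 1 * M.g 0 1 = 0 := by
  simpa [Fin.sum_univ_two, g10, G10] using M.G_mul_g 1 0

theorem G_mul_g11 : M.G 0 1 * M.g 0 1 + M.G 1 1 * M.g 1 1 = 1 := by
  simpa [Fin.sum_univ_two, G10] using M.G_mul_g 1 1

/-- The derivative of the inverse metric along any derivation. -/
theorem derivation_G (d : Derivation ℝ A A) (a b : Fin 2) :
    d (M.G a b) = -∑ c, ∑ e, M.G a c * d (M.g c e) * M.G e b := by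
  have h00 := congrArg d M.G_mul_g00
  have h01 := congrArg d M.G_mul_g01
  have h10 := congrArg d M.G_mul_g10
  have h11 := congrArg d M.G_mul_g11
  simp only [map_add, Derivation.leibniz, smul_eq_mul, map_zero] at h00 h01 h10 h11
  rw [Derivation.map_one_eq_zero] at h00 h11
  have e00 := M.G_mul_g00
  have e01 := M.G_mul_g01
  have e10 := M.G_mul_g10
  have e11 := M.G_mul_g11
  fin_cases a <;> fin_cases b <;> simp only [Fin.sum_univ_two, Fin.zero_eta, Fin.mk_one, g10, G10,
    Fin.isValue]
  · linear_combination M.G 0 0 * h00 + M.G 0 1 * h01 - d (M.G 0 0) * e00 - d (M.G 0 1) * e01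
  · linear_combination M.G 0 1 * h00 + M.G 1 1 * h01 - d (M.G 0 0) * e10 - d (M.G 0 1) * e11
  · linear_combination M.G 0 0 * h10 + M.G 0 1 * h11 - d (M.G 0 1) * e00 - d (M.G 1 1) * e01
  · linear_combination M.G 0 1 * h10 + M.G 1 1 * h11 - d (M.G 0 1) * e10 - d (M.G 1 1) * e11

/-- The inverse metric is covariantly constant. -/
theorem D_G (c a b : Fin 2) :
    M.D c (M.G a b) = -∑ d, (M.Γ a c d * M.G d b + M.Γ b c d * M.G a d) := by
  have e00 := M.G_mul_g00
  have e01 := M.G_mul_g01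
  have e10 := M.G_mul_g10
  have e11 := M.G_mul_g11
  rw [derivation_G]
  simp only [D_g, Fin.sum_univ_two, g10]
  fin_cases a <;> fin_cases b <;> simp only [Fin.zero_eta, Fin.mk_one, G10, Fin.isValue]
  · linear_combination -(M.G 0 0 * M.Γ 0 c 0 + M.G 0 1 * M.Γ 0 c 1) * e00
      -(M.G 0 0 * M.Γ 1 c 0 + M.G 0 1 * M.Γ 1 c 1) * e01
      -(M.G 0 0 * M.Γ 0 c 0 + M.G 0 1 * M.Γ 0 c 1) * e00
      -(M.G 0 0 * M.Γ 1 c 0 + M.G 0 1 * M.Γ 1 c 1) * e01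
  · linear_combination -(M.G 0 0 * M.Γ 0 c 0 + M.G 0 1 * M.Γ 0 c 1) * e10
      -(M.G 0 0 * M.Γ 1 c 0 + M.G 0 1 * M.Γ 1 c 1) * e11
      -(M.G 0 1 * M.Γ 0 c 0 + M.G 1 1 * M.Γ 0 c 1) * e00
      -(M.G 0 1 * M.Γ 1 c 0 + M.G 1 1 * M.Γ 1 c 1) * e01
  · linear_combination -(M.G 0 1 * M.Γ 0 c 0 + M.G 1 1 * M.Γ 0 c 1) * e00
      -(M.G 0 1 * M.Γ 1 c 0 + M.G 1 1 * M.Γ 1 c 1) * e01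
      -(M.G 0 0 * M.Γ 0 c 0 + M.G 0 1 * M.Γ 0 c 1) * e10
      -(M.G 0 0 * M.Γ 1 c 0 + M.G 0 1 * M.Γ 1 c 1) * e11
  · linear_combination -(M.G 0 1 * M.Γ 0 c 0 + M.G 1 1 * M.Γ 0 c 1) * e10
      -(M.G 0 1 * M.Γ 1 c 0 + M.G 1 1 * M.Γ 1 c 1) * e11
      -(M.G 0 1 * M.Γ 0 c 0 + M.G 1 1 * M.Γ 0 c 1) * e10
      -(M.G 0 1 * M.Γ 1 c 0 + M.G 1 1 * M.Γ 1 c 1) * e11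

/-- `∇_a W_b`. -/
def cd1 (W : Fin 2 → A) (a b : Fin 2) : A := M.D a (W b) - ∑ c, M.Γ c a b * W c

/-- `∇_c T_{ab}`. -/
def cd2 (T : Fin 2 → Fin 2 → A) (c a b : Fin 2) : A :=
  M.D c (T a b) - ∑ d, (M.Γ d c a * T d b + M.Γ d c b * T a d)

/-- `∇_b m_a^b`, where `m a b = m_a^b`. -/
def div (m : Fin 2 → Fin 2 → A) (a : Fin 2) : A :=
  ∑ b, (M.D b (m a b) + ∑ c, (M.Γ b b c * m a c - M.Γ c b a * m c b))

/-- `T_a^b = g^{bc} T_{ac}`. -/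
def raise (T : Fin 2 → Fin 2 → A) (a b : Fin 2) : A := ∑ c, M.G b c * T a c

/-- `g^{ab} T_{ab}`. -/
def tr (T : Fin 2 → Fin 2 → A) : A := ∑ a, ∑ b, M.G a b * T a b

/-- `∇_a ∂_b f`. -/
def hess (f : A) : Fin 2 → Fin 2 → A := M.cd1 fun c => M.D c f

/-- `R^d_{cab}`. -/
def riem (d c a b : Fin 2) : A :=
  M.D a (M.Γ d b c) - M.D b (M.Γ d a c) + ∑ e, (M.Γ d a e * M.Γ e b c - M.Γ d b e * M.Γ e a c)

/-- The Ricci tensor. -/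
def ric (a b : Fin 2) : A :=
  ∑ c, (M.D c (M.Γ c a b) - M.D b (M.Γ c a c)
    + ∑ d, (M.Γ c c d * M.Γ d a b - M.Γ c b d * M.Γ d a c))

/-- The scalar curvature. -/
def scal : A := M.tr M.ric

theorem div_raise (T : Fin 2 → Fin 2 → A) (a : Fin 2) :
    M.div (M.raise T) a = ∑ b, ∑ c, M.G b c * M.cd2 T b a c := by
  simp only [div, raise, cd2, Fin.sum_univ_two, map_add, Derivation.leibniz, smul_eq_mul, D_G,
    G10, Γ10, Fin.isValue]
  ring

theorem D_tr (T : Fin 2 → Fin 2 → A) (a : Fin 2) :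
    M.D a (M.tr T) = ∑ b, ∑ c, M.G b c * M.cd2 T a b c := by
  simp only [tr, cd2, Fin.sum_univ_two, map_add, Derivation.leibniz, smul_eq_mul, D_G,
    G10, Fin.isValue]
  ring

/-- Antisymmetry of the curvature in its first two indices. -/
theorem riem_antisymm (a b c d : Fin 2) :
    ∑ e, (M.riem a e c d * M.G e b + M.riem b e c d * M.G a e) = 0 := by
  have h := M.D_comm c d (M.G a b)
  simp only [riem, Fin.sum_univ_two, map_add, map_neg, Derivation.leibniz, smul_eq_mul, D_G] at h ⊢
  linear_combination -h

theorem ric_eq_riem (a b : Fin 2) : M.ric a b = ∑ c, M.riem c a c b := by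
  simp only [ric, riem, M.Γ_symm _ a b, M.Γ_symm _ a 0, M.Γ_symm _ a 1, Fin.sum_univ_two]

theorem two_mul_cancel {x y : A} (h : 2 * x = 2 * y) : x = y := by
  have := congrArg (fun z => (1 / 2 : ℝ) • z) h
  simpa [two_mul, ← two_smul ℝ, smul_smul] using this

/-- Antisymmetry in both pairs of indices leaves a single function `P` to describe the
curvature. -/
theorem exists_riem_eq : ∃ P, (∀ c, M.riem 0 c 0 1 = P * M.g 1 c) ∧
    ∀ c, M.riem 1 c 0 1 = -(P * M.g 0 c) := by
  have e00 := M.G_mul_g00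
  have e01 := M.G_mul_g01
  have e10 := M.G_mul_g10
  have e11 := M.G_mul_g11
  have h0 := M.riem_antisymm 0 0 0 1
  have h1 := M.riem_antisymm 0 1 0 1
  have h2 := M.riem_antisymm 1 1 0 1
  simp only [Fin.sum_univ_two, G10] at h0 h1 h2
  replace h0 : M.riem 0 0 0 1 * M.G 0 0 + M.riem 0 1 0 1 * M.G 0 1 = 0 :=
    two_mul_cancel (by linear_combination h0)
  replace h2 : M.riem 1 0 0 1 * M.G 0 1 + M.riem 1 1 0 1 * M.G 1 1 = 0 :=
    two_mul_cancel (by linear_combination h2)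
  refine ⟨M.riem 0 0 0 1 * M.G 0 1 + M.riem 0 1 0 1 * M.G 1 1, fun c => ?_, fun c => ?_⟩ <;>
    fin_cases c <;> simp only [Fin.zero_eta, Fin.mk_one, g10, Fin.isValue]
  · linear_combination M.g 0 0 * h0 - M.riem 0 0 0 1 * e00 - M.riem 0 1 0 1 * e10
  · linear_combination M.g 0 1 * h0 - M.riem 0 0 0 1 * e01 - M.riem 0 1 0 1 * e11
  · linear_combination M.g 0 1 * h2 + M.g 0 0 * h1 - M.riem 1 0 0 1 * e00 - M.riem 1 1 0 1 * e10
  · linear_combination M.g 1 1 * h2 + M.g 0 1 * h1 - M.riem 1 0 0 1 * e01 - M.riem 1 1 0 1 * e11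

theorem riem_swap (d c : Fin 2) : M.riem d c 1 0 = -M.riem d c 0 1 := by
  simp only [riem, Fin.sum_univ_two]
  ring

theorem riem_self (d c a : Fin 2) : M.riem d c a a = 0 := by
  simp only [riem, Fin.sum_univ_two]
  ring

/-- In dimension two the curvature is determined by one function `P`, half the scalar
curvature. -/
theorem exists_curvature_eq : ∃ P, (∀ c, M.riem 0 c 0 1 = P * M.g 1 c) ∧
    (∀ c, M.riem 1 c 0 1 = -(P * M.g 0 c)) ∧ (∀ a b, M.ric a b = P * M.g a b) ∧
    M.scal = 2 * P := by
  obtain ⟨P, h0, h1⟩ := M.exists_riem_eq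
  have h (a b) : M.ric a b = P * M.g a b := by
    rw [ric_eq_riem, M.g_symm a b]
    fin_cases b <;> simp [Fin.sum_univ_two, riem_self, riem_swap, h0, h1]
  have hs : M.scal = 2 * P := by
    simp only [scal, tr, h, Fin.sum_univ_two, g10, G10]
    linear_combination P * M.G_mul_g00 + P * M.G_mul_g11
  exact ⟨P, h0, h1, h, hs⟩

/-- In dimension two, `R_{ab} = ½ R g_{ab}`. -/
theorem two_ric (a b : Fin 2) : 2 * M.ric a b = M.scal * M.g a b := by
  obtain ⟨P, -, -, h, hs⟩ := M.exists_curvature_eq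
  rw [h, hs]
  ring

theorem ric_symm (a b : Fin 2) : M.ric a b = M.ric b a := by
  obtain ⟨P, -, -, h, -⟩ := M.exists_curvature_eq
  rw [h, h, M.g_symm]

/-- The Ricci identity for the covector `∂f`. -/
theorem cd2_hess (f : A) (b a c : Fin 2) :
    M.cd2 (M.hess f) b a c = M.cd2 (M.hess f) a b c - ∑ d, M.riem d c b a * M.D d f := by
  have h1 := M.D_comm b a (M.D c f)
  simp only [cd2, hess, cd1, riem, Fin.sum_univ_two, map_add, map_sub, Derivation.leibniz,
    smul_eq_mul, M.Γ_symm _ b a]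
  linear_combination h1

theorem hess_symm (f : A) (a b : Fin 2) : M.hess f a b = M.hess f b a := by
  simp only [hess, cd1, M.Γ_symm _ a b, M.D_comm a b]

/-- `∇^b ∇_b ∂_a f = ∂_a Δf + ½ R ∂_a f`. -/
theorem two_div_hess (f : A) (a : Fin 2) :
    2 * M.div (M.raise (M.hess f)) a = 2 * M.D a (M.tr (M.hess f)) + M.scal * M.D a f := by
  obtain ⟨P, h0, h1, -, hs⟩ := M.exists_curvature_eq
  rw [div_raise, D_tr, hs]
  simp only [M.cd2_hess f _ a, Fin.sum_univ_two]
  have e00 := M.G_mul_g00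
  have e01 := M.G_mul_g01
  have e10 := M.G_mul_g10
  have e11 := M.G_mul_g11
  fin_cases a <;> simp [riem_self, riem_swap, h0, h1, g10, G10]
  · linear_combination 2 * P * M.D 0 f * e11 - 2 * P * M.D 1 f * e10
  · linear_combination -2 * P * M.D 0 f * e01 + 2 * P * M.D 1 f * e00

end FormalMetric

/-! ### Variation of the curvature -/

namespace FormalMetric

variable {A : Type*} [CommRing A] [Algebra ℝ A] (M : FormalMetric A)

theorem sum_G_mul_g_mul (x : Fin 2 → A) (c : Fin 2) :
    ∑ e, M.G c e * ∑ d, M.g e d * x d = x c := by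
  have e00 := M.G_mul_g00
  have e01 := M.G_mul_g01
  have e10 := M.G_mul_g10
  have e11 := M.G_mul_g11
  fin_cases c <;> simp only [Fin.zero_eta, Fin.mk_one, Fin.sum_univ_two, g10, G10, Fin.isValue]
  · linear_combination x 0 * e00 + x 1 * e01
  · linear_combination x 0 * e10 + x 1 * e11

/-- The Christoffel symbols with a lowered index. -/
theorem two_sum_g_mul_Γ (e a b : Fin 2) :
    2 * ∑ c, M.g e c * M.Γ c a b
      = M.D a (M.g e b) + M.D b (M.g e a) - M.D e (M.g a b) := by
  simp only [D_g, Fin.sum_univ_two]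
  fin_cases e <;> fin_cases a <;> fin_cases b <;>
    simp only [Fin.zero_eta, Fin.mk_one, g10, Γ10, Fin.isValue] <;> ring

/-- The variation of the Christoffel symbols. Here and below, the variation is a derivation `t`
that commutes with the coordinate derivatives. -/
theorem two_variation_Γ (t : Derivation ℝ A A) (ht : ∀ a x, t (M.D a x) = M.D a (t x))
    (h : Fin 2 → Fin 2 → A) (hh : ∀ a b, t (M.g a b) = h a b) (c a b : Fin 2) :
    2 * t (M.Γ c a b) = ∑ e, M.G c e * (M.cd2 h a e b + M.cd2 h b e a - M.cd2 h e a b) := by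
  have key (e : Fin 2) : ∑ d, M.g e d * (2 * t (M.Γ d a b)) =
      M.cd2 h a e b + M.cd2 h b e a - M.cd2 h e a b := by
    have hs (a b) : h a b = h b a := by rw [← hh, ← hh, M.g_symm]
    have h1 := congrArg t (M.two_sum_g_mul_Γ e a b)
    simp only [Fin.sum_univ_two, Derivation.leibniz, map_add, map_sub, ht, hh, smul_eq_mul,
      two_mul] at h1
    simp only [cd2, Fin.sum_univ_two, M.Γ_symm _ _ e, M.Γ_symm _ b a]
    linear_combination h1 + M.Γ 0 e b * hs 0 a + M.Γ 1 e b * hs 1 a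
  rw [← M.sum_G_mul_g_mul (fun d => 2 * t (M.Γ d a b)) c]
  simp only [key]

/-- `2 δΓ^c_{cb} = ∂_b (g^{ac} δg_{ac})`. -/
theorem two_trace_variation_Γ (t : Derivation ℝ A A) (ht : ∀ a x, t (M.D a x) = M.D a (t x))
    (h : Fin 2 → Fin 2 → A) (hh : ∀ a b, t (M.g a b) = h a b)
    (b : Fin 2) : 2 * ∑ c, t (M.Γ c c b) = M.D b (M.tr h) := by
  rw [Finset.mul_sum]
  simp only [M.two_variation_Γ t ht h hh, D_tr]
  simp only [Fin.sum_univ_two, G10]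
  have hs (c a b) : M.cd2 h c a b = M.cd2 h c b a := by
    have hs (a b) : h a b = h b a := by rw [← hh, ← hh, M.g_symm]
    simp only [cd2, Fin.sum_univ_two, hs a b, hs _ b, hs a]
    ring
  rw [hs b 1 0]
  ring

/-- `2 g^{ab} δΓ^c_{ab} = g^{ce} (2 ∇^b δg_{be} - ∂_e (g^{ab} δg_{ab}))`. -/
theorem two_contract_variation_Γ (t : Derivation ℝ A A) (ht : ∀ a x, t (M.D a x) = M.D a (t x))
    (h : Fin 2 → Fin 2 → A) (hh : ∀ a b, t (M.g a b) = h a b)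
    (c : Fin 2) : 2 * ∑ a, ∑ b, M.G a b * t (M.Γ c a b) =
      ∑ e, M.G c e * (2 * M.div (M.raise h) e - M.D e (M.tr h)) := by
  have h2 (a b : Fin 2) : 2 * (M.G a b * t (M.Γ c a b)) = M.G a b * (2 * t (M.Γ c a b)) := by ring
  simp only [Finset.mul_sum, h2]
  simp only [M.two_variation_Γ t ht h hh, D_tr, div_raise, Fin.sum_univ_two, G10]
  ring

/-- The contracted Palatini identity. -/
theorem contract_variation_ric (t : Derivation ℝ A A) (ht : ∀ a x, t (M.D a x) = M.D a (t x)) :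
    ∑ a, ∑ b, M.G a b * t (M.ric a b) =
      ∑ c, (M.D c (∑ a, ∑ b, M.G a b * t (M.Γ c a b))
        + ∑ d, M.Γ d d c * ∑ a, ∑ b, M.G a b * t (M.Γ c a b))
      - ∑ a, ∑ b, M.G a b * M.cd1 (fun b => ∑ c, t (M.Γ c c b)) a b := by
  simp only [ric, cd1, Fin.sum_univ_two, map_add, map_sub, Derivation.leibniz, smul_eq_mul, D_G, ht,
    G10, Γ10]
  ring

/-- The divergence of the vector field `Z^c` is `g^{ab} ∇_a Z_b`. -/
theorem div_raise_covector (Z : Fin 2 → A) :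
    ∑ c, (M.D c (∑ e, M.G c e * Z e) + ∑ d, M.Γ d d c * ∑ e, M.G c e * Z e) =
      ∑ a, ∑ b, M.G a b * M.cd1 Z a b := by
  simp only [cd1, Fin.sum_univ_two, map_add, Derivation.leibniz, smul_eq_mul, D_G,
    G10, Γ10]
  ring

/-- The variation of the scalar curvature. -/
theorem variation_scal (t : Derivation ℝ A A) (ht : ∀ a x, t (M.D a x) = M.D a (t x))
    (h : Fin 2 → Fin 2 → A) (hh : ∀ a b, t (M.g a b) = h a b) :
    t M.scal = ∑ a, ∑ b, t (M.G a b) * M.ric a b +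
      ∑ a, ∑ b, M.G a b * M.cd1 (fun e => M.div (M.raise h) e - M.D e (M.tr h)) a b := by
  have e1 : t M.scal = ∑ a, ∑ b, t (M.G a b) * M.ric a b +
      ∑ a, ∑ b, M.G a b * t (M.ric a b) := by
    simp only [scal, tr, Fin.sum_univ_two, map_add, Derivation.leibniz, smul_eq_mul]
    ring
  rw [e1, M.contract_variation_ric t ht]
  congr 1
  apply two_mul_cancel
  have e2 := M.two_contract_variation_Γ t ht h hh
  have e3 := M.two_trace_variation_Γ t ht h hh
  have e4 := M.div_raise_covector (fun e => 2 * M.div (M.raise h) e - M.D e (M.tr h))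
  simp only [← e2] at e4
  have e5 : M.cd1 (fun e => M.D e (M.tr h)) =
      fun a b => 2 * M.cd1 (fun b => ∑ c, t (M.Γ c c b)) a b := by
    funext a b
    simp only [← e3, cd1, two_mul, map_add, Fin.sum_univ_two]
    ring
  have e5' := fun a b => congrFun (congrFun e5 a) b
  have e6 : ∀ a b, M.cd1 (fun e => 2 * M.div (M.raise h) e - M.D e (M.tr h)) a b =
      2 * M.cd1 (fun e => M.div (M.raise h) e - M.D e (M.tr h)) a b
        + M.cd1 (fun e => M.D e (M.tr h)) a b := by
    intro a b
    simp only [cd1, two_mul, map_add, map_sub, Fin.sum_univ_two]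
    ring
  simp only [e6, e5'] at e4
  simp only [two_mul, map_add, Fin.sum_univ_two] at e4 ⊢
  linear_combination e4

end FormalMetric

/-! ### Propagation of the Hamiltonian constraint function -/

/-- The algebraic content of a solution of the evolution equations: a metric, a time derivation `t`
and fields `N, k, φ, p` subject to the equations. The equation `t_p` is that of `p` after
`σ^{ab} ∂_t σ_{ab} = -2 (Nτ + ∂_t λ)` has been inserted. -/
structure FormalSolution (A : Type*) [CommRing A] [Algebra ℝ A] extends FormalMetric A where
  t : Derivation ℝ A A
  t_D : ∀ a x, t (D a x) = D a (t x)
  N : A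
  k : Fin 2 → Fin 2 → A
  φ : A
  p : A
  k_symm : ∀ a b, k a b = k b a
  t_g : ∀ a b, t (g a b) = -(2 * N * k a b)
  t_k : ∀ a b, t (k a b) = N * toFormalMetric.ric a b
    - 2 * N * ∑ c, k a c * toFormalMetric.raise k b c
    + N * toFormalMetric.tr k * k a b - toFormalMetric.hess N a b - 2 * N * (D a φ * D b φ)
  t_φ : t φ = N * p
  t_p : t p = N * toFormalMetric.tr k * p
    + ∑ a, ∑ b, G a b * (N * toFormalMetric.hess φ a b + D a N * D b φ)

namespace FormalSolution

variable {A : Type*} [CommRing A] [Algebra ℝ A] (S : FormalSolution A)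

open FormalMetric

/-- `k_a^b`. -/
abbrev m : Fin 2 → Fin 2 → A := S.raise S.k

/-- The mean curvature. -/
abbrev τ : A := S.tr S.k

/-- `k_a^b k_b^a`. -/
def kk : A := ∑ a, ∑ b, S.m a b * S.m b a

/-- `|∇φ|²`. -/
def grad2 : A := ∑ a, ∑ b, S.G a b * (S.D a S.φ * S.D b S.φ)

/-- `-2 C₀`. -/
def H : A := S.scal - S.kk + S.τ ^ 2 - 2 * S.p ^ 2 - 2 * S.grad2

/-- The momentum constraint function `C_a`. -/
def C (a : Fin 2) : A := -(S.div S.m a - S.D a S.τ + 2 * S.p * S.D a S.φ)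

theorem k10 : S.k 1 0 = S.k 0 1 := S.k_symm 1 0

theorem t_G (a b : Fin 2) : S.t (S.G a b) = 2 * S.N * ∑ c, S.G a c * S.m c b := by
  rw [S.derivation_G]
  simp only [S.t_g, raise, Fin.sum_univ_two, S.G_symm _ b]
  ring

/-- The source of the evolution equation of `k_a^b`. -/
def Q (a b : Fin 2) : A := S.N * S.ric a b + S.N * S.τ * S.k a b - S.hess S.N a b
  - 2 * S.N * (S.D a S.φ * S.D b S.φ)

/-- In mixed components the quadratic terms in `k` of the evolution equation cancel. -/
theorem t_m (a b : Fin 2) : S.t (S.m a b) = S.raise S.Q a b := by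
  simp only [raise, Fin.sum_univ_two, map_add, Derivation.leibniz, smul_eq_mul, S.t_G, S.t_k, Q]
  fin_cases a <;> fin_cases b <;> simp only [Fin.zero_eta, Fin.mk_one, G10, k10,
    Fin.isValue] <;> ring

theorem t_τ : S.t S.τ = S.tr S.Q := by
  have h : ∀ T, S.tr T = S.raise T 0 0 + S.raise T 1 1 := by
    intro T
    simp only [tr, raise, Fin.sum_univ_two, S.G10]
  rw [h, τ, h, map_add, S.t_m, S.t_m]

theorem tr_Q : S.tr S.Q = S.N * S.scal + S.N * S.τ ^ 2 - S.tr (S.hess S.N)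
    - 2 * S.N * S.grad2 := by
  simp only [scal, tr, Q, grad2, Fin.sum_univ_two]
  ring

/-- The divergence of `N k_a^b`. -/
theorem div_N_m (a : Fin 2) : S.div (fun a b => S.N * S.m a b) a =
    S.N * (S.D a S.τ - 2 * S.p * S.D a S.φ - S.C a) + ∑ b, S.m a b * S.D b S.N := by
  simp only [C, div, Fin.sum_univ_two, Derivation.leibniz, smul_eq_mul]
  ring

/-- The evolution of the scalar curvature. -/
theorem t_scal : S.t S.scal = ∑ a, ∑ b, S.t (S.G a b) * S.ric a b +
    2 * ∑ a, ∑ b, S.G a b * S.cd1 (fun e =>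
      S.D e (S.N * S.τ) - S.div (fun a b => S.N * S.m a b) e) a b := by
  rw [S.variation_scal S.t S.t_D (fun a b => -(2 * S.N * S.k a b)) S.t_g]
  congr 1
  have h1 (e) : S.div (S.raise fun a b => -(2 * S.N * S.k a b)) e =
      -(2 * S.div (fun a b => S.N * S.m a b) e) := by
    simp only [div, raise, Fin.sum_univ_two, Derivation.leibniz, smul_eq_mul, map_add, map_neg,
      two_mul, add_mul]
    ring
  have h2 : S.tr (fun a b => -(2 * S.N * S.k a b)) = -(2 * (S.N * S.τ)) := by
    simp only [tr, Fin.sum_univ_two]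
    ring
  simp only [h1, h2]
  generalize S.N * S.τ = x
  generalize S.div (fun a b => S.N * S.m a b) = y
  simp only [cd1, Fin.sum_univ_two, map_neg, two_mul, map_add, map_sub]
  ring

/-- The divergence of the covector `k_a^c ∂_c f`. -/
theorem div_contract (f : A) : ∑ a, ∑ b, S.G a b * S.cd1 (fun e => ∑ c, S.m e c * S.D c f) a b =
    ∑ a, ∑ b, (S.G a b * S.div S.m a * S.D b f + S.hess f a b * ∑ c, S.G a c * S.m c b) := by
  simp only [cd1, hess, div, raise, Fin.sum_univ_two, map_add, Derivation.leibniz, smul_eq_mul,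
    D_G, G10, Γ10, k10]
  ring

end FormalSolution

/-! ### Propagation of the momentum constraint functions -/

namespace FormalSolution

variable {A : Type*} [CommRing A] [Algebra ℝ A] (S : FormalSolution A)

open FormalMetric

theorem div_m (a : Fin 2) : S.div S.m a = S.D a S.τ - 2 * S.p * S.D a S.φ - S.C a := by
  simp only [C]
  ring

/-- The second-order terms of the evolution of the scalar curvature, expressed through the momentum
constraint functions. -/
theorem div_cd1_source : ∑ a, ∑ b, S.G a b * S.cd1 (fun e =>
      S.D e (S.N * S.τ) - S.div (fun a b => S.N * S.m a b) e) a b =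
    ∑ a, ∑ b, (S.G a b * (S.N * S.cd1 S.C a b + 2 * S.D a S.N * S.C b + S.τ * S.hess S.N a b
      + 2 * S.N * S.p * S.hess S.φ a b + 4 * S.p * S.D a S.N * S.D b S.φ
      + 2 * S.N * S.D a S.p * S.D b S.φ)
      - S.hess S.N a b * ∑ c, S.G a c * S.m c b) := by
  have h1 (e) : S.D e (S.N * S.τ) - S.div (fun a b => S.N * S.m a b) e =
      S.τ * S.D e S.N + 2 * (S.N * S.p * S.D e S.φ) + S.N * S.C e - ∑ c, S.m e c * S.D c S.N := by
    rw [S.div_N_m, Derivation.leibniz, smul_eq_mul, smul_eq_mul]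
    ring
  have h2 := S.div_contract S.N
  simp only [h1, S.div_m] at h2 ⊢
  generalize hx : (fun e => ∑ c, S.m e c * S.D c S.N) = x at h2 ⊢
  have hx' : ∀ e, ∑ c, S.m e c * S.D c S.N = x e := fun e => congrFun hx e
  simp only [hx']
  simp only [cd1, hess, Fin.sum_univ_two, map_add, map_sub, Derivation.leibniz, smul_eq_mul,
    two_mul, G10, Γ10] at h2 ⊢
  linear_combination -h2

theorem t_kk : S.t S.kk = 2 * ∑ a, ∑ b, S.m b a * S.raise S.Q a b := by
  simp only [kk, Fin.sum_univ_two, map_add, Derivation.leibniz, smul_eq_mul, S.t_m]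
  ring

theorem t_grad2 :
    S.t S.grad2 = ∑ a, ∑ b, (2 * S.N * (∑ c, S.G a c * S.m c b) * (S.D a S.φ * S.D b S.φ)
    + 2 * S.G a b * (S.D a S.φ * (S.N * S.D b S.p + S.p * S.D b S.N))) := by
  simp only [grad2, Fin.sum_univ_two, map_add, Derivation.leibniz, smul_eq_mul, S.t_G, S.t_D, S.t_φ,
    raise, G10, k10]
  ring

/-- Propagation of the Hamiltonian constraint. -/
theorem t_H : S.t S.H = 2 * S.N * S.τ * S.H
    + 2 * S.N * (∑ a, ∑ b, S.G a b * S.cd1 S.C a b)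
    + 4 * ∑ a, ∑ b, S.G a b * (S.D a S.N * S.C b) := by
  have h (x : A) : S.t (x ^ 2) = 2 * x * S.t x := by
    rw [pow_two, Derivation.leibniz, smul_eq_mul]; ring
  have h2 : S.t (2 : A) = 0 := by simpa using S.t.map_natCast 2
  have e : S.t S.H = S.t S.scal - S.t S.kk + 2 * S.τ * S.t S.τ - 4 * S.p * S.t S.p
      - 2 * S.t S.grad2 := by
    simp only [H, map_add, map_sub, Derivation.leibniz, smul_eq_mul, h, h2]
    ring
  rw [e, S.t_scal, S.div_cd1_source, S.t_kk, S.t_τ, S.tr_Q, S.t_grad2, S.t_p]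
  have hr := S.ric_symm 1 0
  have hh := S.hess_symm S.φ 1 0
  have hN := S.hess_symm S.N 1 0
  generalize S.cd1 S.C = dC
  simp only [H, kk, S.t_G]
  simp only [τ, tr, grad2, m, Q, raise, Fin.sum_univ_two, G10, k10, hr, hh, hN]
  ring

theorem two_raise_ric (a b : Fin 2) : 2 * S.raise S.ric a b = if a = b then S.scal else 0 := by
  have h : 2 * S.raise S.ric a b = S.scal * ∑ c, S.G b c * S.g c a := by
    simp only [raise, Fin.sum_univ_two, S.g_symm _ a]
    linear_combination S.G b 0 * S.two_ric a 0 + S.G b 1 * S.two_ric a 1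
  rw [h, S.G_mul_g]
  simp [eq_comm]

/-- The contracted Bianchi identity, with the weight `N`. -/
theorem two_div_raise_ric (a : Fin 2) :
    2 * S.div (fun a b => S.N * S.raise S.ric a b) a = S.D a (S.N * S.scal) := by
  have h (c a b) : S.D c (S.N * S.raise S.ric a b) + S.D c (S.N * S.raise S.ric a b) =
      if a = b then S.D c (S.N * S.scal) else 0 := by
    rw [← map_add, ← two_mul, mul_left_comm, two_raise_ric]
    split_ifs <;> simp
  have h2 := S.two_raise_ric
  generalize S.raise S.ric = r at *
  simp only [div, Fin.sum_univ_two, two_mul, Derivation.leibniz, smul_eq_mul] at h h2 ⊢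
  have h00 := h2 0 0
  have h01 := h2 0 1
  have h10 := h2 1 0
  have h11 := h2 1 1
  fin_cases a <;> simp at h00 h01 h10 h11 ⊢
  · have k0 := h 0 0 0
    have k1 := h 1 0 1
    simp at k0 k1
    linear_combination k0 + k1 + S.N * (S.Γ 1 1 0 * (h00 - h11) + (S.Γ 0 0 1 + S.Γ 1 1 1
      - S.Γ 0 1 0) * h01 - S.Γ 1 0 0 * h10)
  · have k0 := h 0 1 0
    have k1 := h 1 1 1
    simp at k0 k1
    linear_combination k0 + k1 + S.N * (S.Γ 0 0 1 * (h11 - h00) + (S.Γ 0 0 0 + S.Γ 1 1 0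
      - S.Γ 1 0 1) * h10 - S.Γ 0 1 1 * h01)

theorem div_smul (f : A) (n : Fin 2 → Fin 2 → A) (a : Fin 2) :
    S.div (fun a b => f * n a b) a = ∑ b, S.D b f * n a b + f * S.div n a := by
  simp only [div, Fin.sum_univ_two, Derivation.leibniz, smul_eq_mul]
  ring

theorem D_grad2 (a : Fin 2) :
    S.D a S.grad2 = 2 * ∑ b, ∑ c, S.G b c * (S.hess S.φ a b * S.D c S.φ) := by
  have := S.D_tr (fun a b => S.D a S.φ * S.D b S.φ) a
  change S.D a (S.tr _) = _
  rw [this]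
  simp only [cd2, hess, cd1, Fin.sum_univ_two, Derivation.leibniz, smul_eq_mul, G10]
  ring

theorem div_raise_grad_grad (a : Fin 2) :
    S.div (S.raise fun a b => S.D a S.φ * S.D b S.φ) a =
      (∑ b, ∑ c, S.G b c * S.hess S.φ b c) * S.D a S.φ
        + ∑ b, ∑ c, S.G b c * (S.hess S.φ a b * S.D c S.φ) := by
  rw [div_raise]
  simp only [S.hess_symm S.φ a]
  simp only [cd2, hess, cd1, Fin.sum_univ_two, Derivation.leibniz, smul_eq_mul, G10, Γ10]
  ring

/-- The divergence of the source of `k_a^b`. The commutator of `∇^b` and `∇_a` on `∂N` and the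
contracted Bianchi identity produce the terms in the scalar curvature. -/
theorem two_div_raise_Q (a : Fin 2) : 2 * S.div (S.raise S.Q) a =
    S.D a (S.N * S.scal) + 2 * (∑ b, S.D b (S.N * S.τ) * S.m a b) + 2 * S.N * S.τ * S.div S.m a
    - 2 * S.D a (S.tr (S.hess S.N)) - S.scal * S.D a S.N
    - 4 * (∑ b, ∑ c, S.G b c * (S.N * S.hess S.φ b c + S.D b S.N * S.D c S.φ)) * S.D a S.φ
    - 2 * S.N * S.D a S.grad2 := by
  have h : S.raise S.Q = fun a b => S.N * S.raise S.ric a b + (S.N * S.τ) * S.m a b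
      - S.raise (S.hess S.N) a b
      - 2 * (S.N * S.raise (fun a b => S.D a S.φ * S.D b S.φ) a b) := by
    funext a b
    simp only [Q, raise, Fin.sum_univ_two]
    ring
  have h1 (x y z w : Fin 2 → Fin 2 → A) : S.div (fun a b => x a b + y a b - z a b - 2 * w a b) a =
      S.div x a + S.div y a - S.div z a - 2 * S.div w a := by
    simp only [div, Fin.sum_univ_two, map_add, map_sub, two_mul]
    ring
  rw [h, h1 (fun a b => S.N * S.raise S.ric a b) (fun a b => (S.N * S.τ) * S.m a b),
    div_smul S (S.N * S.τ),
    div_smul S S.N (S.raise fun a b => S.D a S.φ * S.D b S.φ), D_grad2, div_raise_grad_grad]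
  have e1 := S.two_div_raise_ric a
  have e2 := S.two_div_hess S.N a
  simp only [raise, Fin.sum_univ_two] at e1 e2 ⊢
  linear_combination e1 - e2

theorem D_kk (a : Fin 2) :
    S.D a S.kk = 2 * ∑ b, ∑ c, ∑ e, S.G c e * S.m c b * S.cd2 S.k a e b := by
  simp only [kk, cd2, raise, Fin.sum_univ_two, map_add, Derivation.leibniz, smul_eq_mul, D_G, G10,
    k10]
  ring

/-- `k_c^b ∂_t Γ^c_{ab}` involves only derivatives in the direction `a`. -/
theorem two_t_Γ_m (a : Fin 2) : 2 * ∑ b, ∑ c, S.t (S.Γ c b a) * S.m c b =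
    - (2 * S.D a S.N * S.kk + S.N * S.D a S.kk) := by
  have h (c b) := S.two_variation_Γ S.t S.t_D (fun a b => -(2 * S.N * S.k a b)) S.t_g c b a
  have h1 (x y z) : S.cd2 (fun a b => -(2 * S.N * S.k a b)) x y z =
      - 2 * (S.D x S.N * S.k y z + S.N * S.cd2 S.k x y z) := by
    simp only [cd2, Fin.sum_univ_two, map_neg, Derivation.leibniz, smul_eq_mul, two_mul, map_add]
    ring
  have h2 : 2 * ∑ b, ∑ c, S.t (S.Γ c b a) * S.m c b =
      ∑ b, ∑ c, (2 * S.t (S.Γ c b a)) * S.m c b := by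
    simp only [Finset.mul_sum, mul_assoc]
  rw [h2]
  simp only [h, h1, D_kk]
  generalize S.cd2 S.k = dk
  simp only [kk, raise, Fin.sum_univ_two, G10, k10]
  ring

theorem t_div_m (a : Fin 2) : S.t (S.div S.m a) = S.div (S.raise S.Q) a
    - (∑ c, S.D c (S.N * S.τ) * S.m a c) - ∑ b, ∑ c, S.t (S.Γ c b a) * S.m c b := by
  have h (b) : ∑ c, S.t (S.Γ c c b) = -S.D b (S.N * S.τ) := by
    apply two_mul_cancel
    rw [S.two_trace_variation_Γ S.t S.t_D (fun a b => -(2 * S.N * S.k a b)) S.t_g]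
    have h2 : S.tr (fun a b => -(2 * S.N * S.k a b)) = -(2 * (S.N * S.τ)) := by
      simp only [tr, Fin.sum_univ_two]
      ring
    rw [h2]
    simp only [map_neg, two_mul, map_add]
    ring
  have h0 := h 0
  have h1 := h 1
  have hm (c a b) : S.t (S.D c (S.m a b)) = S.D c (S.raise S.Q a b) := by
    rw [S.t_D, S.t_m]
  have hm' := S.t_m
  generalize S.raise S.Q = q at *
  generalize S.m = n at *
  simp only [div, Fin.sum_univ_two, map_add, map_sub, Derivation.leibniz, smul_eq_mul, hm,
    hm'] at h0 h1 ⊢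
  linear_combination n a 0 * h0 + n a 1 * h1

/-- Propagation of the momentum constraint. -/
theorem two_t_C (a : Fin 2) : 2 * S.t (S.C a) = 2 * S.N * S.τ * S.C a + 2 * S.D a S.N * S.H
    + S.N * S.D a S.H := by
  have h (x : A) : S.D a (x ^ 2) = 2 * x * S.D a x := by
    rw [pow_two, Derivation.leibniz, smul_eq_mul]; ring
  have h2 : S.t (2 : A) = 0 := by simpa using S.t.map_natCast 2
  have h2' : S.D a (2 : A) = 0 := by simpa using (S.D a).map_natCast 2
  have e1 := S.two_div_raise_Q a
  have e2 := S.two_t_Γ_m a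
  have e3 := S.t_div_m a
  have e4 := S.div_m a
  have e5 : S.t (S.C a) = -(S.t (S.div S.m a) - S.D a (S.tr S.Q)
      + 2 * (S.t S.p * S.D a S.φ + S.p * S.D a (S.N * S.p))) := by
    simp only [C, map_neg, map_add, map_sub, Derivation.leibniz, smul_eq_mul, S.t_D, h2, S.t_τ,
      S.t_φ]
    ring
  rw [e5, e3, S.tr_Q, S.t_p]
  simp only [H, map_add, map_sub, Derivation.leibniz, smul_eq_mul, h, h2'] at e1 e2 ⊢
  rw [e4] at e1
  linear_combination -e1 + e2

end FormalSolution

/-! ### Algebras of real-analytic functions -/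

namespace FormalMetric

/-- The Levi-Civita connection of a metric with given inverse. -/
def ofMetric {A : Type*} [CommRing A] [Algebra ℝ A] (D : Fin 2 → Derivation ℝ A A)
    (g G : Fin 2 → Fin 2 → A) (D_comm : ∀ a b x, D a (D b x) = D b (D a x))
    (g_symm : ∀ a b, g a b = g b a) (G_symm : ∀ a b, G a b = G b a)
    (G_mul_g : ∀ a b, ∑ c, G a c * g c b = if a = b then 1 else 0) : FormalMetric A where
  D := D
  g := g
  G := G
  Γ c a b := algebraMap ℝ A (1 / 2) * ∑ d, G c d * (D a (g d b) + D b (g d a) - D d (g a b))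
  D_comm := D_comm
  g_symm := g_symm
  G_symm := G_symm
  G_mul_g := G_mul_g
  Γ_symm c a b := by simp only [g_symm a b, add_comm]
  D_g c a b := by
    have h2 : algebraMap ℝ A (1 / 2) * 2 = 1 := by
      rw [← map_ofNat (algebraMap ℝ A) 2, ← map_mul]
      norm_num
    have h (x : Fin 2 → A) (b) : ∑ d, (∑ e, G d e * x e) * g d b = x b := by
      have e : ∑ d, (∑ e, G d e * x e) * g d b = ∑ e, (∑ d, G e d * g d b) * x e := by
        simp only [Fin.sum_univ_two, G_symm 1 0]
        ring
      rw [e]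
      simp [G_mul_g]
    have e1 := h (fun d => D c (g d a) + D a (g d c) - D d (g c a)) b
    have e2 := h (fun d => D c (g d b) + D b (g d c) - D d (g c b)) a
    simp only [Fin.sum_univ_two] at e1 e2 ⊢
    simp only [g_symm b a, g_symm b c, g_symm a c, g_symm a 0, g_symm a 1] at e1 e2 ⊢
    linear_combination -(algebraMap ℝ A (1 / 2)) * e1 - algebraMap ℝ A (1 / 2) * e2
      - D c (g a b) * h2

end FormalMetric

open TopologicalSpace (Opens)

/-- The algebra of real-analytic functions on an open subset of spacetime, as functions on the
subset. -/
def analyticAlgebra (Ω : Opens (ℝ × Plane)) : Subalgebra ℝ (Ω → ℝ) where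
  carrier := {f | ∃ F : ℝ × Plane → ℝ, AnalyticOnNhd ℝ F Ω ∧ ∀ q : Ω, f q = F q}
  mul_mem' := by
    rintro f g ⟨F, hF, hf⟩ ⟨G, hG, hg⟩
    exact ⟨F * G, hF.mul hG, fun q => by simp [hf, hg]⟩
  add_mem' := by
    rintro f g ⟨F, hF, hf⟩ ⟨G, hG, hg⟩
    exact ⟨F + G, hF.add hG, fun q => by simp [hf, hg]⟩
  algebraMap_mem' r := ⟨fun _ => r, analyticOnNhd_const, fun _ => rfl⟩

namespace analyticAlgebra

variable {Ω : Opens (ℝ × Plane)}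

/-- The restriction of an analytic function. -/
def ofFun (F : ℝ × Plane → ℝ) (hF : AnalyticOnNhd ℝ F Ω) : analyticAlgebra Ω :=
  ⟨fun q => F q, F, hF, fun _ => rfl⟩

/-- Evaluation at a point. -/
def ev (q : Ω) : analyticAlgebra Ω →ₐ[ℝ] ℝ :=
  (Pi.evalAlgHom ℝ (fun _ : Ω => ℝ) q).comp (analyticAlgebra Ω).val

@[ext]
theorem ext {x y : analyticAlgebra Ω} (h : ∀ q, ev q x = ev q y) : x = y :=
  Subtype.ext (funext h)

theorem exists_eq_ofFun (x : analyticAlgebra Ω) : ∃ F hF, x = ofFun F hF := by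
  obtain ⟨F, hF, h⟩ := x.2
  exact ⟨F, hF, ext h⟩

@[simp]
theorem ev_ofFun (F : ℝ × Plane → ℝ) (hF : AnalyticOnNhd ℝ F Ω) (q : Ω) :
    ev q (ofFun F hF) = F q := rfl

theorem fderiv_congr_on {F G : ℝ × Plane → ℝ} (h : ∀ q : Ω, F q = G q) (q : Ω) :
    fderiv ℝ F q = fderiv ℝ G q := by
  apply Filter.EventuallyEq.fderiv_eq
  filter_upwards [Ω.isOpen.mem_nhds q.2] with z hz using h ⟨z, hz⟩

theorem analyticOnNhd_fderiv {F : ℝ × Plane → ℝ} (hF : AnalyticOnNhd ℝ F Ω) (v : ℝ × Plane) :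
    AnalyticOnNhd ℝ (fun q => fderiv ℝ F q v) Ω := fun q hq =>
  ((ContinuousLinearMap.apply ℝ ℝ v).analyticAt _).comp (hF q hq).fderiv

/-- The derivative of an element along a constant vector field. It does not depend on the chosen
extension, since the domain is open. -/
def dirFun (v : ℝ × Plane) (x : analyticAlgebra Ω) : analyticAlgebra Ω :=
  ofFun (fun q => fderiv ℝ (exists_eq_ofFun x).choose q v)
    (analyticOnNhd_fderiv (exists_eq_ofFun x).choose_spec.choose v)

theorem dirFun_ofFun (v : ℝ × Plane) (F : ℝ × Plane → ℝ) (hF : AnalyticOnNhd ℝ F Ω) :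
    dirFun v (ofFun F hF) = ofFun (fun q => fderiv ℝ F q v) (analyticOnNhd_fderiv hF v) := by
  ext q
  simp only [dirFun, ev_ofFun]
  rw [fderiv_congr_on]
  intro q
  have h := (exists_eq_ofFun (ofFun F hF)).choose_spec.choose_spec
  have := congrArg (ev q) h
  simpa using this.symm

theorem dirFun_add (v : ℝ × Plane) (x y : analyticAlgebra Ω) :
    dirFun v (x + y) = dirFun v x + dirFun v y := by
  obtain ⟨F, hF, rfl⟩ := exists_eq_ofFun x
  obtain ⟨G, hG, rfl⟩ := exists_eq_ofFun y
  have h : ofFun F hF + ofFun G hG = ofFun (F + G) (hF.add hG) := rfl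
  rw [h, dirFun_ofFun, dirFun_ofFun, dirFun_ofFun]
  ext q
  have h1 := (hF q q.2).differentiableAt
  have h2 := (hG q q.2).differentiableAt
  simp [fderiv_add h1 h2]

theorem dirFun_smul (v : ℝ × Plane) (r : ℝ) (x : analyticAlgebra Ω) :
    dirFun v (r • x) = r • dirFun v x := by
  obtain ⟨F, hF, rfl⟩ := exists_eq_ofFun x
  have h : r • ofFun F hF = ofFun (fun q => r * F q) (analyticOnNhd_const.mul hF) := rfl
  rw [h, dirFun_ofFun, dirFun_ofFun]
  ext q
  have h1 := (hF q q.2).differentiableAt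
  simp [fderiv_const_mul h1]

theorem dirFun_mul (v : ℝ × Plane) (x y : analyticAlgebra Ω) :
    dirFun v (x * y) = x * dirFun v y + y * dirFun v x := by
  obtain ⟨F, hF, rfl⟩ := exists_eq_ofFun x
  obtain ⟨G, hG, rfl⟩ := exists_eq_ofFun y
  have h : ofFun F hF * ofFun G hG = ofFun (F * G) (hF.mul hG) := rfl
  rw [h, dirFun_ofFun, dirFun_ofFun, dirFun_ofFun]
  ext q
  have h1 := (hF q q.2).differentiableAt
  have h2 := (hG q q.2).differentiableAt
  simp [fderiv_mul h1 h2]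

/-- The derivation along a constant vector field. -/
def dir (v : ℝ × Plane) : Derivation ℝ (analyticAlgebra Ω) (analyticAlgebra Ω) :=
  Derivation.mk'
    { toFun := dirFun v
      map_add' := dirFun_add v
      map_smul' := dirFun_smul v }
    (dirFun_mul v)

theorem dir_ofFun (v : ℝ × Plane) (F : ℝ × Plane → ℝ) (hF : AnalyticOnNhd ℝ F Ω) :
    dir v (ofFun F hF) = ofFun (fun q => fderiv ℝ F q v) (analyticOnNhd_fderiv hF v) :=
      dirFun_ofFun v F hF

theorem dir_comm (v w : ℝ × Plane) (x : analyticAlgebra Ω) : dir v (dir w x) = dir w (dir v x) := by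
  obtain ⟨F, hF, rfl⟩ := exists_eq_ofFun x
  simp only [dir_ofFun]
  ext q
  have hd : DifferentiableAt ℝ (fderiv ℝ F) q := (hF q q.2).fderiv.differentiableAt
  have hs : IsSymmSndFDerivAt ℝ F q :=
    ContDiffAt.isSymmSndFDerivAt (n := ω) (hF q q.2).contDiffAt (by simp)
  have h (v w) : fderiv ℝ (fun q => fderiv ℝ F q v) q w = fderiv ℝ (fderiv ℝ F) q w v := by
    rw [fderiv_clm_apply hd (differentiableAt_const v)]
    simp
  simp only [ev_ofFun, h]
  exact hs v w

/-- The element `x` is the restriction of the function `f`. -/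
def Rep (x : analyticAlgebra Ω) (f : ℝ → Plane → ℝ) : Prop := ∀ q : Ω, ev q x = f q.1.1 q.1.2

theorem rep_ofFun {f : ℝ → Plane → ℝ} (h : AnalyticOnNhd ℝ (fun q : ℝ × Plane => f q.1 q.2) Ω) :
    Rep (ofFun _ h) f := fun _ => rfl

theorem Rep.analyticOnNhd {x : analyticAlgebra Ω} {f : ℝ → Plane → ℝ} (h : Rep x f) :
    AnalyticOnNhd ℝ (fun q : ℝ × Plane => f q.1 q.2) Ω := by
  obtain ⟨F, hF, rfl⟩ := exists_eq_ofFun x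
  intro q hq
  refine (hF q hq).congr ?_
  filter_upwards [Ω.isOpen.mem_nhds hq] with z hz using h ⟨z, hz⟩

theorem Rep.eq_ofFun {x : analyticAlgebra Ω} {f : ℝ → Plane → ℝ} (h : Rep x f) :
    x = ofFun _ h.analyticOnNhd := ext h

theorem Rep.dx {x : analyticAlgebra Ω} {f : ℝ → Plane → ℝ} (h : Rep x f) (a : Fin 2) :
    Rep (dir (0, EuclideanSpace.single a 1) x) fun t u => partialD a (f t) u := by
  intro q
  have hd := (h.analyticOnNhd q q.2).differentiableAt.hasFDerivAt
  rw [h.eq_ofFun, dir_ofFun, ev_ofFun]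
  have h2 : HasFDerivAt (fun u : Plane => (q.1.1, u)) (ContinuousLinearMap.inr ℝ ℝ Plane) q.1.2 :=
    hasFDerivAt_prodMk_right _ _
  have h3 := (HasFDerivAt.comp (g := fun q : ℝ × Plane => f q.1 q.2) q.1.2 hd h2).fderiv
  change fderiv ℝ (f q.1.1) q.1.2 = _ at h3
  simp [partialD, h3]

theorem Rep.dt {x : analyticAlgebra Ω} {f : ℝ → Plane → ℝ} (h : Rep x f) :
    Rep (dir (1, 0) x) fun t u => deriv (fun s => f s u) t := by
  intro q
  have hd := (h.analyticOnNhd q q.2).differentiableAt.hasFDerivAt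
  rw [h.eq_ofFun, dir_ofFun, ev_ofFun]
  have h2 : HasDerivAt (fun s : ℝ => (s, q.1.2)) (1, 0) q.1.1 :=
    (hasDerivAt_id _).prodMk (hasDerivAt_const _ _)
  have h3 := HasFDerivAt.comp_hasDerivAt (l := fun q : ℝ × Plane => f q.1 q.2) q.1.1 hd h2
  exact h3.deriv.symm

end analyticAlgebra

/-! ### Analytic solutions in a coordinate domain -/

section

open TopologicalSpace (Opens)

theorem Matrix.inv_fin_two_apply (B : Matrix (Fin 2) (Fin 2) ℝ) (a b : Fin 2) :
    B⁻¹ a b = (B 0 0 * B 1 1 - B 0 1 * B 1 0)⁻¹ * (B.adjugate a b) := by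
  rw [Matrix.inv_def, Matrix.det_fin_two, Ring.inverse_eq_inv']
  simp

/-- An analytic solution of the evolution equations on `(T, ∞) × V` whose metric is nondegenerate,
in a gauge with `∂_t λ = -v`. -/
structure IsLocalSolution (L : LocalState) (v : Plane → ℝ) (T : ℝ) (V : Set Plane) : Prop where
  isOpen : IsOpen V
  sig : ∀ a b, AnalyticOnNhd ℝ (fun q : ℝ × Plane => L.sig q.1 q.2 a b) (Ioi T ×ˢ V)
  k : ∀ a b, AnalyticOnNhd ℝ (fun q : ℝ × Plane => L.k q.1 q.2 a b) (Ioi T ×ˢ V)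
  phi : AnalyticOnNhd ℝ (fun q : ℝ × Plane => L.phi q.1 q.2) (Ioi T ×ˢ V)
  p : AnalyticOnNhd ℝ (fun q : ℝ × Plane => L.p q.1 q.2) (Ioi T ×ˢ V)
  lam : AnalyticOnNhd ℝ (fun q : ℝ × Plane => L.lam q.1 q.2) (Ioi T ×ˢ V)
  deriv_lam : ∀ t > T, ∀ u ∈ V, deriv (fun s => L.lam s u) t = -v u
  sig_posDef : ∀ t > T, ∀ u ∈ V, (L.sig t u).PosDef
  evolution : L.SolvesEvolution T V

namespace IsLocalSolution

open analyticAlgebra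

variable {L : LocalState} {v : Plane → ℝ} {T : ℝ} {V : Set Plane}

/-- The spacetime domain. -/
def Ω (h : IsLocalSolution L v T V) : Opens (ℝ × Plane) := ⟨Ioi T ×ˢ V, isOpen_Ioi.prod h.isOpen⟩

theorem isUnit_det_sig (h : IsLocalSolution L v T V) {t : ℝ} (ht : t > T) {u : Plane}
    (hu : u ∈ V) : IsUnit (L.sig t u).det :=
  (h.sig_posDef t ht u hu).det_pos.ne'.isUnit

theorem sig_symm (h : IsLocalSolution L v T V) {t : ℝ} (ht : t > T) {u : Plane} (hu : u ∈ V)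
    (a b : Fin 2) :
    L.sig t u a b = L.sig t u b a := by
  simpa using ((h.sig_posDef t ht u hu).1.apply a b).symm

theorem gam_symm (h : IsLocalSolution L v T V) {t : ℝ} (ht : t > T) {u : Plane} (hu : u ∈ V)
    (a b : Fin 2) :
    L.gam t u a b = L.gam t u b a := by
  simp [LocalState.gam, h.sig_symm ht hu a b]

theorem gam_inv (h : IsLocalSolution L v T V) {t : ℝ} (ht : t > T) {u : Plane} (hu : u ∈ V) :
    (L.gam t u)⁻¹ = Real.exp (-L.lam t u) • (L.sig t u)⁻¹ := by
  rw [LocalState.gam]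
  apply Matrix.inv_eq_left_inv
  rw [Matrix.smul_mul, Matrix.mul_smul, smul_smul, ← Real.exp_add,
    Matrix.nonsing_inv_mul _ (h.isUnit_det_sig ht hu)]
  simp

theorem sig_inv_symm (h : IsLocalSolution L v T V) {t : ℝ} (ht : t > T) {u : Plane} (hu : u ∈ V)
    (a b : Fin 2) :
    (L.sig t u)⁻¹ a b = (L.sig t u)⁻¹ b a := by
  simpa using ((h.sig_posDef t ht u hu).inv.1.apply a b).symm

theorem gam_inv_symm (h : IsLocalSolution L v T V) {t : ℝ} (ht : t > T) {u : Plane} (hu : u ∈ V)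
    (a b : Fin 2) : (L.gam t u)⁻¹ a b = (L.gam t u)⁻¹ b a := by
  have := h.sig_inv_symm ht hu a b
  simp [h.gam_inv ht hu, this]

theorem gam_inv_mul (h : IsLocalSolution L v T V) {t : ℝ} (ht : t > T) {u : Plane} (hu : u ∈ V) :
    (L.gam t u)⁻¹ * L.gam t u = 1 := by
  rw [h.gam_inv ht hu, LocalState.gam, Matrix.smul_mul, Matrix.mul_smul, smul_smul, ← Real.exp_add,
    Matrix.nonsing_inv_mul _ (h.isUnit_det_sig ht hu)]
  simp

theorem analytic_gam (h : IsLocalSolution L v T V) (a b : Fin 2) :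
    AnalyticOnNhd ℝ (fun q : ℝ × Plane => L.gam q.1 q.2 a b) (Ioi T ×ˢ V) :=
  h.lam.rexp.mul (h.sig a b)

theorem analytic_sig_inv (h : IsLocalSolution L v T V) (a b : Fin 2) :
    AnalyticOnNhd ℝ (fun q : ℝ × Plane => (L.sig q.1 q.2)⁻¹ a b) (Ioi T ×ˢ V) := by
  simp only [Matrix.inv_fin_two_apply]
  refine AnalyticOnNhd.mul (AnalyticOnNhd.inv
    (((h.sig 0 0).mul (h.sig 1 1)).sub ((h.sig 0 1).mul (h.sig 1 0))) ?_) ?_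
  · rintro q ⟨h1, h2⟩
    have := (h.isUnit_det_sig h1 h2).ne_zero
    rwa [Matrix.det_fin_two] at this
  · have h2 := fun a b => (h.sig a b).neg
    fin_cases a <;> fin_cases b <;> simp [Matrix.adjugate_fin_two, h.sig] <;> exact h2 _ _

theorem analytic_gam_inv (h : IsLocalSolution L v T V) (a b : Fin 2) :
    AnalyticOnNhd ℝ (fun q : ℝ × Plane => (L.gam q.1 q.2)⁻¹ a b) (Ioi T ×ˢ V) := by
  refine (h.lam.neg.rexp.mul (h.analytic_sig_inv a b)).congr h.Ω.isOpen ?_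
  rintro q ⟨h1, h2⟩
  simp [h.gam_inv h1 h2]

/-- The spatial metric as a metric over the algebra of analytic functions. -/
def metric (h : IsLocalSolution L v T V) : FormalMetric (analyticAlgebra h.Ω) :=
  FormalMetric.ofMetric (fun a => dir (0, EuclideanSpace.single a 1))
    (fun a b => ofFun _ (h.analytic_gam a b)) (fun a b => ofFun _ (h.analytic_gam_inv a b))
    (fun _ _ _ => dir_comm _ _ _)
    (fun a b => ext fun q => h.gam_symm q.2.1 q.2.2 a b)
    (fun a b => ext fun q => h.gam_inv_symm q.2.1 q.2.2 a b)
    (fun a b => ext fun q => by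
      have := congrFun (congrFun (h.gam_inv_mul q.2.1 q.2.2) a) b
      rw [Matrix.mul_apply, Matrix.one_apply] at this
      refine Eq.trans ?_ (this.trans (by split_ifs <;> simp))
      rw [map_sum]
      refine Finset.sum_congr rfl fun c _ => ?_
      rw [map_mul]
      rfl)

theorem rep_metric_D (h : IsLocalSolution L v T V) {x : analyticAlgebra h.Ω} {f : ℝ → Plane → ℝ}
    (hx : Rep x f) (a : Fin 2) :
    Rep (h.metric.D a x) fun t u => partialD a (f t) u := hx.dx a

theorem rep_g (h : IsLocalSolution L v T V) (a b : Fin 2) :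
    Rep (h.metric.g a b) fun t u => L.gam t u a b := fun _ => rfl

theorem rep_G (h : IsLocalSolution L v T V) (a b : Fin 2) :
    Rep (h.metric.G a b) fun t u => (L.gam t u)⁻¹ a b := fun _ => rfl

theorem rep_Γ (h : IsLocalSolution L v T V) (c a b : Fin 2) :
    Rep (h.metric.Γ c a b) fun t u => christoffel (L.gam t) c a b u := by
  intro q
  have hD := fun a b c => (h.rep_g a b).dx c q
  simp only [metric, FormalMetric.ofMetric, map_mul, AlgHom.commutes, map_sum, map_add,
    map_sub] at hD ⊢
  simp only [hD, christoffel]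
  rfl

theorem rep_ric (h : IsLocalSolution L v T V) (a b : Fin 2) :
    Rep (h.metric.ric a b) fun t u => ricci (L.gam t) a b u := by
  intro q
  have h1 := fun c a b => h.rep_Γ c a b q
  have h2 := fun c a b d => h.rep_metric_D (h.rep_Γ c a b) d q
  simp only [FormalMetric.ric, map_mul, map_sum, map_add, map_sub, h1, h2, ricci]

theorem rep_scal (h : IsLocalSolution L v T V) :
    Rep h.metric.scal fun t u => scalarCurv (L.gam t) u := by
  intro q
  have h1 := fun a b => h.rep_ric a b q
  have h2 := fun a b => h.rep_G a b q
  simp only [FormalMetric.scal, FormalMetric.tr, map_mul, map_sum, h1, h2, scalarCurv]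

theorem rep_cd1 (h : IsLocalSolution L v T V) {W : Fin 2 → analyticAlgebra h.Ω}
    {w : ℝ → Plane → Fin 2 → ℝ}
    (hW : ∀ a, Rep (W a) fun t u => w t u a) (a b : Fin 2) :
    Rep (h.metric.cd1 W a b) fun t u => covDCovector (L.gam t) (w t) a b u := by
  intro q
  have h1 := fun c a b => h.rep_Γ c a b q
  have h2 := fun c a => h.rep_metric_D (hW c) a q
  have h3 := fun c => hW c q
  simp only [FormalMetric.cd1, map_mul, map_sum, map_sub, h1, h2, h3, covDCovector]

theorem rep_hess (h : IsLocalSolution L v T V) {x : analyticAlgebra h.Ω} {f : ℝ → Plane → ℝ}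
    (hx : Rep x f) (a b : Fin 2) :
    Rep (h.metric.hess x a b) fun t u => hessian (L.gam t) (f t) a b u :=
  h.rep_cd1 (w := fun t u c => partialD c (f t) u) (fun c => h.rep_metric_D hx c) a b

theorem rep_div (h : IsLocalSolution L v T V) {m : Fin 2 → Fin 2 → analyticAlgebra h.Ω}
    {n : ℝ → Plane → Matrix (Fin 2) (Fin 2) ℝ}
    (hm : ∀ a b, Rep (m a b) fun t u => n t u a b) (a : Fin 2) :
    Rep (h.metric.div m a) fun t u => divMixed (L.gam t) (n t) a u := by
  intro q
  have h1 := fun c a b => h.rep_Γ c a b q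
  have h2 := fun c a b => h.rep_metric_D (hm a b) c q
  have h3 := fun c b => hm c b q
  simp only [FormalMetric.div, map_mul, map_sum, map_add, map_sub, h1, h2, h3, divMixed]

/-- The second fundamental form over the algebra of analytic functions. -/
def formalK (h : IsLocalSolution L v T V) (a b : Fin 2) : analyticAlgebra h.Ω := ofFun _ (h.k a b)

theorem rep_k (h : IsLocalSolution L v T V) (a b : Fin 2) :
    Rep (h.formalK a b) fun t u => L.k t u a b := fun _ => rfl

theorem rep_m (h : IsLocalSolution L v T V) (a b : Fin 2) :
    Rep (h.metric.raise h.formalK a b) fun t u => L.kMixed t u a b := by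
  intro q
  have h1 := fun a b => h.rep_k a b q
  have h2 := fun a b => h.rep_G a b q
  simp only [FormalMetric.raise, map_mul, map_sum, h1, h2, LocalState.kMixed, Matrix.of_apply]

theorem rep_τ (h : IsLocalSolution L v T V) : Rep (h.metric.tr h.formalK) fun t u => L.tau t u := by
  intro q
  have h1 := fun a b => h.rep_k a b q
  have h2 := fun a b => h.rep_G a b q
  simp only [FormalMetric.tr, map_mul, map_sum, h1, h2, LocalState.tau]

/-- The lapse over the algebra of analytic functions. -/
def formalN (h : IsLocalSolution L v T V) : analyticAlgebra h.Ω := ofFun _ h.lam.rexp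

theorem rep_N (h : IsLocalSolution L v T V) : Rep h.formalN fun t u => Real.exp (L.lam t u) :=
    fun _ => rfl

end IsLocalSolution

end

/-! ### The constraint propagation system -/

section

open TopologicalSpace (Opens)

theorem hasDerivAt_fst_of_analyticAt {f : ℝ → Plane → ℝ} {t : ℝ} {u : Plane}
    (hf : AnalyticAt ℝ (fun q : ℝ × Plane => f q.1 q.2) (t, u)) :
    HasDerivAt (fun s => f s u) (deriv (fun s => f s u) t) t := by
  apply DifferentiableAt.hasDerivAt
  exact hf.differentiableAt.comp t (f := fun s : ℝ => (s, u)) (by fun_prop)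

namespace IsLocalSolution

open analyticAlgebra

variable {L : LocalState} {v : Plane → ℝ} {T : ℝ} {V : Set Plane}

theorem hasDerivAt_lam (h : IsLocalSolution L v T V) {t : ℝ} (ht : t > T) {u : Plane} (hu : u ∈ V) :
    HasDerivAt (fun s => L.lam s u) (-v u) t := by
  rw [← h.deriv_lam t ht u hu]
  exact hasDerivAt_fst_of_analyticAt (h.lam (t, u) ⟨ht, hu⟩)

theorem hasDerivAt_N (h : IsLocalSolution L v T V) {t : ℝ} (ht : t > T) {u : Plane} (hu : u ∈ V) :
    HasDerivAt (fun s => Real.exp (L.lam s u)) (-v u * Real.exp (L.lam t u)) t := by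
  convert (h.hasDerivAt_lam ht hu).exp using 1
  ring

/-- The evolution equation of `σ_{ab}`. -/
theorem hasDerivAt_sig (h : IsLocalSolution L v T V) {t : ℝ} (ht : t > T) {u : Plane} (hu : u ∈ V)
    (a b : Fin 2) :
    HasDerivAt (fun s => L.sig s u a b) (v u * L.sig t u a b - 2 * L.k t u a b) t := by
  have h1 := hasDerivAt_fst_of_analyticAt (f := fun t u => L.sig t u a b)
    (h.sig a b (t, u) ⟨ht, hu⟩)
  have h2 := h.evolution.evol_gam t ht u hu a b
  have h3 : deriv (fun s => L.gam s u a b) t = _ := ((h.hasDerivAt_N ht hu).mul h1).deriv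
  rw [h2] at h3
  have h4 := (Real.exp_pos (L.lam t u)).ne'
  convert h1 using 1
  apply mul_left_cancel₀ h4
  linear_combination h3

theorem k_symm (h : IsLocalSolution L v T V) {t : ℝ} (ht : t > T) {u : Plane} (hu : u ∈ V)
    (a b : Fin 2) : L.k t u a b = L.k t u b a := by
  have h1 := h.hasDerivAt_sig ht hu a b
  have h2 := h.hasDerivAt_sig ht hu b a
  have h3 : (fun s => L.sig s u b a) =ᶠ[𝓝 t] fun s => L.sig s u a b := by
    filter_upwards [isOpen_Ioi.mem_nhds ht] with s hs using h.sig_symm hs hu b a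
  have h4 := h1.unique (h2.congr_of_eventuallyEq h3.symm)
  rw [h.sig_symm ht hu a b] at h4
  linarith

theorem sum_sig_inv_mul_sig (h : IsLocalSolution L v T V) {t : ℝ} (ht : t > T) {u : Plane}
    (hu : u ∈ V) : ∑ a, ∑ b, (L.sig t u)⁻¹ a b * L.sig t u a b = 2 := by
  have h1 := Matrix.nonsing_inv_mul _ (h.isUnit_det_sig ht hu)
  have h0 := congrFun (congrFun h1 0) 0
  have h2 := congrFun (congrFun h1 1) 1
  simp only [Matrix.mul_apply, Fin.sum_univ_two, Matrix.one_apply_eq] at h0 h2 ⊢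
  rw [h.sig_symm ht hu 1 0] at *
  linarith

theorem exp_mul_tau (h : IsLocalSolution L v T V) {t : ℝ} (ht : t > T) {u : Plane} (hu : u ∈ V) :
    Real.exp (L.lam t u) * L.tau t u = ∑ a, ∑ b, (L.sig t u)⁻¹ a b * L.k t u a b := by
  simp only [LocalState.tau, h.gam_inv ht hu, Matrix.smul_apply, smul_eq_mul, Finset.mul_sum,
    ← mul_assoc, ← Real.exp_add]
  simp

/-- `σ^{ab} ∂_t σ_{ab} = 2 (v - e^λ τ)`. -/
theorem psi_eq (h : IsLocalSolution L v T V) {t : ℝ} (ht : t > T) {u : Plane} (hu : u ∈ V) :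
    L.psi t u = 2 * v u - 2 * (Real.exp (L.lam t u) * L.tau t u) := by
  have h1 := h.sum_sig_inv_mul_sig ht hu
  rw [h.exp_mul_tau ht hu]
  simp only [LocalState.psi, (h.hasDerivAt_sig ht hu _ _).deriv, Fin.sum_univ_two] at h1 ⊢
  linear_combination v u * h1

theorem partialD_N (h : IsLocalSolution L v T V) {t : ℝ} (ht : t > T) {u : Plane} (hu : u ∈ V)
    (a : Fin 2) : partialD a (fun y => Real.exp (L.lam t y)) u =
      Real.exp (L.lam t u) * partialD a (L.lam t) u := by
  have h1 : DifferentiableAt ℝ (L.lam t) u :=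
    (h.lam (t, u) ⟨ht, hu⟩).differentiableAt.comp u (f := fun y : Plane => (t, y)) (by fun_prop)
  simp [partialD, fderiv_exp h1]

/-- A solution of the evolution equations over the algebra of analytic functions. -/
def formal (h : IsLocalSolution L v T V) : FormalSolution (analyticAlgebra h.Ω) where
  toFormalMetric := h.metric
  t := dir (1, 0)
  t_D _ _ := dir_comm _ _ _
  N := h.formalN
  k := h.formalK
  φ := ofFun _ h.phi
  p := ofFun _ h.p
  k_symm a b := ext fun q => h.k_symm q.2.1 q.2.2 a b
  t_g a b := ext fun q => by
    have e1 := h.evolution.evol_gam q.1.1 q.2.1 q.1.2 q.2.2 a b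
    refine ((h.rep_g a b).dt q).trans (e1.trans ?_)
    have e2 := h.rep_k a b q
    have e3 := h.rep_N q
    simp only [map_neg, map_mul, map_ofNat, e2, e3]
    ring
  t_k a b := ext fun q => by
    have e1 := h.evolution.evol_k q.1.1 q.2.1 q.1.2 q.2.2 a b
    refine ((h.rep_k a b).dt q).trans (e1.trans ?_)
    have hphi : Rep (ofFun _ h.phi : analyticAlgebra h.Ω) L.phi := fun _ => rfl
    have e2 := fun a b => h.rep_k a b q
    have e3 := h.rep_N q
    have e4 := fun a b => h.rep_ric a b q
    have e5 := fun a b => h.rep_m a b q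
    have e6 := fun a b => h.rep_hess h.rep_N a b q
    have e7 := fun a => h.rep_metric_D hphi a q
    have e8 := h.rep_τ q
    simp only [map_sub, map_add, map_mul, map_ofNat, map_sum, e2, e3, e4, e5, e6, e7, e8]
    rfl
  t_φ := ext fun q => by
    have hphi : Rep (ofFun _ h.phi : analyticAlgebra h.Ω) L.phi := fun _ => rfl
    rw [hphi.dt q, map_mul, h.rep_N q]
    exact h.evolution.evol_phi q.1.1 q.2.1 q.1.2 q.2.2
  t_p := ext fun q => by
    have hphi : Rep (ofFun _ h.phi : analyticAlgebra h.Ω) L.phi := fun _ => rfl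
    have hp : Rep (ofFun _ h.p : analyticAlgebra h.Ω) L.p := fun _ => rfl
    have e1 := h.evolution.evol_p q.1.1 q.2.1 q.1.2 q.2.2
    refine (hp.dt q).trans (e1.trans ?_)
    rw [h.psi_eq q.2.1 q.2.2, h.deriv_lam q.1.1 q.2.1 q.1.2 q.2.2]
    have e2 := h.rep_N q
    have e3 := fun a b => h.rep_hess hphi a b q
    have e4 := fun a b => h.rep_G a b q
    have e5 := h.rep_τ q
    have e6 := fun a => h.rep_metric_D hphi a q
    have e7 := fun a => h.rep_metric_D h.rep_N a q
    simp only [h.partialD_N q.2.1 q.2.2] at e7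
    simp only [map_add, map_mul, map_sum, e2, e3, e4, e5, e6, e7, hp q, Finset.mul_sum]
    simp only [Fin.sum_univ_two]
    ring

theorem rep_H (h : IsLocalSolution L v T V) : Rep h.formal.H fun t u => -2 * L.C0 t u := by
  intro q
  have hphi : Rep (ofFun _ h.phi : analyticAlgebra h.Ω) L.phi := fun _ => rfl
  have hp : Rep (ofFun _ h.p : analyticAlgebra h.Ω) L.p := fun _ => rfl
  have e1 : ev q h.formal.scal = scalarCurv (L.gam q.1.1) q.1.2 := h.rep_scal q
  have e2 : ∀ a b, ev q (h.formal.m a b) = L.kMixed q.1.1 q.1.2 a b := fun a b => h.rep_m a b q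
  have e3 : ev q h.formal.τ = L.tau q.1.1 q.1.2 := h.rep_τ q
  have e4 : ev q h.formal.p = L.p q.1.1 q.1.2 := hp q
  have e5 : ∀ a, ev q (h.formal.D a h.formal.φ) = partialD a (L.phi q.1.1) q.1.2 :=
    fun a => h.rep_metric_D hphi a q
  have e6 : ∀ a b, ev q (h.formal.G a b) = (L.gam q.1.1 q.1.2)⁻¹ a b := fun a b => h.rep_G a b q
  simp only [FormalSolution.H, FormalSolution.kk, FormalSolution.grad2, map_sub, map_add, map_mul,
    map_pow, map_sum, map_ofNat, e1, e2, e3, e4, e5, e6, LocalState.C0]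
  ring

theorem rep_C (h : IsLocalSolution L v T V) (a : Fin 2) :
    Rep (h.formal.C a) fun t u => L.Cvec t u a := by
  intro q
  have hphi : Rep (ofFun _ h.phi : analyticAlgebra h.Ω) L.phi := fun _ => rfl
  have hp : Rep (ofFun _ h.p : analyticAlgebra h.Ω) L.p := fun _ => rfl
  have e1 : ∀ a, ev q (h.formal.div h.formal.m a) =
      divMixed (L.gam q.1.1) (L.kMixed q.1.1) a q.1.2 :=
    fun a => h.rep_div (n := L.kMixed) h.rep_m a q
  have e3 : ∀ a, ev q (h.formal.D a h.formal.τ) = partialD a (L.tau q.1.1) q.1.2 :=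
    fun a => h.rep_metric_D h.rep_τ a q
  have e4 : ev q h.formal.p = L.p q.1.1 q.1.2 := hp q
  have e5 : ∀ a, ev q (h.formal.D a h.formal.φ) = partialD a (L.phi q.1.1) q.1.2 :=
    fun a => h.rep_metric_D hphi a q
  simp only [FormalSolution.C, map_neg, map_sub, map_add, map_mul, map_ofNat, e1, e3, e4, e5,
    LocalState.Cvec]

/-- The rescaled Hamiltonian constraint over the algebra of analytic functions. -/
def formalE0 (h : IsLocalSolution L v T V) : analyticAlgebra h.Ω :=
  algebraMap ℝ _ (-(1 / 2)) * (h.formal.N * h.formal.N * h.formal.H)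

theorem rep_E0 (h : IsLocalSolution L v T V) : Rep h.formalE0 L.E0 := by
  intro q
  have hN : ev q h.formal.N = Real.exp (L.lam q.1.1 q.1.2) := rfl
  simp only [formalE0, map_mul, AlgHom.commutes, h.rep_H q, hN, LocalState.E0, two_mul,
    Real.exp_add, Algebra.algebraMap_self, RingHom.id_apply]
  ring

theorem rep_Evec (h : IsLocalSolution L v T V) (a : Fin 2) :
    Rep (h.formalN * h.formal.C a) fun t u => L.Evec t u a := by
  intro q
  simp only [map_mul, h.rep_C a q, h.rep_N q, LocalState.Evec]

theorem analytic_E0 (h : IsLocalSolution L v T V) :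
    AnalyticOnNhd ℝ (fun q : ℝ × Plane => L.E0 q.1 q.2) (Ioi T ×ˢ V) := h.rep_E0.analyticOnNhd

theorem analytic_Evec (h : IsLocalSolution L v T V) (a : Fin 2) :
    AnalyticOnNhd ℝ (fun q : ℝ × Plane => L.Evec q.1 q.2 a) (Ioi T ×ˢ V) :=
  (h.rep_Evec a).analyticOnNhd

/-- The rescaled constraint functions satisfy the constraint propagation system. -/
theorem solvesPropagation (h : IsLocalSolution L v T V) :
    L.SolvesPropagation v T V L.E0 L.Evec where
  eq0 t ht u hu := by
    let q : h.Ω := ⟨(t, u), ht, hu⟩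
    have e1 : ev q (h.formal.t h.formalE0) = deriv (fun s => L.E0 s u) t := h.rep_E0.dt q
    have e2 : ∀ a b, ev q (h.formal.cd1 (fun a => h.formal.N * h.formal.C a) a b) =
      covDCovector (L.gam t) (L.Evec t) a b u := fun a b => h.rep_cd1 h.rep_Evec a b q
    have e3 : ev q (h.formal.t h.formal.N) = -v u * Real.exp (L.lam t u) :=
      (h.rep_N.dt q).trans (h.hasDerivAt_N ht hu).deriv
    have e4 := congrArg (ev q) h.formal.t_H
    have e5 : ∀ a b, (L.sig t u)⁻¹ a b = ev q (h.formal.N * h.formal.G a b) := by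
      intro a b
      have : ev q (h.formal.N * h.formal.G a b) = Real.exp (L.lam t u) * (L.gam t u)⁻¹ a b := by
        rw [map_mul]
        rfl
      rw [this, h.gam_inv ht hu, Matrix.smul_apply, smul_eq_mul, ← mul_assoc, ← Real.exp_add]
      simp
    have e6 : ∀ a b, h.formal.cd1 (fun a => h.formal.N * h.formal.C a) a b =
        h.formal.N * h.formal.cd1 h.formal.C a b + h.formal.D a h.formal.N * h.formal.C b := by
      intro a b
      simp only [FormalMetric.cd1, Fin.sum_univ_two, Derivation.leibniz, smul_eq_mul]
      ring
    have e7 : ∀ a, Real.exp (L.lam t u) * partialD a (L.lam t) u = ev q (h.formal.D a h.formal.N) :=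
      fun a => ((h.rep_metric_D h.rep_N a q).trans (h.partialD_N ht hu a)).symm
    have e8 : Real.exp (L.lam t u) = ev q h.formal.N := rfl
    have e9 : L.tau t u = ev q h.formal.τ := (h.rep_τ q).symm
    have e10 : L.E0 t u = -(1 / 2) * (ev q h.formal.N ^ 2 * ev q h.formal.H) := by
      rw [← h.rep_E0 q]
      simp only [formalE0, map_mul, AlgHom.commutes, Algebra.algebraMap_self, RingHom.id_apply]
      ring
    have e11 : ∀ b, L.Evec t u b = ev q h.formal.N * ev q (h.formal.C b) := by
      intro b
      rw [← map_mul]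
      exact (h.rep_Evec b q).symm
    have e12 : h.formal.t h.formalE0 = algebraMap ℝ _ (-(1 / 2)) *
        (2 * h.formal.N * h.formal.t h.formal.N * h.formal.H
          + h.formal.N ^ 2 * h.formal.t h.formal.H) := by
      simp only [formalE0, Derivation.leibniz, Derivation.map_algebraMap, smul_eq_mul]
      ring
    simp only [← e1, ← e2, e5, e6, e9, e10, e11, e12]
    simp only [map_add, map_mul, map_pow, map_ofNat, map_sum, AlgHom.commutes, e3,
      Algebra.algebraMap_self, RingHom.id_apply] at e4 ⊢
    simp only [e8, Fin.sum_univ_two] at e4 e7 ⊢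
    linear_combination -(1 / 2) * ev q h.formal.N ^ 2 * e4
      + ev q h.formal.N ^ 2 * (ev q (h.formal.G 0 0) * ev q (h.formal.C 0)
        + ev q (h.formal.G 0 1) * ev q (h.formal.C 1)) * e7 0
      + ev q h.formal.N ^ 2 * (ev q (h.formal.G 1 0) * ev q (h.formal.C 0)
        + ev q (h.formal.G 1 1) * ev q (h.formal.C 1)) * e7 1
  eqa t ht u hu a := by
    let q : h.Ω := ⟨(t, u), ht, hu⟩
    have e1 : ev q (h.formal.t (h.formal.N * h.formal.C a)) = deriv (fun s => L.Evec s u a) t :=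
      (h.rep_Evec a).dt q
    have e2 : ev q (h.formal.D a h.formalE0) = partialD a (L.E0 t) u := h.rep_metric_D h.rep_E0 a q
    have e3 : ev q (h.formal.t h.formal.N) = -v u * Real.exp (L.lam t u) :=
      (h.rep_N.dt q).trans (h.hasDerivAt_N ht hu).deriv
    have e4 := congrArg (ev q) (h.formal.two_t_C a)
    have e8 : Real.exp (L.lam t u) = ev q h.formal.N := rfl
    have e9 : L.tau t u = ev q h.formal.τ := (h.rep_τ q).symm
    have e11 : L.Evec t u a = ev q h.formal.N * ev q (h.formal.C a) := by
      rw [← map_mul]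
      exact (h.rep_Evec a q).symm
    have e12 : h.formal.D a h.formalE0 = algebraMap ℝ _ (-(1 / 2)) *
        (2 * h.formal.N * h.formal.D a h.formal.N * h.formal.H
          + h.formal.N ^ 2 * h.formal.D a h.formal.H) := by
      simp only [formalE0, Derivation.leibniz, Derivation.map_algebraMap, smul_eq_mul]
      ring
    rw [← e1, ← e2, e9, e11, e12]
    simp only [Derivation.leibniz, smul_eq_mul]
    simp only [map_add, map_mul, map_pow, map_ofNat, AlgHom.commutes, e3,
      Algebra.algebraMap_self, RingHom.id_apply] at e4 ⊢
    simp only [e8] at e4 ⊢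
    linear_combination (1 / 2) * ev q h.formal.N * e4

end IsLocalSolution

end

/-! ### Cutoff functions and Grönwall's inequality from `t = ∞` -/

theorem hasDerivAt_max_zero_sq (x : ℝ) : HasDerivAt (fun y : ℝ => max 0 y ^ 2) (2 * max 0 x) x := by
  rcases lt_trichotomy x 0 with hx | rfl | hx
  · have h : (fun y : ℝ => max 0 y ^ 2) =ᶠ[𝓝 x] fun _ => 0 := by
      filter_upwards [isOpen_Iio.mem_nhds hx] with y hy
      simp [max_eq_left (le_of_lt (Set.mem_Iio.mp hy))]
    rw [max_eq_left hx.le]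
    simpa using (hasDerivAt_const x (0 : ℝ)).congr_of_eventuallyEq h
  · rw [hasDerivAt_iff_isLittleO]
    simp only [max_self, mul_zero, smul_zero, sub_zero, ne_eq, OfNat.ofNat_ne_zero,
      not_false_eq_true, zero_pow]
    refine Asymptotics.IsBigO.trans_isLittleO (g := fun y : ℝ => y ^ 2)
      (Asymptotics.IsBigO.of_bound 1 (Eventually.of_forall fun y => ?_))
      (Asymptotics.isLittleO_pow_id one_lt_two)
    rw [one_mul, norm_pow, norm_pow, Real.norm_eq_abs, Real.norm_eq_abs]
    refine pow_le_pow_left₀ (abs_nonneg _) ?_ 2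
    rw [abs_of_nonneg (le_max_left 0 y)]
    exact max_le (abs_nonneg y) (le_abs_self y)
  · have h : (fun y : ℝ => max 0 y ^ 2) =ᶠ[𝓝 x] fun y => y ^ 2 := by
      filter_upwards [isOpen_Ioi.mem_nhds hx] with y hy
      rw [max_eq_right (le_of_lt (Set.mem_Ioi.mp hy))]
    rw [max_eq_right hx.le]
    simpa using (hasDerivAt_pow 2 x).congr_of_eventuallyEq h

/-- The squared positive part of `ρ² - |u - u₀|² - A e^{-ct}`. It is a `C¹` cutoff to balls about
`u₀` that expand to the ball of radius `ρ` as `t → ∞`; for large `A` their boundaries move faster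
than signals whose speed is `O(e^{-ct})`. -/
def coneCutoff (u₀ : Plane) (ρ A c t : ℝ) (u : Plane) : ℝ :=
  max 0 (ρ ^ 2 - ‖u - u₀‖ ^ 2 - A * Real.exp (-c * t)) ^ 2

/-- Twice the positive part of `ρ² - |u - u₀|² - A e^{-ct}`, which appears in the derivatives of
`coneCutoff`. -/
def coneSlope (u₀ : Plane) (ρ A c t : ℝ) (u : Plane) : ℝ :=
  2 * max 0 (ρ ^ 2 - ‖u - u₀‖ ^ 2 - A * Real.exp (-c * t))

section Cone

variable {u₀ : Plane} {ρ A c t : ℝ} {u : Plane}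

theorem coneCutoff_nonneg : 0 ≤ coneCutoff u₀ ρ A c t u := sq_nonneg _

theorem coneSlope_nonneg : 0 ≤ coneSlope u₀ ρ A c t u := mul_nonneg zero_le_two (le_max_left _ _)

theorem cone_arg_nonpos (hρ : 0 ≤ ρ) (hA : 0 ≤ A) (hu : u ∉ Metric.closedBall u₀ ρ) :
    ρ ^ 2 - ‖u - u₀‖ ^ 2 - A * Real.exp (-c * t) ≤ 0 := by
  rw [Metric.mem_closedBall, dist_eq_norm, not_le] at hu
  have h1 : 0 ≤ A * Real.exp (-c * t) := mul_nonneg hA (Real.exp_pos _).le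
  nlinarith

theorem coneCutoff_eq_zero (hρ : 0 ≤ ρ) (hA : 0 ≤ A) (hu : u ∉ Metric.closedBall u₀ ρ) :
    coneCutoff u₀ ρ A c t u = 0 := by
  rw [coneCutoff, max_eq_left (cone_arg_nonpos hρ hA hu), zero_pow two_ne_zero]

theorem coneSlope_eq_zero (hρ : 0 ≤ ρ) (hA : 0 ≤ A) (hu : u ∉ Metric.closedBall u₀ ρ) :
    coneSlope u₀ ρ A c t u = 0 := by
  rw [coneSlope, max_eq_left (cone_arg_nonpos hρ hA hu), mul_zero]

theorem hasDerivAt_coneCutoff :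
    HasDerivAt (fun s => coneCutoff u₀ ρ A c s u)
      (coneSlope u₀ ρ A c t u * (c * A * Real.exp (-c * t))) t := by
  have h1 : HasDerivAt (fun s => ρ ^ 2 - ‖u - u₀‖ ^ 2 - A * Real.exp (-c * s))
      (c * A * Real.exp (-c * t)) t := by
    have h2 : HasDerivAt (fun s : ℝ => -c * s) (-c) t := by
      simpa using (hasDerivAt_id t).const_mul (-c)
    exact ((h2.exp.const_mul A).const_sub (ρ ^ 2 - ‖u - u₀‖ ^ 2)).congr_deriv (by ring)
  exact (hasDerivAt_max_zero_sq _).comp t h1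

theorem hasFDerivAt_coneCutoff :
    HasFDerivAt (coneCutoff u₀ ρ A c t)
      (coneSlope u₀ ρ A c t u • -((2 : ℝ) • (innerSL ℝ (u - u₀) : Plane →L[ℝ] ℝ))) u := by
  have h2 : HasFDerivAt (fun y : Plane => ‖y - u₀‖ ^ 2)
      ((2 : ℝ) • (innerSL ℝ (u - u₀) : Plane →L[ℝ] ℝ)) u := by
    refine ((hasFDerivAt_id (𝕜 := ℝ) u).sub_const u₀).norm_sq.congr_fderiv ?_
    ext x
    simp [two_smul]
  exact (hasDerivAt_max_zero_sq _).comp_hasFDerivAt u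
    ((h2.const_sub (ρ ^ 2)).sub_const (A * Real.exp (-c * t)))

theorem partialD_coneCutoff (a : Fin 2) :
    partialD a (coneCutoff u₀ ρ A c t) u = -(2 * coneSlope u₀ ρ A c t u * (u a - u₀ a)) := by
  rw [partialD, hasFDerivAt_coneCutoff.fderiv]
  simp [EuclideanSpace.inner_single_right]
  ring

theorem continuous_coneCutoff :
    Continuous fun q : ℝ × Plane => coneCutoff u₀ ρ A c q.1 q.2 := by
  unfold coneCutoff
  fun_prop

theorem continuous_coneSlope :
    Continuous fun q : ℝ × Plane => coneSlope u₀ ρ A c q.1 q.2 := by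
  unfold coneSlope
  fun_prop

end Cone

/-- Grönwall's inequality from `t = ∞`: the coefficient `C e^{-ct}` is integrable, so the
integrating factor stays bounded. -/
theorem nonpos_of_deriv_ge {E E' : ℝ → ℝ} {C c T : ℝ} (hc : 0 < c)
    (hE : ∀ t > T, HasDerivAt E (E' t) t) (h : ∀ t > T, -(C * Real.exp (-c * t)) * E t ≤ E' t)
    (hlim : Tendsto E atTop (𝓝 0)) : ∀ t > T, E t ≤ 0 := by
  have hexp : ∀ t, HasDerivAt (fun s : ℝ => Real.exp (-(C / c) * Real.exp (-c * s)))
      (Real.exp (-(C / c) * Real.exp (-c * t)) * (C * Real.exp (-c * t))) t := by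
    intro t
    have h2 : HasDerivAt (fun s : ℝ => -c * s) (-c) t := by
      simpa using (hasDerivAt_id t).const_mul (-c)
    exact ((h2.exp.const_mul (-(C / c))).exp).congr_deriv (by field_simp)
  have hG : ∀ t > T, HasDerivAt (fun s => E s * Real.exp (-(C / c) * Real.exp (-c * s)))
      ((E' t + C * Real.exp (-c * t) * E t) * Real.exp (-(C / c) * Real.exp (-c * t))) t := by
    intro t ht
    exact ((hE t ht).mul (hexp t)).congr_deriv (by ring)
  have hmono : MonotoneOn (fun s => E s * Real.exp (-(C / c) * Real.exp (-c * s))) (Ioi T) := by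
    apply monotoneOn_of_deriv_nonneg (convex_Ioi T)
    · exact fun t ht => (hG t ht).continuousAt.continuousWithinAt
    · intro t ht
      rw [interior_Ioi] at ht
      exact (hG t ht).differentiableAt.differentiableWithinAt
    · intro t ht
      rw [interior_Ioi] at ht
      rw [(hG t ht).deriv]
      refine mul_nonneg ?_ (Real.exp_pos _).le
      linarith [h t ht]
  have hlim2 : Tendsto (fun s => E s * Real.exp (-(C / c) * Real.exp (-c * s))) atTop (𝓝 0) := by
    have h1 : Tendsto (fun s : ℝ => Real.exp (-c * s)) atTop (𝓝 0) := by
      apply Real.tendsto_exp_atBot.comp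
      exact tendsto_id.const_mul_atTop_of_neg (by linarith)
    have h2 := (Real.continuous_exp.tendsto _).comp (h1.const_mul (-(C / c)))
    simpa using hlim.mul h2
  intro t ht
  have h3 : E t * Real.exp (-(C / c) * Real.exp (-c * t)) ≤ 0 := by
    apply ge_of_tendsto hlim2
    filter_upwards [eventually_ge_atTop t] with s hs
    exact hmono ht (lt_of_lt_of_le ht hs) hs
  by_contra hn
  have := mul_pos (not_le.mp hn) (Real.exp_pos (-(C / c) * Real.exp (-c * t)))
  linarith

/-! ### An energy estimate from `t = ∞` -/

section

open MeasureTheory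

theorem analyticOnNhd_dt {f : ℝ → Plane → ℝ} {T : ℝ} {V : Set Plane} (hV : IsOpen V)
    (hf : AnalyticOnNhd ℝ (fun q : ℝ × Plane => f q.1 q.2) (Ioi T ×ˢ V)) :
    AnalyticOnNhd ℝ (fun q : ℝ × Plane => deriv (fun s => f s q.2) q.1) (Ioi T ×ˢ V) :=
  ((analyticAlgebra.rep_ofFun (Ω := ⟨_, isOpen_Ioi.prod hV⟩) hf).dt).analyticOnNhd

theorem analyticOnNhd_dx {f : ℝ → Plane → ℝ} {T : ℝ} {V : Set Plane} (hV : IsOpen V)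
    (hf : AnalyticOnNhd ℝ (fun q : ℝ × Plane => f q.1 q.2) (Ioi T ×ˢ V)) (a : Fin 2) :
    AnalyticOnNhd ℝ (fun q : ℝ × Plane => partialD a (f q.1) q.2) (Ioi T ×ˢ V) :=
  ((analyticAlgebra.rep_ofFun (Ω := ⟨_, isOpen_Ioi.prod hV⟩) hf).dx a).analyticOnNhd

theorem differentiableAt_snd_of_analyticAt {f : ℝ → Plane → ℝ} {t : ℝ} {u : Plane}
    (hf : AnalyticAt ℝ (fun q : ℝ × Plane => f q.1 q.2) (t, u)) : DifferentiableAt ℝ (f t) u :=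
  hf.differentiableAt.comp u (f := fun y : Plane => (t, y)) (by fun_prop)

/-- Differentiation under an integral over a compact set. -/
theorem hasDerivAt_setIntegral {F F' : ℝ → Plane → ℝ} {T t : ℝ} {B : Set Plane} (hB : IsCompact B)
    (hF : ContinuousOn (fun q : ℝ × Plane => F q.1 q.2) (Ioi T ×ˢ B))
    (hF' : ContinuousOn (fun q : ℝ × Plane => F' q.1 q.2) (Ioi T ×ˢ B))
    (hd : ∀ s > T, ∀ u ∈ B, HasDerivAt (fun s => F s u) (F' s u) s) (ht : t > T) :
    HasDerivAt (fun s => ∫ u in B, F s u) (∫ u in B, F' t u) t := by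
  have hsec : ∀ {G : ℝ → Plane → ℝ}, ContinuousOn (fun q : ℝ × Plane => G q.1 q.2) (Ioi T ×ˢ B) →
      ∀ s > T, ContinuousOn (G s) B := fun hG s hs =>
    hG.comp (f := fun y : Plane => (s, y)) (by fun_prop) fun y hy => ⟨hs, hy⟩
  obtain ⟨δ, hδ, hball⟩ :=
    Metric.nhds_basis_closedBall.mem_iff.mp (isOpen_Ioi.mem_nhds (mem_Ioi.mpr ht))
  obtain ⟨C, hC⟩ := ((isCompact_closedBall t δ).prod hB).exists_bound_of_continuousOn
    (hF'.mono (prod_mono hball subset_rfl))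
  refine (hasDerivAt_integral_of_dominated_loc_of_deriv_le (μ := volume.restrict B)
    (bound := fun _ => C) (Metric.ball_mem_nhds t hδ) ?_ ?_ ?_ ?_ ?_ ?_).2
  · filter_upwards [isOpen_Ioi.mem_nhds ht] with s hs
    exact (hsec hF s hs).aestronglyMeasurable hB.measurableSet
  · exact (hsec hF t ht).integrableOn_compact hB
  · exact (hsec hF' t ht).aestronglyMeasurable hB.measurableSet
  · filter_upwards [ae_restrict_mem hB.measurableSet] with u hu s hs
    exact hC (s, u) ⟨Metric.ball_subset_closedBall hs, hu⟩
  · exact (continuousOn_const (c := C)).integrableOn_compact hB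
  · filter_upwards [ae_restrict_mem hB.measurableSet] with u hu s hs
    exact hd s (hball (Metric.ball_subset_closedBall hs)) u hu

/-- Integration by parts against a differentiable function supported in a compact set. -/
theorem setIntegral_mul_partialD {V B : Set Plane} (hV : IsOpen V) (hB : IsCompact B) (hBV : B ⊆ V)
    {χ g : Plane → ℝ} (hχ : Differentiable ℝ χ) (a : Fin 2)
    (hχc : Continuous (partialD a χ)) (hχ0 : ∀ u ∉ B, χ u = 0) (hχ1 : ∀ u ∉ B, partialD a χ u = 0)
    (hg : DifferentiableOn ℝ g V) (hgc : ContinuousOn (partialD a g) V) :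
    ∫ u in B, χ u * partialD a g u = -∫ u in B, partialD a χ u * g u := by
  have hgB : ContinuousOn g B := hg.continuousOn.mono hBV
  have hsupp : tsupport χ ⊆ B := by
    apply closure_minimal _ hB.isClosed
    intro u hu
    by_contra h
    exact hu (hχ0 u h)
  have key : ∀ f : Plane → ℝ, ContinuousOn f B → (∀ u ∉ B, f u = 0) → Integrable f := by
    intro f hf h0
    rw [← integrableOn_iff_integrable_of_support_subset (s := B)]
    · exact hf.integrableOn_compact hB
    · intro u hu
      by_contra h
      exact hu (h0 u h)
  have h := integral_mul_fderiv_eq_neg_fderiv_mul_of_integrable (μ := volume) (f := χ) (g := g)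
    (v := EuclideanSpace.single a 1)
    (key _ (hχc.continuousOn.mul hgB) fun u hu => by
      change partialD a χ u * _ = 0
      rw [hχ1 u hu, zero_mul])
    (key _ (hχ.continuous.continuousOn.mul (hgc.mono hBV)) fun u hu => by
      change _ * partialD a g u = 0
      rw [hχ0 u hu, zero_mul])
    (key _ (hχ.continuous.continuousOn.mul hgB) fun u hu => by
      rw [hχ0 u hu, zero_mul])
    (fun u _ => hχ u)
    (fun u hu => hg.differentiableAt (hV.mem_nhds (hBV (hsupp hu))))
  rw [setIntegral_eq_integral_of_forall_compl_eq_zero,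
    setIntegral_eq_integral_of_forall_compl_eq_zero]
  · exact h
  · intro u hu
    rw [hχ1 u hu, zero_mul]
  · intro u hu
    rw [hχ0 u hu, zero_mul]

/-- A nonnegative energy density which decays as `t → ∞` and whose flux and production are bounded
by an exponentially small multiple of the density vanishes near `t = ∞`. The proof integrates it
against `coneCutoff`: the growth of the cutoff dominates the flux, and Grönwall's inequality from
`t = ∞` applies to the integral. -/
theorem energy_eq_zero {V : Set Plane} (hV : IsOpen V) {T : ℝ} {u₀ : Plane} {ρ : ℝ} (hρ : 0 < ρ)
    (hBV : Metric.closedBall u₀ ρ ⊆ V) {e : ℝ → Plane → ℝ} {j : Fin 2 → ℝ → Plane → ℝ} {C c : ℝ}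
    (hC : 0 ≤ C) (hc : 0 < c)
    (he : AnalyticOnNhd ℝ (fun q : ℝ × Plane => e q.1 q.2) (Ioi T ×ˢ V))
    (hj : ∀ a, AnalyticOnNhd ℝ (fun q : ℝ × Plane => j a q.1 q.2) (Ioi T ×ˢ V))
    (h0 : ∀ t > T, ∀ u ∈ Metric.closedBall u₀ ρ, 0 ≤ e t u)
    (hflux : ∀ t > T, ∀ u ∈ Metric.closedBall u₀ ρ, ∀ a, |j a t u| ≤ C * Real.exp (-c * t) * e t u)
    (hineq : ∀ t > T, ∀ u ∈ Metric.closedBall u₀ ρ, -(C * Real.exp (-c * t) * e t u) ≤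
      deriv (fun s => e s u) t + ∑ a, partialD a (j a t) u)
    (hlim : TendstoUniformlyOn e (fun _ => 0) atTop (Metric.closedBall u₀ ρ)) :
    ∃ T', ∀ t > T', e t u₀ = 0 := by
  set B := Metric.closedBall u₀ ρ with hBdef
  have hB : IsCompact B := isCompact_closedBall _ _
  -- The gradient of the cutoff is at most `2ρ` times its slope in each of the two directions; this
  -- `A` makes the time derivative of the cutoff outweigh the flux term.
  set A := 4 * ρ * C / c with hA
  have hA0 : 0 ≤ A := by positivity
  have hec : ContinuousOn (fun q : ℝ × Plane => e q.1 q.2) (Ioi T ×ˢ B) :=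
    he.continuousOn.mono (prod_mono subset_rfl hBV)
  have hetc : ContinuousOn (fun q : ℝ × Plane => deriv (fun s => e s q.2) q.1) (Ioi T ×ˢ B) :=
    (analyticOnNhd_dt hV he).continuousOn.mono (prod_mono subset_rfl hBV)
  have hsec : ∀ {G : ℝ → Plane → ℝ} {V},
      ContinuousOn (fun q : ℝ × Plane => G q.1 q.2) (Ioi T ×ˢ V) →
      ∀ s > T, ContinuousOn (G s) V := fun hG s hs =>
    hG.comp (f := fun y : Plane => (s, y)) (by fun_prop) fun y hy => ⟨hs, hy⟩
  have hχc : ∀ t, Continuous (coneCutoff u₀ ρ A c t) := fun t =>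
    continuous_coneCutoff.comp (f := fun y : Plane => (t, y)) (by fun_prop)
  have hsc : ∀ t, Continuous (coneSlope u₀ ρ A c t) := fun t =>
    continuous_coneSlope.comp (f := fun y : Plane => (t, y)) (by fun_prop)
  set E : ℝ → ℝ := fun t => ∫ u in B, coneCutoff u₀ ρ A c t u * e t u with hE
  set E' : ℝ → ℝ := fun t => ∫ u in B, (coneSlope u₀ ρ A c t u * (c * A * Real.exp (-c * t)) * e t u
    + coneCutoff u₀ ρ A c t u * deriv (fun s => e s u) t) with hE'
  have hderiv : ∀ t > T, HasDerivAt E (E' t) t := by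
    intro t ht
    refine hasDerivAt_setIntegral (F := fun t u => coneCutoff u₀ ρ A c t u * e t u)
      (F' := fun t u => coneSlope u₀ ρ A c t u * (c * A * Real.exp (-c * t)) * e t u
        + coneCutoff u₀ ρ A c t u * deriv (fun s => e s u) t) hB
      (continuous_coneCutoff.continuousOn.mul hec) ?_ ?_ ht
    · refine ((continuous_coneSlope.continuousOn.mul ?_).mul hec).add
        (continuous_coneCutoff.continuousOn.mul hetc)
      fun_prop
    · intro s hs u hu
      exact hasDerivAt_coneCutoff.mul (hasDerivAt_fst_of_analyticAt (he (s, u) ⟨hs, hBV hu⟩))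
  have hge : ∀ t > T, -(C * Real.exp (-c * t)) * E t ≤ E' t := by
    intro t ht
    have hpc : ∀ a, Continuous (partialD a (coneCutoff u₀ ρ A c t)) := fun a => by
      have : partialD a (coneCutoff u₀ ρ A c t) =
          fun u => -(2 * coneSlope u₀ ρ A c t u * (u a - u₀ a)) :=
            funext fun u => partialD_coneCutoff a
      rw [this]
      have := hsc t
      fun_prop
    have hjd : ∀ a, DifferentiableOn ℝ (j a t) V := fun a u hu =>
      (differentiableAt_snd_of_analyticAt (hj a (t, u) ⟨ht, hu⟩)).differentiableWithinAt
    have hjc : ∀ a, ContinuousOn (partialD a (j a t)) V := fun a =>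
      hsec (G := fun t u => partialD a (j a t) u) (analyticOnNhd_dx hV (hj a) a).continuousOn t ht
    have hparts : ∀ a, ∫ u in B, (coneCutoff u₀ ρ A c t u * partialD a (j a t) u
        + partialD a (coneCutoff u₀ ρ A c t) u * j a t u) = 0 := by
      intro a
      rw [integral_add, setIntegral_mul_partialD hV hB hBV
        (fun u => hasFDerivAt_coneCutoff.differentiableAt) a (hpc a)
        (fun u hu => coneCutoff_eq_zero hρ.le hA0 hu) (fun u hu => ?_) (hjd a) (hjc a)]
      · ring
      · rw [partialD_coneCutoff, coneSlope_eq_zero hρ.le hA0 hu]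
        ring
      · exact ((hχc t).continuousOn.mul ((hjc a).mono hBV)).integrableOn_compact hB
      · exact ((hpc a).continuousOn.mul ((hjd a).continuousOn.mono hBV)).integrableOn_compact hB
    have hparts_int : ∀ a, IntegrableOn (fun u => coneCutoff u₀ ρ A c t u * partialD a (j a t) u
        + partialD a (coneCutoff u₀ ρ A c t) u * j a t u) B := fun a =>
      (((hχc t).continuousOn.mul ((hjc a).mono hBV)).add
        ((hpc a).continuousOn.mul ((hjd a).continuousOn.mono hBV))).integrableOn_compact hB
    have hE'_int : IntegrableOn (fun u =>
      coneSlope u₀ ρ A c t u * (c * A * Real.exp (-c * t)) * e t u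
        + coneCutoff u₀ ρ A c t u * deriv (fun s => e s u) t) B :=
      ((((hsc t).continuousOn.mul continuousOn_const).mul (hsec hec t ht)).add
        ((hχc t).continuousOn.mul
          (hsec (G := fun t u => deriv (fun s => e s u) t) hetc t ht))).integrableOn_compact hB
    have hsum : E' t = ∫ u in B, ((coneSlope u₀ ρ A c t u * (c * A * Real.exp (-c * t)) * e t u
        + coneCutoff u₀ ρ A c t u * deriv (fun s => e s u) t)
        + ∑ a, (coneCutoff u₀ ρ A c t u * partialD a (j a t) u
          + partialD a (coneCutoff u₀ ρ A c t) u * j a t u)) := by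
      rw [integral_add hE'_int (integrable_finsetSum _ fun a _ => hparts_int a),
        integral_finsetSum _ fun a _ => hparts_int a]
      simp only [hparts, Finset.sum_const_zero, add_zero, hE']
    rw [hsum, hE, ← integral_const_mul]
    refine setIntegral_mono_on ?_ ?_ hB.measurableSet fun u hu => ?_
    · exact (continuousOn_const.mul
        ((hχc t).continuousOn.mul (hsec hec t ht))).integrableOn_compact hB
    · exact hE'_int.add (integrable_finsetSum _ fun a _ => hparts_int a)
    have h1 := hineq t ht u hu
    have hn := h0 t ht u hu
    have hsl : 0 ≤ coneSlope u₀ ρ A c t u := coneSlope_nonneg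
    have hX := Real.exp_pos (-c * t)
    have h2 : ∀ a, -(2 * coneSlope u₀ ρ A c t u * (ρ * (C * Real.exp (-c * t) * e t u))) ≤
        partialD a (coneCutoff u₀ ρ A c t) u * j a t u := by
      intro a
      rw [partialD_coneCutoff]
      have h3 : |u a - u₀ a| ≤ ρ :=
        (PiLp.norm_apply_le (u - u₀) a).trans (by rw [← dist_eq_norm]; exact hu)
      have h4 : (u a - u₀ a) * j a t u ≤ ρ * (C * Real.exp (-c * t) * e t u) :=
        (le_abs_self _).trans (by
          rw [abs_mul]
          exact mul_le_mul h3 (hflux t ht u hu a) (abs_nonneg _) hρ.le)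
      have h5 := mul_le_mul_of_nonneg_left h4 (mul_nonneg zero_le_two hsl)
      linarith
    have h3 := mul_le_mul_of_nonneg_left h1 (coneCutoff_nonneg (u₀ := u₀) (ρ := ρ) (A := A) (c := c)
      (t := t) (u := u))
    have h4 : c * A = 4 * ρ * C := by
      rw [hA]
      field_simp
    have h5 := h2 0
    have h6 := h2 1
    rw [h4]
    simp only [Fin.sum_univ_two] at h3 ⊢
    linarith
  have hlimE : Tendsto E atTop (𝓝 0) := by
    rw [Metric.tendsto_nhds]
    intro η hη
    set v := volume.real B
    have hv : 0 ≤ v := measureReal_nonneg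
    have hη' : 0 < η / (2 * (ρ ^ 4 * v + 1)) := by positivity
    rw [Metric.tendstoUniformlyOn_iff] at hlim
    filter_upwards [hlim _ hη', eventually_gt_atTop T] with t ht htT
    have hbound : ∀ u ∈ B, ‖coneCutoff u₀ ρ A c t u * e t u‖ ≤
        ρ ^ 4 * (η / (2 * (ρ ^ 4 * v + 1))) := by
      intro u hu
      have h1 : |coneCutoff u₀ ρ A c t u| ≤ ρ ^ 4 := by
        rw [abs_of_nonneg coneCutoff_nonneg, coneCutoff, show ρ ^ 4 = (ρ ^ 2) ^ 2 by ring]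
        refine pow_le_pow_left₀ (le_max_left _ _) (max_le (by positivity) ?_) 2
        have := mul_nonneg hA0 (Real.exp_pos (-c * t)).le
        nlinarith [sq_nonneg ‖u - u₀‖]
      have h2 := ht u hu
      rw [dist_zero_left] at h2
      rw [norm_mul]
      exact mul_le_mul h1 h2.le (norm_nonneg _) (by positivity)
    have h1 := norm_setIntegral_le_of_norm_le_const (μ := volume) hB.measure_lt_top hbound
    rw [dist_zero_right]
    refine lt_of_le_of_lt h1 ?_
    rw [mul_div_assoc', div_mul_eq_mul_div, div_lt_iff₀ (by positivity)]
    nlinarith [mul_nonneg (pow_nonneg hρ.le 4) hv]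
  have hEn := nonpos_of_deriv_ge hc hderiv hge hlimE
  obtain ⟨T₁, hT₁⟩ : ∃ T₁, ∀ t > T₁, A * Real.exp (-c * t) < ρ ^ 2 := by
    have h1 : Tendsto (fun s : ℝ => A * Real.exp (-c * s)) atTop (𝓝 (A * 0)) :=
      (Real.tendsto_exp_atBot.comp (tendsto_id.const_mul_atTop_of_neg (by linarith))).const_mul A
    rw [mul_zero] at h1
    obtain ⟨T₁, h2⟩ := eventually_atTop.mp (h1.eventually_lt_const (by positivity : 0 < ρ ^ 2))
    exact ⟨T₁, fun t ht => h2 t ht.le⟩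
  refine ⟨max T T₁, fun t ht => ?_⟩
  have htT : t > T := lt_of_le_of_lt (le_max_left _ _) ht
  have hcont : ContinuousOn (fun u => coneCutoff u₀ ρ A c t u * e t u) B :=
    (hχc t).continuousOn.mul (hsec hec t htT)
  have hnn : ∀ u ∈ B, 0 ≤ coneCutoff u₀ ρ A c t u * e t u := fun u hu =>
    mul_nonneg coneCutoff_nonneg (h0 t htT u hu)
  have hzero : E t = 0 := le_antisymm (hEn t htT) (setIntegral_nonneg hB.measurableSet hnn)
  have hae := (setIntegral_eq_zero_iff_of_nonneg_ae
    ((ae_restrict_iff' hB.measurableSet).mpr (Eventually.of_forall hnn))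
    (hcont.integrableOn_compact hB)).mp hzero
  have hae2 :=
    ae_restrict_of_ae_restrict_of_subset (Metric.ball_subset_closedBall (x := u₀) (ε := ρ)) hae
  have hon := Measure.eqOn_open_of_ae_eq hae2 Metric.isOpen_ball
    (hcont.mono Metric.ball_subset_closedBall) continuousOn_const
  have h2 : coneCutoff u₀ ρ A c t u₀ * e t u₀ = 0 := hon (Metric.mem_ball_self hρ)
  refine (mul_eq_zero.mp h2).resolve_left ?_
  have h3 := hT₁ t (lt_of_le_of_lt (le_max_right _ _) ht)
  simp only [coneCutoff, sub_self, norm_zero]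
  have h4 : 0 < ρ ^ 2 - 0 ^ 2 - A * Real.exp (-c * t) := by linarith
  rw [max_eq_right h4.le]
  positivity

end

/-! ### Exponential rates -/

theorem tendsto_mul_exp_neg {c : ℝ} (hc : 0 < c) (C : ℝ) :
    Tendsto (fun t : ℝ => C * Real.exp (-c * t)) atTop (𝓝 0) := by
  have h1 : Tendsto (fun t : ℝ => -c * t) atTop atBot :=
    tendsto_id.const_mul_atTop_of_neg (neg_lt_zero.mpr hc)
  simpa using (Real.tendsto_exp_atBot.comp h1).const_mul C

theorem analyticOnNhd_partialD {V : Set Plane} {f : Plane → ℝ} (hf : AnalyticOnNhd ℝ f V)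
    (a : Fin 2) :
    AnalyticOnNhd ℝ (partialD a f) V := fun u hu =>
  ((ContinuousLinearMap.apply ℝ ℝ (EuclideanSpace.single a (1 : ℝ) : Plane)).analyticAt _).comp
    (hf u hu).fderiv

/-- `f = O(e^{rt})` as `t → ∞`, locally uniformly on `V`. -/
def ExpBound (V : Set Plane) (r : ℝ) (f : ℝ → Plane → ℝ) : Prop :=
  ∀ K ⊆ V, IsCompact K → ∃ C T₁ : ℝ, ∀ t ≥ T₁, ∀ u ∈ K, |f t u| ≤ C * Real.exp (r * t)

/-- `f` is analytic on `(T, ∞) × V`, and its spatial derivatives of order at most `n` are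
`O(e^{rt})`, locally uniformly on `V`. The recursion is on the number of coordinate derivatives. -/
def Rate (T : ℝ) (V : Set Plane) : ℕ → ℝ → (ℝ → Plane → ℝ) → Prop
  | 0, r, f => AnalyticOnNhd ℝ (fun q : ℝ × Plane => f q.1 q.2) (Ioi T ×ˢ V) ∧ ExpBound V r f
  | n + 1, r, f => (AnalyticOnNhd ℝ (fun q : ℝ × Plane => f q.1 q.2) (Ioi T ×ˢ V) ∧
      ExpBound V r f) ∧ ∀ a, Rate T V n r fun t u => partialD a (f t) u

namespace ExpBound

variable {V : Set Plane} {r s : ℝ} {f g : ℝ → Plane → ℝ}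

theorem exists_nonneg (hf : ExpBound V r f) {K : Set Plane} (hK : K ⊆ V) (hc : IsCompact K)
    (T : ℝ) : ∃ C T₁ : ℝ, 0 ≤ C ∧ T < T₁ ∧ ∀ t ≥ T₁, ∀ u ∈ K, |f t u| ≤ C * Real.exp (r * t) := by
  obtain ⟨C, T₁, h⟩ := hf K hK hc
  refine ⟨|C|, max (T + 1) T₁, abs_nonneg _, lt_of_lt_of_le (lt_add_one T) (le_max_left _ _),
    fun t ht u hu => (h t ((le_max_right _ _).trans ht) u hu).trans ?_⟩
  exact mul_le_mul_of_nonneg_right (le_abs_self C) (Real.exp_pos _).le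

theorem add (hf : ExpBound V r f) (hg : ExpBound V r g) :
    ExpBound V r fun t u => f t u + g t u := by
  intro K hK hc
  obtain ⟨C, T₁, h⟩ := hf K hK hc
  obtain ⟨C', T₁', h'⟩ := hg K hK hc
  refine ⟨C + C', max T₁ T₁', fun t ht u hu => (abs_add_le _ _).trans ?_⟩
  rw [add_mul]
  exact add_le_add (h t ((le_max_left _ _).trans ht) u hu) (h' t ((le_max_right _ _).trans ht) u hu)

theorem mul (hf : ExpBound V r f) (hg : ExpBound V s g) :
    ExpBound V (r + s) fun t u => f t u * g t u := by
  intro K hK hc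
  obtain ⟨C, T₁, h0, -, h⟩ := hf.exists_nonneg hK hc 0
  obtain ⟨C', T₁', -, -, h'⟩ := hg.exists_nonneg hK hc 0
  refine ⟨C * C', max T₁ T₁', fun t ht u hu => ?_⟩
  rw [abs_mul, add_mul, Real.exp_add, mul_mul_mul_comm]
  exact mul_le_mul (h t ((le_max_left _ _).trans ht) u hu)
    (h' t ((le_max_right _ _).trans ht) u hu) (abs_nonneg _) (by positivity)

theorem mono (hf : ExpBound V r f) (hrs : r ≤ s) : ExpBound V s f := by
  intro K hK hc
  obtain ⟨C, T₁, h0, hT, h⟩ := hf.exists_nonneg hK hc 0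
  refine ⟨C, T₁, fun t ht u hu => (h t ht u hu).trans ?_⟩
  have : 0 ≤ t := hT.le.trans ht
  gcongr

theorem congr (hf : ExpBound V r f) (T : ℝ) (hfg : ∀ t > T, ∀ u ∈ V, f t u = g t u) :
    ExpBound V r g := by
  intro K hK hc
  obtain ⟨C, T₁, -, hT, h⟩ := hf.exists_nonneg hK hc T
  refine ⟨C, T₁, fun t ht u hu => ?_⟩
  rw [← hfg t (hT.trans_le ht) u (hK hu)]
  exact h t ht u hu

/-- A function of nonpositive rate is bounded on `[T', ∞) × K`, not only for large times. -/
theorem exists_bound (hf : ExpBound V 0 f) {T : ℝ}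
    (hc : ContinuousOn (fun q : ℝ × Plane => f q.1 q.2) (Ioi T ×ˢ V)) {K : Set Plane} (hK : K ⊆ V)
    (hKc : IsCompact K) {T' : ℝ} (hT' : T < T') :
    ∃ C, 0 ≤ C ∧ ∀ u ∈ K, ∀ t ≥ T', |f t u| ≤ C := by
  obtain ⟨C, T₁, h0, -, h⟩ := hf.exists_nonneg hK hKc 0
  obtain ⟨C', h'⟩ := ((isCompact_Icc (a := T') (b := T₁)).prod hKc).exists_bound_of_continuousOn
    (hc.mono (prod_mono (fun t ht => hT'.trans_le ht.1) hK))
  refine ⟨max C C', h0.trans (le_max_left _ _), fun u hu t ht => ?_⟩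
  rcases le_total T₁ t with h1 | h1
  · have := h t h1 u hu
    rw [zero_mul, Real.exp_zero, mul_one] at this
    exact this.trans (le_max_left _ _)
  · exact (h' (t, u) ⟨⟨ht, h1⟩, hu⟩).trans (le_max_right _ _)

/-- If `f - g` decays exponentially and `g` is time-independent and positive, then `1 / f` is
bounded. -/
theorem inv_of_sub {η : ℝ} {g : Plane → ℝ}
    (hη : 0 < η) (h : ExpBound V (-η) fun t u => f t u - g u) (hg : ContinuousOn g V)
    (hpos : ∀ u ∈ V, 0 < g u) : ExpBound V 0 fun t u => (f t u)⁻¹ := by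
  intro K hK hKc
  rcases K.eq_empty_or_nonempty with rfl | hne
  · exact ⟨0, 0, by simp⟩
  obtain ⟨u₀, hu₀, hmin⟩ := hKc.exists_isMinOn hne (hg.mono hK)
  have hc := hpos u₀ (hK hu₀)
  obtain ⟨C, T₁, hC, -, hb⟩ := h.exists_nonneg hK hKc 0
  have hlim := tendsto_mul_exp_neg hη C
  obtain ⟨T₂, hT₂⟩ := eventually_atTop.mp (hlim.eventually (gt_mem_nhds (half_pos hc)))
  refine ⟨(g u₀ / 2)⁻¹, max T₁ T₂, fun t ht u hu => ?_⟩
  have h1 := (hb t ((le_max_left _ _).trans ht) u hu).trans (hT₂ t ((le_max_right _ _).trans ht)).le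
  have h2 : g u₀ ≤ g u := hmin hu
  have h3 : g u₀ / 2 ≤ f t u := by linarith [(abs_le.mp h1).1]
  rw [zero_mul, Real.exp_zero, mul_one, abs_of_nonneg (inv_nonneg.mpr ((half_pos hc).le.trans h3))]
  exact inv_anti₀ (half_pos hc) h3

theorem tendstoUniformlyOn {c : ℝ} (hc : 0 < c)
    (hf : ExpBound V (-c) f) {K : Set Plane} (hK : K ⊆ V) (hKc : IsCompact K) :
    TendstoUniformlyOn f (fun _ => 0) atTop K := by
  obtain ⟨C, T₁, h⟩ := hf K hK hKc
  rw [Metric.tendstoUniformlyOn_iff]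
  intro η hη
  filter_upwards [(tendsto_mul_exp_neg hc C).eventually (gt_mem_nhds hη), eventually_ge_atTop T₁]
    with t ht htT u hu
  rw [dist_zero_left]
  exact (h t htT u hu).trans_lt ht

end ExpBound

namespace Rate

variable {T : ℝ} {V : Set Plane} {n : ℕ} {r s : ℝ} {f g : ℝ → Plane → ℝ}

theorem analytic (hf : Rate T V n r f) :
    AnalyticOnNhd ℝ (fun q : ℝ × Plane => f q.1 q.2) (Ioi T ×ˢ V) := by
  cases n
  exacts [hf.1, hf.1.1]

theorem expBound (hf : Rate T V n r f) : ExpBound V r f := by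
  cases n
  exacts [hf.2, hf.1.2]

theorem dx (hf : Rate T V (n + 1) r f) (a : Fin 2) : Rate T V n r fun t u => partialD a (f t) u :=
  hf.2 a

theorem pred (hf : Rate T V (n + 1) r f) : Rate T V n r f := by
  induction n generalizing f with
  | zero => exact hf.1
  | succ n ih => exact ⟨hf.1, fun a => ih (hf.2 a)⟩

theorem mono_order {m : ℕ} (hf : Rate T V n r f) (h : m ≤ n) : Rate T V m r f := by
  induction h with
  | refl => exact hf
  | step _ ih => exact ih hf.pred

theorem mono (hf : Rate T V n r f) (hrs : r ≤ s) : Rate T V n s f := by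
  induction n generalizing f with
  | zero => exact ⟨hf.1, hf.2.mono hrs⟩
  | succ n ih => exact ⟨⟨hf.1.1, hf.1.2.mono hrs⟩, fun a => ih (hf.2 a)⟩

theorem partialD_congr {f g : Plane → ℝ} (hV : IsOpen V) (h : ∀ u ∈ V, f u = g u) (a : Fin 2) :
    ∀ u ∈ V, partialD a f u = partialD a g u := by
  intro u hu
  rw [partialD, partialD, Filter.EventuallyEq.fderiv_eq]
  filter_upwards [hV.mem_nhds hu] with y hy using h y hy

theorem congr (hV : IsOpen V) (hf : Rate T V n r f) (h : ∀ t > T, ∀ u ∈ V, f t u = g t u) :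
    Rate T V n r g := by
  have h0 : ∀ {f g : ℝ → Plane → ℝ}, (∀ t > T, ∀ u ∈ V, f t u = g t u) →
      AnalyticOnNhd ℝ (fun q : ℝ × Plane => f q.1 q.2) (Ioi T ×ˢ V) →
      AnalyticOnNhd ℝ (fun q : ℝ × Plane => g q.1 q.2) (Ioi T ×ˢ V) := fun h hf =>
    hf.congr (isOpen_Ioi.prod hV) fun q hq => h q.1 hq.1 q.2 hq.2
  induction n generalizing f g with
  | zero => exact ⟨h0 h hf.1, hf.2.congr T h⟩
  | succ n ih => exact ⟨⟨h0 h hf.1.1, hf.1.2.congr T h⟩, fun a => ih (hf.2 a) fun t ht u hu =>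
      partialD_congr hV (h t ht) a u hu⟩

theorem add (hV : IsOpen V) (hf : Rate T V n r f) (hg : Rate T V n r g) :
    Rate T V n r fun t u => f t u + g t u := by
  induction n generalizing f g with
  | zero => exact ⟨hf.1.add hg.1, hf.2.add hg.2⟩
  | succ n ih =>
    refine ⟨⟨hf.1.1.add hg.1.1, hf.1.2.add hg.1.2⟩, fun a =>
      (ih (hf.2 a) (hg.2 a)).congr hV fun t ht u hu => ?_⟩
    have h1 := differentiableAt_snd_of_analyticAt (hf.analytic (t, u) ⟨ht, hu⟩)
    have h2 := differentiableAt_snd_of_analyticAt (hg.analytic (t, u) ⟨ht, hu⟩)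
    simp [partialD, fderiv_fun_add h1 h2]

theorem mul (hV : IsOpen V) (hf : Rate T V n r f) (hg : Rate T V n s g) :
    Rate T V n (r + s) fun t u => f t u * g t u := by
  induction n generalizing f g with
  | zero => exact ⟨hf.1.mul hg.1, hf.2.mul hg.2⟩
  | succ n ih =>
    refine ⟨⟨hf.1.1.mul hg.1.1, hf.1.2.mul hg.1.2⟩, fun a =>
      (add hV (ih hf.pred (hg.2 a)) (ih (hf.2 a) hg.pred)).congr hV fun t ht u hu => ?_⟩
    have h1 := differentiableAt_snd_of_analyticAt (hf.analytic (t, u) ⟨ht, hu⟩)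
    have h2 := differentiableAt_snd_of_analyticAt (hg.analytic (t, u) ⟨ht, hu⟩)
    simp only [partialD, fderiv_fun_mul h1 h2, add_apply, smul_apply,
      smul_eq_mul]
    ring

theorem mul_le {q : ℝ} (hV : IsOpen V) (hf : Rate T V n r f) (hg : Rate T V n s g) (h : r + s ≤ q) :
    Rate T V n q fun t u => f t u * g t u :=
  (hf.mul hV hg).mono h

theorem of_time (n : ℕ) {c : ℝ → ℝ} (hc : AnalyticOnNhd ℝ c (Ioi T))
    (h : ∃ C T₁ : ℝ, ∀ t ≥ T₁, |c t| ≤ C * Real.exp (r * t)) : Rate T V n r fun t _ => c t := by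
  have ha : AnalyticOnNhd ℝ (fun q : ℝ × Plane => c q.1) (Ioi T ×ˢ V) :=
    hc.comp analyticOnNhd_fst fun q hq => hq.1
  have hb : ExpBound V r fun t _ => c t := by
    intro K _ _
    obtain ⟨C, T₁, h⟩ := h
    exact ⟨C, T₁, fun t ht _ _ => h t ht⟩
  induction n generalizing c with
  | zero => exact ⟨ha, hb⟩
  | succ n ih =>
    refine ⟨⟨ha, hb⟩, fun a => ?_⟩
    have h0 : (fun (t : ℝ) (u : Plane) => partialD a (fun _ => c t) u) = fun _ _ => 0 := by
      funext t u
      simp [partialD]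
    rw [h0]
    have h1 : ∃ C T₁ : ℝ, ∀ t ≥ T₁, |(0 : ℝ)| ≤ C * Real.exp (r * t) := ⟨0, 0, by simp⟩
    refine ih (c := fun _ => 0) analyticOnNhd_const h1 analyticOnNhd_const ?_
    intro K _ _
    obtain ⟨C, T₁, h⟩ := h1
    exact ⟨C, T₁, fun t ht _ _ => h t ht⟩

theorem const (n : ℕ) (c : ℝ) : Rate T V n 0 fun _ _ => c :=
  of_time n analyticOnNhd_const ⟨|c|, 0, by simp⟩

theorem exp (n : ℕ) (r : ℝ) : Rate T V n r fun t _ => Real.exp (r * t) :=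
  of_time n (by intro t _; fun_prop) ⟨1, 0, by simp [Real.abs_exp]⟩

/-- Powers of `t` are absorbed into an arbitrarily small exponential rate. -/
theorem time (n : ℕ) (hr : 0 < r) : Rate T V n r fun t _ => t := by
  refine of_time n (by intro t _; fun_prop) ⟨1 / r, 0, fun t ht => ?_⟩
  rw [abs_of_nonneg ht, div_mul_eq_mul_div, one_mul, le_div_iff₀ hr]
  linarith [Real.add_one_le_exp (r * t)]

theorem of_space (n : ℕ) {c : Plane → ℝ} (hc : AnalyticOnNhd ℝ c V) :
    Rate T V n 0 fun _ u => c u := by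
  have ha {c : Plane → ℝ} (hc : AnalyticOnNhd ℝ c V) :
      AnalyticOnNhd ℝ (fun q : ℝ × Plane => c q.2) (Ioi T ×ˢ V) :=
    hc.comp analyticOnNhd_snd fun q hq => hq.2
  have hb {c : Plane → ℝ} (hc : AnalyticOnNhd ℝ c V) : ExpBound V 0 fun _ u => c u := by
    intro K hK hKc
    obtain ⟨C, h⟩ := hKc.exists_bound_of_continuousOn (hc.continuousOn.mono hK)
    exact ⟨C, 0, fun t _ u hu => by simpa using h u hu⟩
  induction n generalizing c with
  | zero => exact ⟨ha hc, hb hc⟩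
  | succ n ih =>
    exact ⟨⟨ha hc, hb hc⟩, fun a => ih (analyticOnNhd_partialD hc a)⟩

theorem const_mul (hV : IsOpen V) (c : ℝ) (hf : Rate T V n r f) :
    Rate T V n r fun t u => c * f t u := by
  simpa using (const n c).mul hV hf

theorem neg (hV : IsOpen V) (hf : Rate T V n r f) : Rate T V n r fun t u => -f t u := by
  simpa using hf.const_mul hV (-1)

theorem sub (hV : IsOpen V) (hf : Rate T V n r f) (hg : Rate T V n r g) :
    Rate T V n r fun t u => f t u - g t u := by
  simpa only [sub_eq_add_neg] using hf.add hV (hg.neg hV)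

theorem sum (hV : IsOpen V) {ι : Type*} (t : Finset ι) {F : ι → ℝ → Plane → ℝ}
    (hF : ∀ i ∈ t, Rate T V n r (F i)) : Rate T V n r fun s u => ∑ i ∈ t, F i s u := by
  classical
  induction t using Finset.induction_on with
  | empty =>
    simp only [Finset.sum_empty]
    exact of_time n analyticOnNhd_const ⟨0, 0, by simp⟩
  | insert i t hi ih =>
    simp only [Finset.sum_insert hi]
    exact add hV (hF i (Finset.mem_insert_self _ _))
      (ih fun j hj => hF j (Finset.mem_insert_of_mem hj))

theorem inv (hV : IsOpen V) (hf : Rate T V n 0 f) (h0 : ∀ t > T, ∀ u ∈ V, f t u ≠ 0)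
    (hb : ExpBound V 0 fun t u => (f t u)⁻¹) : Rate T V n 0 fun t u => (f t u)⁻¹ := by
  have ha : AnalyticOnNhd ℝ (fun q : ℝ × Plane => (f q.1 q.2)⁻¹) (Ioi T ×ˢ V) :=
    hf.analytic.inv fun q hq => h0 q.1 hq.1 q.2 hq.2
  have key : ∀ m ≤ n, Rate T V m 0 fun t u => (f t u)⁻¹ := by
    intro m
    induction m with
    | zero => exact fun _ => ⟨ha, hb⟩
    | succ m ih =>
      intro hm
      refine ⟨⟨ha, hb⟩, fun a => ?_⟩
      have h1 := ih (by omega)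
      have h2 := ((hf.mono_order hm).dx a).neg hV
      have h3 := (h2.mul hV h1).mul hV h1
      simp only [add_zero] at h3
      refine h3.congr hV fun t ht u hu => ?_
      have hd := differentiableAt_snd_of_analyticAt (hf.analytic (t, u) ⟨ht, hu⟩)
      have h5 := ((hasDerivAt_inv (h0 t ht u hu)).comp_hasFDerivAt u hd.hasFDerivAt).fderiv
      have h6 : fderiv ℝ (fun y => (f t y)⁻¹) u = -(f t u ^ 2)⁻¹ • fderiv ℝ (f t) u := h5
      simp only [partialD, h6, smul_apply, smul_eq_mul]
      ring
  exact key n le_rfl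

end Rate

theorem TendsToZeroOn.partialD {T : ℝ} {V : Set Plane} {f : ℝ → Plane → ℝ} (hf : TendsToZeroOn V f)
    (ha : AnalyticOnNhd ℝ (fun q : ℝ × Plane => f q.1 q.2) (Ioi T ×ˢ V)) (a : Fin 2) :
    TendsToZeroOn V fun t u => partialD a (f t) u := by
  intro n K hK hKc
  have h := hf (n + 1) K hK hKc
  rw [Metric.tendstoUniformlyOn_iff] at h ⊢
  intro η hη
  filter_upwards [h η hη, eventually_gt_atTop T] with t ht htT u hu
  have h1 := ht u hu
  rw [dist_zero_left] at h1 ⊢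
  refine lt_of_le_of_lt ?_ h1
  have hc : AnalyticAt ℝ (f t) u :=
    (ha (t, u) ⟨htT, hK hu⟩).comp_of_eq (f := fun y : Plane => (t, y)) (by fun_prop) rfl
  have h2 := norm_iteratedFDeriv_clm_apply_const (n := n) (N := n)
    (c := (EuclideanSpace.single a (1 : ℝ) : Plane)) hc.fderiv.contDiffAt le_rfl
  rw [norm_iteratedFDeriv_fderiv] at h2
  refine h2.trans ?_
  simp

theorem TendsToZeroOn.rate {T : ℝ} {V : Set Plane} {f : ℝ → Plane → ℝ} (hV : IsOpen V)
    (hf : TendsToZeroOn V f)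
    (ha : AnalyticOnNhd ℝ (fun q : ℝ × Plane => f q.1 q.2) (Ioi T ×ˢ V)) (n : ℕ) :
    Rate T V n 0 f := by
  have hb {f : ℝ → Plane → ℝ} (hf : TendsToZeroOn V f) : ExpBound V 0 f := by
    intro K hK hKc
    have h := hf 0 K hK hKc
    rw [Metric.tendstoUniformlyOn_iff] at h
    obtain ⟨T₁, h⟩ := eventually_atTop.mp (h 1 one_pos)
    refine ⟨1, T₁, fun t ht u hu => ?_⟩
    have := h t ht u hu
    rw [dist_zero_left, norm_iteratedFDeriv_zero] at this
    simpa using this.le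
  induction n generalizing f with
  | zero => exact ⟨ha, hb hf⟩
  | succ n ih => exact ⟨⟨ha, hb hf⟩, fun a => ih (hf.partialD ha a) (analyticOnNhd_dx hV ha a)⟩

/-- A field whose remainder `e^{εt} f` tends to zero decays at the rate `e^{-εt}`. -/
theorem TendsToZeroOn.rate_of_exp_mul {T ε : ℝ} {V : Set Plane} {f : ℝ → Plane → ℝ} (hV : IsOpen V)
    (hf : TendsToZeroOn V fun t u => Real.exp (ε * t) * f t u)
    (ha : AnalyticOnNhd ℝ (fun q : ℝ × Plane => f q.1 q.2) (Ioi T ×ˢ V)) (n : ℕ) :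
    Rate T V n (-ε) f := by
  have h1 := hf.rate hV (T := T) ((analyticOnNhd_const.mul analyticOnNhd_fst).rexp.mul ha) n
  have h2 := (Rate.exp (T := T) (V := V) n (-ε)).mul hV h1
  rw [add_zero] at h2
  refine h2.congr hV fun t _ u _ => ?_
  rw [← mul_assoc, ← Real.exp_add]
  simp

/-! ### Asymptotics of the geometry and of the matter fields -/

/-- A local solution of the evolution equations that is AVTD with analytic data `D` satisfying the
asymptotic constraints. -/
structure IsLocalAVTD (ε : Exponents) (D : LocalData) (L : LocalState) (T : ℝ) (V : Set Plane) :
    Prop extends IsLocalSolution L D.v T V where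
  data_sig : ∀ a b, AnalyticOnNhd ℝ (fun u => D.sig u a b) V
  data_phi : AnalyticOnNhd ℝ D.phi V
  data_lam : AnalyticOnNhd ℝ D.lam V
  data_v : AnalyticOnNhd ℝ D.v V
  data_w : AnalyticOnNhd ℝ D.w V
  data_posDef : ∀ u ∈ V, (D.sig u).PosDef
  lam_eq : ∀ t u, L.lam t u = D.lam u - D.v u * t
  lt_v : ∀ u ∈ V, ε.k < D.v u
  ham : ∀ u ∈ V, (1 / 2) * D.v u ^ 2 - 2 * D.w u ^ 2 = 0
  mom : ∀ u ∈ V, ∀ t : ℝ, ∀ b,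
    -D.v u * (partialD b D.lam u - partialD b D.v u * t) + partialD b D.v u
      + 4 * D.w u * (partialD b D.phi u - partialD b D.w u * t) = 0
  remainders : RemaindersTendToZero ε D L V

namespace IsLocalAVTD

variable {ε : Exponents} {D : LocalData} {L : LocalState} {T : ℝ} {V : Set Plane}

theorem analytic_data_sig_inv (h : IsLocalAVTD ε D L T V) (a b : Fin 2) :
    AnalyticOnNhd ℝ (fun u => (D.sig u)⁻¹ a b) V := by
  have hd : ∀ u ∈ V, D.sig u 0 0 * D.sig u 1 1 - D.sig u 0 1 * D.sig u 1 0 ≠ 0 := fun u hu => by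
    rw [← Matrix.det_fin_two]
    exact (h.data_posDef u hu).det_pos.ne'
  simp only [Matrix.inv_fin_two_apply]
  refine (AnalyticOnNhd.inv (((h.data_sig 0 0).mul (h.data_sig 1 1)).sub
    ((h.data_sig 0 1).mul (h.data_sig 1 0))) hd).mul ?_
  simp only [Matrix.adjugate_fin_two]
  fin_cases a <;> fin_cases b
  exacts [h.data_sig 1 1, (h.data_sig 0 1).neg, (h.data_sig 1 0).neg, h.data_sig 0 0]

theorem rate_sig_inv_sub (h : IsLocalAVTD ε D L T V) (n : ℕ) (a b : Fin 2) :
    Rate T V n (-ε.sig) fun t u => (L.sig t u)⁻¹ a b - (D.sig u)⁻¹ a b :=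
  (h.remainders.sig a b).rate_of_exp_mul h.isOpen ((h.analytic_sig_inv a b).sub
    ((h.analytic_data_sig_inv a b).comp analyticOnNhd_snd fun _ hq => hq.2)) n

theorem rate_sig_inv (h : IsLocalAVTD ε D L T V) (n : ℕ) (a b : Fin 2) :
    Rate T V n 0 fun t u => (L.sig t u)⁻¹ a b := by
  have h1 := ((h.rate_sig_inv_sub n a b).mono (neg_nonpos.mpr ε.sig_pos.le)).add h.isOpen
    (Rate.of_space n (h.analytic_data_sig_inv a b))
  simpa using h1

theorem rate_det_sig (h : IsLocalAVTD ε D L T V) (n : ℕ) :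
    Rate T V n 0 fun t u => (L.sig t u).det := by
  have hV := h.isOpen
  have hs := h.rate_sig_inv n
  have hd : Rate T V n 0 fun t u => (L.sig t u)⁻¹ 0 0 * (L.sig t u)⁻¹ 1 1
      - (L.sig t u)⁻¹ 0 1 * (L.sig t u)⁻¹ 1 0 :=
    ((hs 0 0).mul_le hV (hs 1 1) (by simp)).sub hV ((hs 0 1).mul_le hV (hs 1 0) (by simp))
  have hdet : ∀ t u, (L.sig t u)⁻¹ 0 0 * (L.sig t u)⁻¹ 1 1
      - (L.sig t u)⁻¹ 0 1 * (L.sig t u)⁻¹ 1 0 = ((L.sig t u)⁻¹).det := fun t u =>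
    (Matrix.det_fin_two _).symm
  have hi := hd.inv hV (fun t ht u hu => by
    rw [hdet]; exact (h.sig_posDef t ht u hu).inv.det_pos.ne') ?_
  · refine hi.congr hV fun t ht u hu => ?_
    rw [hdet, Matrix.det_nonsing_inv, Ring.inverse_eq_inv', inv_inv]
  · refine ExpBound.inv_of_sub (η := ε.sig) (g := fun u => ((D.sig u)⁻¹).det) ε.sig_pos ?_ ?_ ?_
    · have e (a b c d : Fin 2) : Rate T V 0 (-ε.sig) fun t u =>
          (L.sig t u)⁻¹ a b * ((L.sig t u)⁻¹ c d - (D.sig u)⁻¹ c d)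
            + ((L.sig t u)⁻¹ a b - (D.sig u)⁻¹ a b) * (D.sig u)⁻¹ c d :=
        ((h.rate_sig_inv 0 a b).mul_le hV (h.rate_sig_inv_sub 0 c d) (by simp)).add hV
          ((h.rate_sig_inv_sub 0 a b).mul_le hV
            (Rate.of_space 0 (h.analytic_data_sig_inv c d)) (by simp))
      refine (((e 0 0 1 1).sub hV (e 0 1 1 0)).congr hV fun t ht u hu => ?_).expBound
      rw [Matrix.det_fin_two]
      ring
    · simp only [Matrix.det_fin_two]
      exact (((h.analytic_data_sig_inv 0 0).mul (h.analytic_data_sig_inv 1 1)).sub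
        ((h.analytic_data_sig_inv 0 1).mul (h.analytic_data_sig_inv 1 0))).continuousOn
    · exact fun u hu => (h.data_posDef u hu).inv.det_pos

theorem rate_sig (h : IsLocalAVTD ε D L T V) (n : ℕ) (a b : Fin 2) :
    Rate T V n 0 fun t u => L.sig t u a b := by
  have hV := h.isOpen
  have hs := h.rate_sig_inv n
  have ha : Rate T V n 0 fun t u => ((L.sig t u)⁻¹).adjugate a b := by
    simp only [Matrix.adjugate_fin_two]
    fin_cases a <;> fin_cases b
    exacts [hs 1 1, (hs 0 1).neg hV, (hs 1 0).neg hV, hs 0 0]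
  refine ((h.rate_det_sig n).mul_le hV ha (add_zero 0).le).congr hV fun t ht u hu => ?_
  have h1 := Matrix.inv_fin_two_apply (L.sig t u)⁻¹ a b
  rw [Matrix.nonsing_inv_nonsing_inv _ (h.isUnit_det_sig ht hu), ← Matrix.det_fin_two,
    Matrix.det_nonsing_inv, Ring.inverse_eq_inv', inv_inv] at h1
  exact h1.symm

theorem analytic_exp_lam (h : IsLocalAVTD ε D L T V) :
    AnalyticOnNhd ℝ (fun q : ℝ × Plane => Real.exp (L.lam q.1 q.2)) (Ioi T ×ˢ V) :=
  h.lam.rexp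

theorem exp_lam_mul (h : IsLocalAVTD ε D L T V) (t : ℝ) (u : Plane) :
    Real.exp (L.lam t u) * Real.exp (D.v u * t) = Real.exp (D.lam u) := by
  rw [← Real.exp_add, h.lam_eq]
  ring_nf

theorem rate_exp_lam (h : IsLocalAVTD ε D L T V) :
    Rate T V 0 (-ε.k) fun t u => Real.exp (L.lam t u) := by
  refine ⟨h.analytic_exp_lam, fun K hK hKc => ?_⟩
  obtain ⟨C, hC⟩ := hKc.exists_bound_of_continuousOn (h.data_lam.rexp.continuousOn.mono hK)
  refine ⟨C, 0, fun t ht u hu => ?_⟩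
  have h1 := hC u hu
  rw [Real.norm_eq_abs, Real.abs_exp] at h1
  rw [Real.abs_exp, h.lam_eq, sub_eq_add_neg, Real.exp_add]
  have h2 := h.lt_v u (hK hu)
  have h3 : 0 ≤ C := (Real.exp_pos _).le.trans h1
  gcongr
  nlinarith

theorem partialD_lam (h : IsLocalAVTD ε D L T V) (t : ℝ) {u : Plane} (hu : u ∈ V) (a : Fin 2) :
    partialD a (L.lam t) u = partialD a D.lam u - partialD a D.v u * t := by
  have h1 : L.lam t = fun y => D.lam y - D.v y * t := funext (h.lam_eq t)
  have h2 := (h.data_lam u hu).differentiableAt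
  have h3 := (h.data_v u hu).differentiableAt
  simp only [partialD, h1]
  rw [fderiv_fun_sub h2 (h3.mul_const t), fderiv_mul_const h3]
  simp [mul_comm]

/-- `∂_a f - t ∂_a g` grows slower than any exponential. -/
theorem rate_affine (hV : IsOpen V) (n : ℕ) {δ : ℝ} (hδ : 0 < δ) {f g : Plane → ℝ}
    (hf : AnalyticOnNhd ℝ f V) (hg : AnalyticOnNhd ℝ g V) (a : Fin 2) :
    Rate T V n δ fun t u => partialD a f u - partialD a g u * t :=
  ((Rate.of_space n (analyticOnNhd_partialD hf a)).mono hδ.le).sub hV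
    ((Rate.of_space n (analyticOnNhd_partialD hg a)).mul_le hV (Rate.time n hδ) (by simp))

theorem rate_partialD_lam (h : IsLocalAVTD ε D L T V) (n : ℕ) {δ : ℝ} (hδ : 0 < δ) (a : Fin 2) :
    Rate T V n δ fun t u => partialD a (L.lam t) u :=
  (rate_affine h.isOpen n hδ h.data_lam h.data_v a).congr h.isOpen fun t _ _ hu =>
    (h.partialD_lam t hu a).symm

theorem partialD_gam (h : IsLocalAVTD ε D L T V) {t : ℝ} (ht : t > T) {u : Plane} (hu : u ∈ V)
    (c a b : Fin 2) :
    partialD c (fun y => L.gam t y a b) u = Real.exp (L.lam t u) *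
      (partialD c (L.lam t) u * L.sig t u a b + partialD c (fun y => L.sig t y a b) u) := by
  have h1 := differentiableAt_snd_of_analyticAt (f := L.lam) (h.lam (t, u) ⟨ht, hu⟩)
  have h2 := differentiableAt_snd_of_analyticAt (f := fun t u => L.sig t u a b)
    (h.sig a b (t, u) ⟨ht, hu⟩)
  have h3 : (fun y => L.gam t y a b) = fun y => Real.exp (L.lam t y) * L.sig t y a b := by
    funext y
    simp [LocalState.gam]
  simp only [partialD, h3, fderiv_fun_mul h1.exp h2, fderiv_exp h1, add_apply, smul_apply,
    smul_eq_mul]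
  ring

theorem christoffel_gam (h : IsLocalAVTD ε D L T V) {t : ℝ} (ht : t > T) {u : Plane} (hu : u ∈ V)
    (c a b : Fin 2) :
    christoffel (L.gam t) c a b u = (1 / 2) * ∑ d, (L.sig t u)⁻¹ c d *
      ((partialD a (L.lam t) u * L.sig t u d b + partialD a (fun y => L.sig t y d b) u)
        + (partialD b (L.lam t) u * L.sig t u d a + partialD b (fun y => L.sig t y d a) u)
        - (partialD d (L.lam t) u * L.sig t u a b + partialD d (fun y => L.sig t y a b) u)) := by
  have h0 : Real.exp (-L.lam t u) * Real.exp (L.lam t u) = 1 := by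
    rw [← Real.exp_add]
    simp
  rw [christoffel]
  congr 1
  refine Finset.sum_congr rfl fun d _ => ?_
  rw [h.partialD_gam ht hu, h.partialD_gam ht hu, h.partialD_gam ht hu, h.gam_inv ht hu,
    Matrix.smul_apply, smul_eq_mul]
  linear_combination (L.sig t u)⁻¹ c d *
      ((partialD a (L.lam t) u * L.sig t u d b + partialD a (fun y => L.sig t y d b) u)
        + (partialD b (L.lam t) u * L.sig t u d a + partialD b (fun y => L.sig t y d a) u)
        - (partialD d (L.lam t) u * L.sig t u a b + partialD d (fun y => L.sig t y a b) u)) * h0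

theorem rate_christoffel (h : IsLocalAVTD ε D L T V) (n : ℕ) {δ : ℝ} (hδ : 0 < δ) (c a b : Fin 2) :
    Rate T V n δ fun t u => christoffel (L.gam t) c a b u := by
  have hV := h.isOpen
  have e (c a b : Fin 2) : Rate T V n δ fun t u =>
      partialD c (L.lam t) u * L.sig t u a b + partialD c (fun y => L.sig t y a b) u :=
    ((h.rate_partialD_lam n hδ c).mul_le hV (h.rate_sig n a b) (by simp)).add hV
      (((h.rate_sig (n + 1) a b).dx c).mono hδ.le)
  refine Rate.congr hV (Rate.const_mul hV (1 / 2) (Rate.sum hV Finset.univ fun d _ =>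
    (h.rate_sig_inv n c d).mul_le hV (((e a d b).add hV (e b d a)).sub hV (e d a b))
      (zero_add δ).le)) fun t ht u hu => (h.christoffel_gam ht hu c a b).symm

theorem rate_ricci (h : IsLocalAVTD ε D L T V) (n : ℕ) {δ : ℝ} (hδ : 0 < δ) (a b : Fin 2) :
    Rate T V n δ fun t u => ricci (L.gam t) a b u := by
  have hV := h.isOpen
  have g := fun c a b => h.rate_christoffel n (half_pos hδ) c a b
  have dg := fun d c a b => ((h.rate_christoffel (n + 1) hδ c a b).dx d)
  have hδ' : δ / 2 + δ / 2 ≤ δ := (add_halves δ).le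
  simp only [ricci]
  exact Rate.sum hV _ fun c _ => ((dg c c a b).sub hV (dg b c a c)).add hV
    (Rate.sum hV _ fun d _ => ((g c c d).mul_le hV (g d a b) hδ').sub hV
      ((g c b d).mul_le hV (g d a c) hδ'))

/-- The deviation of `e^λ k_a^b` from its limit. -/
def devK (D : LocalData) (L : LocalState) (a b : Fin 2) (t : ℝ) (u : Plane) : ℝ :=
  Real.exp (L.lam t u) * L.kMixed t u a b - (1 / 2) * D.v u * (1 : Matrix _ _ ℝ) a b

/-- The deviation of `e^λ p` from its limit. -/
def devP (D : LocalData) (L : LocalState) (t : ℝ) (u : Plane) : ℝ :=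
  Real.exp (L.lam t u) * L.p t u + D.w u

/-- The deviation of `∂_a φ` from its asymptotic form. -/
def devPhi (D : LocalData) (L : LocalState) (a : Fin 2) (t : ℝ) (u : Plane) : ℝ :=
  partialD a (L.phi t) u - (partialD a D.phi u - partialD a D.w u * t)

theorem rate_devK (h : IsLocalAVTD ε D L T V) (n : ℕ) (a b : Fin 2) :
    Rate T V n (-ε.k) (devK D L a b) := by
  refine (h.remainders.k a b).rate_of_exp_mul h.isOpen ?_ n
  have h1 : AnalyticOnNhd ℝ (fun q : ℝ × Plane => L.kMixed q.1 q.2 a b) (Ioi T ×ˢ V) :=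
    (h.rep_m a b).analyticOnNhd
  exact (h.analytic_exp_lam.mul h1).sub ((analyticOnNhd_const.mul
    (h.data_v.comp analyticOnNhd_snd fun _ hq => hq.2)).mul analyticOnNhd_const)

theorem rate_devP (h : IsLocalAVTD ε D L T V) (n : ℕ) : Rate T V n (-ε.p) (devP D L) :=
  h.remainders.p.rate_of_exp_mul h.isOpen ((h.analytic_exp_lam.mul h.p).add
    (h.data_w.comp analyticOnNhd_snd fun _ hq => hq.2)) n

theorem rate_devPhi (h : IsLocalAVTD ε D L T V) (n : ℕ) (a : Fin 2) :
    Rate T V n (-ε.phiD) (devPhi D L a) := by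
  have h1 := (rate_affine (T := T) h.isOpen n one_pos h.data_phi h.data_w a).analytic
  exact (h.remainders.phiD a).rate_of_exp_mul h.isOpen
    ((analyticOnNhd_dx h.isOpen h.phi a).sub h1) n

end IsLocalAVTD

/-! ### Decay of the constraint functions -/

namespace IsLocalAVTD

variable {ε : Exponents} {D : LocalData} {L : LocalState} {T : ℝ} {V : Set Plane}

theorem exp_mul_kMixed (t : ℝ) (u : Plane) (a b : Fin 2) :
    Real.exp (L.lam t u) * L.kMixed t u a b
      = devK D L a b t u + (1 / 2) * D.v u * (1 : Matrix _ _ ℝ) a b := by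
  rw [devK]
  ring

theorem tau_eq_sum (t : ℝ) (u : Plane) : L.tau t u = ∑ a, L.kMixed t u a a := rfl

theorem exp_mul_tau_sub (t : ℝ) (u : Plane) :
    Real.exp (L.lam t u) * L.tau t u - D.v u = ∑ a, devK D L a a t u := by
  rw [tau_eq_sum, Finset.mul_sum]
  simp only [exp_mul_kMixed (D := D), Fin.sum_univ_two, Matrix.one_apply_eq]
  ring

theorem analytic_kMixed (h : IsLocalAVTD ε D L T V) (a b : Fin 2) :
    AnalyticOnNhd ℝ (fun q : ℝ × Plane => L.kMixed q.1 q.2 a b) (Ioi T ×ˢ V) :=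
  (h.rep_m a b).analyticOnNhd

theorem exp_mul_partialD_kMixed (h : IsLocalAVTD ε D L T V) {t : ℝ} (ht : t > T) {u : Plane}
    (hu : u ∈ V) (c a b : Fin 2) :
    Real.exp (L.lam t u) * partialD c (fun y => L.kMixed t y a b) u
      = partialD c (devK D L a b t) u + (1 / 2) * partialD c D.v u * (1 : Matrix _ _ ℝ) a b
        - partialD c (L.lam t) u *
          (devK D L a b t u + (1 / 2) * D.v u * (1 : Matrix _ _ ℝ) a b) := by
  have h1 := differentiableAt_snd_of_analyticAt (f := L.lam) (h.lam (t, u) ⟨ht, hu⟩)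
  have h2 := differentiableAt_snd_of_analyticAt (f := fun t u => L.kMixed t u a b)
    (h.analytic_kMixed a b (t, u) ⟨ht, hu⟩)
  have h3 := (h.data_v u hu).differentiableAt
  have h4 : devK D L a b t = fun y => Real.exp (L.lam t y) * L.kMixed t y a b
      - D.v y * ((1 / 2) * (1 : Matrix _ _ ℝ) a b) := by
    funext y
    rw [devK]
    ring
  have h5 : partialD c (devK D L a b t) u = Real.exp (L.lam t u) *
      (partialD c (L.lam t) u * L.kMixed t u a b + partialD c (fun y => L.kMixed t y a b) u)
      - partialD c D.v u * ((1 / 2) * (1 : Matrix _ _ ℝ) a b) := by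
    have h6 : DifferentiableAt ℝ (fun y => Real.exp (L.lam t y) * L.kMixed t y a b) u :=
      h1.exp.mul h2
    rw [partialD, h4, fderiv_fun_sub h6 (h3.mul_const _), fderiv_fun_mul h1.exp h2,
      fderiv_exp h1, fderiv_mul_const h3]
    simp only [partialD, add_apply, sub_apply, smul_apply, smul_eq_mul]
    ring
  rw [h5, ← exp_mul_kMixed]
  ring

theorem partialD_tau (h : IsLocalAVTD ε D L T V) {t : ℝ} (ht : t > T) {u : Plane}
    (hu : u ∈ V) (c : Fin 2) :
    partialD c (L.tau t) u = ∑ a, partialD c (fun y => L.kMixed t y a a) u := by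
  have h2 a := differentiableAt_snd_of_analyticAt (f := fun t u => L.kMixed t u a a)
    (h.analytic_kMixed a a (t, u) ⟨ht, hu⟩)
  have h3 : L.tau t = fun y => ∑ a, L.kMixed t y a a := funext fun y => tau_eq_sum t y
  simp only [partialD, h3]
  rw [fderiv_fun_sum fun a _ => h2 a]
  simp

/-- The momentum constraint function in terms of the deviations from the asymptotic fields: the
leading part cancels by the asymptotic momentum constraint. -/
theorem Evec_eq (h : IsLocalAVTD ε D L T V) {t : ℝ} (ht : t > T) {u : Plane} (hu : u ∈ V)
    (a : Fin 2) :
    L.Evec t u a = -((∑ b, (partialD b (devK D L a b t) u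
          - partialD b (L.lam t) u * devK D L a b t u
          + ∑ c, (christoffel (L.gam t) b b c u * devK D L a c t u
            - christoffel (L.gam t) c b a u * devK D L c b t u)))
        - (∑ b, (partialD a (devK D L b b t) u - partialD a (L.lam t) u * devK D L b b t u))
        + 2 * (devP D L t u * (partialD a D.phi u - partialD a D.w u * t)
          - D.w u * devPhi D L a t u + devP D L t u * devPhi D L a t u)) := by
  have hk := exp_mul_kMixed (D := D) (L := L) t u
  have hdk := h.exp_mul_partialD_kMixed ht hu
  have hp : Real.exp (L.lam t u) * L.p t u = devP D L t u - D.w u := by rw [devP]; ring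
  have hphi : partialD a (L.phi t) u
      = devPhi D L a t u + (partialD a D.phi u - partialD a D.w u * t) := by rw [devPhi]; ring
  have hm := h.mom u hu t a
  rw [← h.partialD_lam t hu] at hm
  have e : L.Evec t u a = -((∑ b, (Real.exp (L.lam t u) * partialD b (fun y => L.kMixed t y a b) u
      + ∑ c, (christoffel (L.gam t) b b c u * (Real.exp (L.lam t u) * L.kMixed t u a c)
        - christoffel (L.gam t) c b a u * (Real.exp (L.lam t u) * L.kMixed t u c b))))
      - (∑ b, Real.exp (L.lam t u) * partialD a (fun y => L.kMixed t y b b) u)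
      + 2 * (Real.exp (L.lam t u) * L.p t u) * partialD a (L.phi t) u) := by
    rw [LocalState.Evec, LocalState.Cvec, divMixed, h.partialD_tau ht hu]
    simp only [Fin.sum_univ_two]
    ring
  rw [e, hp, hphi]
  simp only [hdk, hk]
  have ha : a = 0 ∨ a = 1 := by omega
  rcases ha with rfl | rfl <;> simp [Fin.sum_univ_two] at hm ⊢ <;> linear_combination (1 / 2) * hm

/-- The Hamiltonian constraint function in terms of the deviations from the asymptotic fields: the
leading part cancels by the asymptotic Hamiltonian constraint. -/
theorem E0_eq (h : IsLocalAVTD ε D L T V) {t : ℝ} (ht : t > T) {u : Plane} (hu : u ∈ V) :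
    L.E0 t u = -(1 / 2) * (Real.exp (L.lam t u) * (∑ a, ∑ b, (L.sig t u)⁻¹ a b *
          (ricci (L.gam t) a b u - 2 * (partialD a (L.phi t) u * partialD b (L.phi t) u)))
        - (∑ a, ∑ b, devK D L a b t u * devK D L b a t u)
        + (∑ a, devK D L a a t u) * (∑ a, devK D L a a t u) + D.v u * (∑ a, devK D L a a t u)
        + 4 * (D.w u * devP D L t u) - 2 * (devP D L t u * devP D L t u)) := by
  have hk := exp_mul_kMixed (D := D) (L := L) t u
  have ht' := exp_mul_tau_sub (D := D) (L := L) t u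
  have hp : Real.exp (L.lam t u) * L.p t u = devP D L t u - D.w u := by rw [devP]; ring
  have h0 : Real.exp (L.lam t u) * Real.exp (-L.lam t u) = 1 := by
    rw [← Real.exp_add]
    simp
  have hh := h.ham u hu
  have e2 : Real.exp (2 * L.lam t u) = Real.exp (L.lam t u) * Real.exp (L.lam t u) := by
    rw [← Real.exp_add, two_mul]
  have hg (F : Fin 2 → Fin 2 → ℝ) : Real.exp (L.lam t u) * ∑ a, ∑ b, (L.gam t u)⁻¹ a b * F a b
      = ∑ a, ∑ b, (L.sig t u)⁻¹ a b * F a b := by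
    rw [Finset.mul_sum]
    refine Finset.sum_congr rfl fun a _ => ?_
    rw [Finset.mul_sum]
    refine Finset.sum_congr rfl fun b _ => ?_
    rw [h.gam_inv ht hu, Matrix.smul_apply, smul_eq_mul]
    linear_combination (L.sig t u)⁻¹ a b * F a b * h0
  have e : L.E0 t u = -(1 / 2) * (Real.exp (L.lam t u) * (Real.exp (L.lam t u)
          * scalarCurv (L.gam t) u)
        - (∑ a, ∑ b, (Real.exp (L.lam t u) * L.kMixed t u a b)
          * (Real.exp (L.lam t u) * L.kMixed t u b a))
        + (Real.exp (L.lam t u) * L.tau t u) ^ 2 - 2 * (Real.exp (L.lam t u) * L.p t u) ^ 2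
        - 2 * Real.exp (L.lam t u) * (Real.exp (L.lam t u) *
          ∑ a, ∑ b, (L.gam t u)⁻¹ a b * (partialD a (L.phi t) u * partialD b (L.phi t) u))) := by
    rw [LocalState.E0, LocalState.C0, e2]
    simp only [Fin.sum_univ_two]
    ring
  rw [e, hp, scalarCurv, hg, hg, sub_eq_iff_eq_add.mp ht']
  simp only [hk]
  simp [Fin.sum_univ_two]
  linear_combination hh

/-- The decay rate of the constraint quantities obtained directly from the asymptotics. -/
def decay (ε : Exponents) : ℝ := min ε.k (min ε.p ε.phiD) / 4

theorem decay_pos : 0 < decay ε := by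
  have := lt_min ε.k_pos (lt_min ε.p_pos ε.phiD_pos)
  rw [decay]
  positivity

theorem decay_le_k : 4 * decay ε ≤ ε.k := by
  rw [decay]
  linarith [min_le_left ε.k (min ε.p ε.phiD)]

theorem decay_le_p : 4 * decay ε ≤ ε.p := by
  rw [decay]
  linarith [min_le_right ε.k (min ε.p ε.phiD), min_le_left ε.p ε.phiD]

theorem decay_le_phiD : 4 * decay ε ≤ ε.phiD := by
  rw [decay]
  linarith [min_le_right ε.k (min ε.p ε.phiD), min_le_right ε.p ε.phiD]

theorem rate_Evec (h : IsLocalAVTD ε D L T V) (n : ℕ) (a : Fin 2) :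
    Rate T V n (-decay ε) fun t u => L.Evec t u a := by
  have hV := h.isOpen
  have hη := decay_pos (ε := ε)
  have hk := decay_le_k (ε := ε)
  have hp := decay_le_p (ε := ε)
  have hf := decay_le_phiD (ε := ε)
  have x := h.rate_devK n
  have dx := fun c a b => ((h.rate_devK (n + 1) a b).dx c).mono (s := -decay ε) (by linarith)
  have l := h.rate_partialD_lam n hη
  have g := h.rate_christoffel n hη
  have y := h.rate_devP n
  have z := h.rate_devPhi n a
  refine Rate.congr hV (Rate.neg hV (Rate.add hV (Rate.sub hV (Rate.sum hV _ fun b _ =>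
    ((dx b a b).sub hV ((l b).mul_le hV (x a b) (by linarith))).add hV (Rate.sum hV _ fun c _ =>
      ((g b b c).mul_le hV (x a c) (by linarith)).sub hV
        ((g c b a).mul_le hV (x c b) (by linarith))))
    (Rate.sum hV _ fun b _ => (dx a b b).sub hV ((l a).mul_le hV (x b b) (by linarith))))
    (Rate.const_mul hV 2 (Rate.add hV (Rate.sub hV
      (y.mul_le hV (rate_affine hV n hη h.data_phi h.data_w a) (by linarith))
      ((Rate.of_space n h.data_w).mul_le hV z (by linarith))) (y.mul_le hV z (by linarith))))))
    fun t ht u hu => (h.Evec_eq ht hu a).symm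

theorem rate_partialD_phi (h : IsLocalAVTD ε D L T V) (n : ℕ) {δ : ℝ} (hδ : 0 < δ) (a : Fin 2) :
    Rate T V n δ fun t u => partialD a (L.phi t) u := by
  refine (((h.rate_devPhi n a).mono (by linarith [ε.phiD_pos])).add h.isOpen
    (rate_affine h.isOpen n hδ h.data_phi h.data_w a)).congr h.isOpen fun t _ u _ => ?_
  rw [devPhi]
  ring

theorem rate_E0 (h : IsLocalAVTD ε D L T V) : Rate T V 0 (-decay ε) L.E0 := by
  have hV := h.isOpen
  have hη := decay_pos (ε := ε)
  have hk := decay_le_k (ε := ε)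
  have hp := decay_le_p (ε := ε)
  have x := h.rate_devK 0
  have y := h.rate_devP 0
  have f := h.rate_partialD_phi 0 hη
  have θ : Rate T V 0 (-ε.k) fun t u => ∑ a, devK D L a a t u := Rate.sum hV _ fun a _ => x a a
  refine Rate.congr hV (Rate.const_mul hV (-(1 / 2)) (Rate.sub hV (Rate.add hV (Rate.add hV
    (Rate.add hV (Rate.sub hV (h.rate_exp_lam.mul_le hV (s := 2 * decay ε)
      (Rate.sum hV _ fun a _ => Rate.sum hV _ fun b _ => (h.rate_sig_inv 0 a b).mul_le hV
        (Rate.sub hV (h.rate_ricci 0 (δ := 2 * decay ε) (by linarith) a b)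
          (Rate.const_mul hV 2 ((f a).mul_le hV (f b) (by linarith)))) (by linarith)) (by linarith))
      (Rate.sum hV _ fun a _ => Rate.sum hV _ fun b _ =>
        (x a b).mul_le hV (x b a) (by linarith)))
      (θ.mul_le hV θ (by linarith))) ((Rate.of_space 0 h.data_v).mul_le hV θ (by linarith)))
      (Rate.const_mul hV 4 ((Rate.of_space 0 h.data_w).mul_le hV y (by linarith))))
      (Rate.const_mul hV 2 (y.mul_le hV y (by linarith)))))
    fun t ht u hu => (h.E0_eq ht hu).symm

end IsLocalAVTD

/-! ### The Fuchsian form of the propagation system -/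

/-- A linear first-order system whose coefficients decay at the rate `e^{-μt}` is of Fuchsian form
with respect to any diagonal operator with positive entries. -/
theorem isFuchsianForm_linear {ι : Type} [Fintype ι] [DecidableEq ι] {T μ : ℝ} {V : Set Plane}
    (hμ : 0 < μ) (hV : IsOpen V) (d : ι → ℝ) (hd : ∀ i, 0 < d i) {α : ℝ → Plane → Matrix ι ι ℝ}
    {β : Fin 2 → ℝ → Plane → Matrix ι ι ℝ} (hα : ∀ i j, Rate T V 0 (-μ) fun t u => α t u i j)
    (hβ : ∀ a i j, Rate T V 0 (-μ) fun t u => β a t u i j) :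
    IsFuchsianForm T V (fun _ => Matrix.diagonal d) μ
      (fun u t U W => Real.exp (μ * t) • (α t u *ᵥ U + ∑ a, β a t u *ᵥ W a)) := by
  have hα' i j : Rate T V 0 0 fun t u => Real.exp (μ * t) * α t u i j :=
    (Rate.exp 0 μ).mul_le hV (hα i j) (by simp)
  have hβ' a i j : Rate T V 0 0 fun t u => Real.exp (μ * t) * β a t u i j :=
    (Rate.exp 0 μ).mul_le hV (hβ a i j) (by simp)
  have hF : ∀ (u : Plane) (t : ℝ) (U : ι → ℝ) (W : Fin 2 → ι → ℝ) (i : ι),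
      (Real.exp (μ * t) • (α t u *ᵥ U + ∑ a, β a t u *ᵥ W a)) i
        = (∑ j, (Real.exp (μ * t) * α t u i j) * U j)
          + ∑ a, ∑ j, (Real.exp (μ * t) * β a t u i j) * W a j := by
    intro u t U W i
    simp only [Pi.smul_apply, Pi.add_apply, Finset.sum_apply, Matrix.mulVec, dotProduct,
      smul_eq_mul, mul_add, Finset.mul_sum, mul_assoc]
  refine ⟨hμ, fun i j => analyticOnNhd_const, ?_, ?_, ?_, ?_⟩
  · intro u _ z hz
    rw [Matrix.diagonal_map (by simp), spectrum_diagonal] at hz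
    obtain ⟨i, rfl⟩ := hz
    simpa using hd i
  · intro U W i
    have hswap {f : ℝ → Plane → ℝ} (hf : Rate T V 0 0 f) :
        AnalyticOnNhd ℝ (fun q : Plane × ℝ => f q.2 q.1) (V ×ˢ Ioi T) :=
      hf.analytic.comp (analyticOnNhd_snd.prod analyticOnNhd_fst) fun q hq => ⟨hq.2, hq.1⟩
    simp only [hF]
    exact (Finset.analyticOnNhd_fun_sum _ fun j _ => (hswap (hα' i j)).mul analyticOnNhd_const).add
      (Finset.analyticOnNhd_fun_sum _ fun a _ => Finset.analyticOnNhd_fun_sum _ fun j _ =>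
        (hswap (hβ' a i j)).mul analyticOnNhd_const)
  · intro K _ _ T' _
    exact ⟨0, fun u _ t _ => by simp⟩
  · intro K hK hKc T' hT' R
    choose a ha0 ha using fun i j =>
      (hα' i j).expBound.exists_bound (hα' i j).analytic.continuousOn hK hKc hT'
    choose b hb0 hb using fun c i j =>
      (hβ' c i j).expBound.exists_bound (hβ' c i j).analytic.continuousOn hK hKc hT'
    have hA0 : 0 ≤ ∑ i, ∑ j, a i j := Finset.sum_nonneg fun i _ =>
      Finset.sum_nonneg fun j _ => ha0 i j
    have hB0 : 0 ≤ ∑ i, ∑ c, ∑ j, b c i j := Finset.sum_nonneg fun i _ =>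
      Finset.sum_nonneg fun c _ => Finset.sum_nonneg fun j _ => hb0 c i j
    refine ⟨(∑ i, ∑ j, a i j) + ∑ i, ∑ c, ∑ j, b c i j,
      fun u hu t ht U U' W W' _ _ _ _ => ?_⟩
    refine (pi_norm_le_iff_of_nonneg (by positivity)).mpr fun i => ?_
    have h1 : |∑ j, (Real.exp (μ * t) * α t u i j) * (U j - U' j)|
        ≤ (∑ i, ∑ j, a i j) * ‖U - U'‖ := by
      refine (Finset.abs_sum_le_sum_abs _ _).trans (le_trans ?_ (mul_le_mul_of_nonneg_right
        (Finset.single_le_sum (f := fun i => ∑ j, a i j)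
          (fun i _ => Finset.sum_nonneg fun j _ => ha0 i j) (Finset.mem_univ i)) (norm_nonneg _)))
      rw [Finset.sum_mul]
      refine Finset.sum_le_sum fun j _ => ?_
      rw [abs_mul]
      exact mul_le_mul (ha i j u hu t ht) (norm_le_pi_norm (U - U') j) (abs_nonneg _) (ha0 i j)
    have h2 : |∑ c, ∑ j, (Real.exp (μ * t) * β c t u i j) * (W c j - W' c j)|
        ≤ (∑ i, ∑ c, ∑ j, b c i j) * ‖W - W'‖ := by
      refine (Finset.abs_sum_le_sum_abs _ _).trans (le_trans ?_ (mul_le_mul_of_nonneg_right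
        (Finset.single_le_sum (f := fun i => ∑ c, ∑ j, b c i j) (fun i _ => Finset.sum_nonneg
          fun c _ => Finset.sum_nonneg fun j _ => hb0 c i j) (Finset.mem_univ i)) (norm_nonneg _)))
      rw [Finset.sum_mul]
      refine Finset.sum_le_sum fun c _ => (Finset.abs_sum_le_sum_abs _ _).trans ?_
      rw [Finset.sum_mul]
      refine Finset.sum_le_sum fun j _ => ?_
      rw [abs_mul]
      exact mul_le_mul (hb c i j u hu t ht) ((norm_le_pi_norm ((W - W') c) j).trans
        (norm_le_pi_norm (W - W') c)) (abs_nonneg _) (hb0 c i j)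
    rw [Pi.sub_apply, hF, hF, Real.norm_eq_abs]
    have e : ((∑ j, (Real.exp (μ * t) * α t u i j) * U j)
          + ∑ c, ∑ j, (Real.exp (μ * t) * β c t u i j) * W c j)
        - ((∑ j, (Real.exp (μ * t) * α t u i j) * U' j)
          + ∑ c, ∑ j, (Real.exp (μ * t) * β c t u i j) * W' c j)
        = (∑ j, (Real.exp (μ * t) * α t u i j) * (U j - U' j))
          + ∑ c, ∑ j, (Real.exp (μ * t) * β c t u i j) * (W c j - W' c j) := by
      simp only [mul_sub, Finset.sum_sub_distrib]
      ring
    rw [e]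
    refine (abs_add_le _ _).trans ((add_le_add h1 h2).trans ?_)
    nlinarith [norm_nonneg (U - U'), norm_nonneg (W - W')]

namespace IsLocalAVTD

variable {ε : Exponents} {D : LocalData} {L : LocalState} {T : ℝ} {V : Set Plane}

/-- The coefficient of `E_c` in the lower-order part of `e^λ σ^{ab} (∇_a E_b + ∂_aλ E_b)`. -/
def lowerCoeff (L : LocalState) (c : Fin 2) (t : ℝ) (u : Plane) : ℝ :=
  ∑ a, ((L.sig t u)⁻¹ a c * partialD a (L.lam t) u
    - ∑ b, (L.sig t u)⁻¹ a b * christoffel (L.gam t) c a b u)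

theorem rate_lowerCoeff (h : IsLocalAVTD ε D L T V) (n : ℕ) {δ : ℝ} (hδ : 0 < δ) (c : Fin 2) :
    Rate T V n δ (lowerCoeff L c) :=
  have hV := h.isOpen
  Rate.sum hV _ fun a _ => ((h.rate_sig_inv n a c).mul_le hV (h.rate_partialD_lam n hδ a)
    (zero_add δ).le).sub hV (Rate.sum hV _ fun b _ =>
      (h.rate_sig_inv n a b).mul_le hV (h.rate_christoffel n hδ c a b) (zero_add δ).le)

/-- The right-hand side of the evolution equation for `W₀`, with derivatives and lower-order
terms separated. -/
theorem propagation_source (t : ℝ) (u : Plane) (W : Plane → Fin 2 → ℝ) :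
    Real.exp (L.lam t u) * (∑ a, ∑ b, (L.sig t u)⁻¹ a b * covDCovector (L.gam t) W a b u)
        + ∑ a, ∑ b, (L.sig t u)⁻¹ a b * Real.exp (L.lam t u) * partialD a (L.lam t) u * W u b
      = Real.exp (L.lam t u) * ((∑ a, ∑ b, (L.sig t u)⁻¹ a b * partialD a (fun y => W y b) u)
        + ∑ c, lowerCoeff L c t u * W u c) := by
  simp only [covDCovector, lowerCoeff, Fin.sum_univ_two]
  ring

theorem isFuchsianSystem (h : IsLocalAVTD ε D L T V) {ε₀ ε₁ : ℝ} (h1 : 0 < ε₁) (h01 : ε₁ < ε₀)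
    (h0 : ε₀ < ε.k) :
    IsFuchsianSystem T V (min (ε₀ - ε₁) ε₁) (L.RescaledPropagation D.v T V ε₀ ε₁) := by
  have hV := h.isOpen
  -- The exponent `ε₁ - ε₀` comes from `∂_a U₀` in the equations of `U_a`. In the equation of `U₀`,
  -- the factor `e^λ = O(e^{-ε_k t})` leaves the exponent `-ε₁` after absorbing the growth of `∂λ`.
  set μ := min (ε₀ - ε₁) ε₁ with hμ
  have hμ0 : 0 < μ := lt_min (sub_pos.mpr h01) h1
  have hμ1 : μ ≤ ε₀ - ε₁ := min_le_left _ _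
  have hμ2 : μ ≤ ε₁ := min_le_right _ _
  let θ : ℝ → Plane → ℝ := fun t u => ∑ a, devK D L a a t u
  let B : Fin 2 → ℝ → Plane → ℝ := fun c t u =>
    -(Real.exp ((ε₀ - ε₁) * t) * (Real.exp (L.lam t u) * lowerCoeff L c t u))
  let s : Fin 2 → Fin 2 → ℝ → Plane → ℝ := fun a b t u =>
    -(Real.exp ((ε₀ - ε₁) * t) * (Real.exp (L.lam t u) * (L.sig t u)⁻¹ a b))
  let r : ℝ → Plane → ℝ := fun t _ => -Real.exp ((ε₁ - ε₀) * t)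
  have hθ : Rate T V 0 (-μ) θ :=
    (Rate.sum hV _ fun a _ => h.rate_devK 0 a a).mono (by linarith)
  have hB c : Rate T V 0 (-μ) (B c) := Rate.neg hV ((Rate.exp 0 _).mul_le hV
    ((h.rate_exp_lam).mul hV (h.rate_lowerCoeff 0 (sub_pos.mpr h0) c)) (by linarith))
  have hs a b : Rate T V 0 (-μ) (s a b) := Rate.neg hV ((Rate.exp 0 _).mul_le hV
    ((h.rate_exp_lam).mul hV (h.rate_sig_inv 0 a b)) (by linarith))
  have hr : Rate T V 0 (-μ) r := Rate.neg hV ((Rate.exp 0 _).mono (by linarith))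
  have hz : Rate T V 0 (-μ) fun _ _ => (0 : ℝ) := (Rate.const 0 0).const_mul hV 0 |>.mul_le hV
    (Rate.exp 0 (-μ)) (zero_add _).le |>.congr hV fun _ _ _ _ => by simp
  let α : ℝ → Plane → Matrix (Fin 3) (Fin 3) ℝ := fun t u =>
    !![2 * θ t u, B 0 t u, B 1 t u; 0, θ t u, 0; 0, 0, θ t u]
  let β : Fin 2 → ℝ → Plane → Matrix (Fin 3) (Fin 3) ℝ := fun a t u =>
    !![0, s a 0 t u, s a 1 t u; if a = 0 then r t u else 0, 0, 0; if a = 1 then r t u else 0, 0, 0]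
  refine ⟨fun _ => Matrix.diagonal ![ε₀, ε₁, ε₁], _, isFuchsianForm_linear (α := α) (β := β) hμ0 hV
    _ ?_ ?_ ?_, ?_⟩
  · intro i
    fin_cases i
    exacts [h1.trans h01, h1, h1]
  · intro i j
    fin_cases i <;> fin_cases j
    exacts [hθ.const_mul hV 2, hB 0, hB 1, hz, hθ, hz, hz, hz, hθ]
  · intro a i j
    fin_cases a <;> fin_cases i <;> fin_cases j
    exacts [hz, hs 0 0, hs 0 1, hr, hz, hz, hz, hz, hz, hz, hs 1 0, hs 1 1, hz, hz, hz, hr, hz, hz]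
  · intro U hU
    have hU' {t : ℝ} (ht : t > T) {u : Plane} (hu : u ∈ V) (i : Fin 3) :
        DifferentiableAt ℝ (fun q : ℝ × Plane => U q.1 q.2 i) (t, u) :=
      differentiableAt_pi.mp (hU.differentiableAt
        ((isOpen_Ioi.prod hV).mem_nhds (show (t, u) ∈ Ioi T ×ˢ V from ⟨ht, hu⟩))) i
    have hUt {t : ℝ} (ht : t > T) {u : Plane} (hu : u ∈ V) (i : Fin 3) :
        DifferentiableAt ℝ (fun s => U s u i) t :=
      (hU' ht hu i).comp (f := fun s : ℝ => (s, u)) t (by fun_prop)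
    have hUx {t : ℝ} (ht : t > T) {u : Plane} (hu : u ∈ V) (i : Fin 3) :
        DifferentiableAt ℝ (fun y => U t y i) u :=
      (hU' ht hu i).comp (f := fun y : Plane => (t, y)) u (by fun_prop)
    have hdt {t : ℝ} (ht : t > T) {u : Plane} (hu : u ∈ V) (i : Fin 3) (c : ℝ) :
        deriv (fun s => Real.exp (-c * s) * U s u i) t
          = Real.exp (-c * t) * (deriv (fun s => U s u i) t - c * U t u i) := by
      have e1 : HasDerivAt (fun s : ℝ => Real.exp (-c * s)) (Real.exp (-c * t) * -c) t := by
        simpa using ((hasDerivAt_id t).const_mul (-c)).exp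
      rw [(e1.fun_mul (hUt ht hu i).hasDerivAt).deriv]
      ring
    have hdx {t : ℝ} (ht : t > T) {u : Plane} (hu : u ∈ V) (i : Fin 3) (c : ℝ) (a : Fin 2) :
        partialD a (fun y => Real.exp (-c * t) * U t y i) u
          = Real.exp (-c * t) * partialD a (fun y => U t y i) u := by
      simp only [partialD]
      rw [fderiv_const_mul (hUx ht hu i)]
      simp
    have e2 (t x : ℝ) : Real.exp (-μ * t) * (Real.exp (μ * t) * x) = x := by
      rw [← mul_assoc, ← Real.exp_add]
      simp
    have e3 (t : ℝ) (u : Plane) : Real.exp (L.lam t u) * L.tau t u = D.v u + θ t u := by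
      rw [← sub_eq_iff_eq_add', exp_mul_tau_sub]
    have key0 {t : ℝ} (ht : t > T) {u : Plane} (hu : u ∈ V) :
        (deriv (fun s => Real.exp (-ε₀ * s) * U s u 0) t
            + 2 * D.v u * (Real.exp (-ε₀ * t) * U t u 0)
            - 2 * Real.exp (L.lam t u) * L.tau t u * (Real.exp (-ε₀ * t) * U t u 0)
          = -(Real.exp (L.lam t u) * (∑ a, ∑ b, (L.sig t u)⁻¹ a b *
              covDCovector (L.gam t) (fun u a => Real.exp (-ε₁ * t) * U t u a.succ) a b u)
            + ∑ a, ∑ b, (L.sig t u)⁻¹ a b * Real.exp (L.lam t u) * partialD a (L.lam t) u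
              * (Real.exp (-ε₁ * t) * U t u b.succ)))
        ↔ deriv (fun s => U s u 0) t - (Matrix.diagonal ![ε₀, ε₁, ε₁] *ᵥ U t u) 0
          = Real.exp (-μ * t) * (Real.exp (μ * t) • (α t u *ᵥ U t u
            + ∑ a, β a t u *ᵥ fun j => partialD a (fun y => U t y j) u)) 0 := by
      rw [propagation_source t u (fun u a => Real.exp (-ε₁ * t) * U t u a.succ), hdt ht hu,
        Pi.smul_apply, smul_eq_mul, e2]
      simp only [hdx ht hu]
      have e1 : Real.exp (-ε₁ * t) = Real.exp (-ε₀ * t) * Real.exp ((ε₀ - ε₁) * t) := by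
        rw [← Real.exp_add]
        ring_nf
      have hpos := Real.exp_ne_zero (-ε₀ * t)
      simp only [α, β, B, s, Matrix.mulVec, dotProduct, Fin.sum_univ_two, Fin.sum_univ_three,
        Pi.add_apply, Matrix.diagonal, Matrix.of_apply, Matrix.cons_val, Fin.succ_zero_eq_one,
        Fin.succ_one_eq_two, e1]
      simp only [if_true, if_false, Fin.reduceEq]
      have e3' := e3 t u
      constructor
      · intro H
        refine sub_eq_zero.mp ((mul_eq_zero.mp ?_).resolve_left hpos)
        linear_combination H + 2 * Real.exp (-ε₀ * t) * U t u 0 * e3'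
      · intro H
        linear_combination Real.exp (-ε₀ * t) * H - 2 * Real.exp (-ε₀ * t) * U t u 0 * e3'
    have keya {t : ℝ} (ht : t > T) {u : Plane} (hu : u ∈ V) (a : Fin 2) :
        (deriv (fun s => Real.exp (-ε₁ * s) * U s u a.succ) t
            + D.v u * (Real.exp (-ε₁ * t) * U t u a.succ)
            - Real.exp (L.lam t u) * L.tau t u * (Real.exp (-ε₁ * t) * U t u a.succ)
          = -partialD a (fun u => Real.exp (-ε₀ * t) * U t u 0) u)
        ↔ deriv (fun s => U s u a.succ) t - (Matrix.diagonal ![ε₀, ε₁, ε₁] *ᵥ U t u) a.succ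
          = Real.exp (-μ * t) * (Real.exp (μ * t) • (α t u *ᵥ U t u
            + ∑ a, β a t u *ᵥ fun j => partialD a (fun y => U t y j) u)) a.succ := by
      rw [hdx ht hu, hdt ht hu, Pi.smul_apply, smul_eq_mul, e2, e3]
      have e1 : Real.exp (-ε₀ * t) = Real.exp (-ε₁ * t) * Real.exp ((ε₁ - ε₀) * t) := by
        rw [← Real.exp_add]
        ring_nf
      have hpos := Real.exp_ne_zero (-ε₁ * t)
      rw [e1]
      have ha : a = 0 ∨ a = 1 := by omega
      rcases ha with rfl | rfl <;>
        simp only [α, β, r, Matrix.mulVec, dotProduct, Fin.sum_univ_two, Fin.sum_univ_three,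
          Pi.add_apply, Matrix.diagonal, Matrix.of_apply, Matrix.cons_val, Fin.succ_zero_eq_one,
          Fin.succ_one_eq_two] <;>
        simp only [if_true, if_false, Fin.reduceEq] <;>
        refine ⟨fun H => sub_eq_zero.mp ((mul_eq_zero.mp ?_).resolve_left hpos), fun H => ?_⟩
      · linear_combination H
      · linear_combination Real.exp (-ε₁ * t) * H
      · linear_combination H
      · linear_combination Real.exp (-ε₁ * t) * H
    constructor
    · rintro ⟨H0, Ha⟩ t ht u hu i
      refine Fin.cases ?_ (fun a => ?_) i
      · exact (key0 ht hu).mp (H0 t ht u hu)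
      · exact (keya ht hu a).mp (Ha t ht u hu a)
    · intro H
      exact ⟨fun t ht u hu => (key0 ht hu).mpr (H t ht u hu 0),
        fun t ht u hu a => (keya ht hu a).mpr (H t ht u hu a.succ)⟩

end IsLocalAVTD

/-! ### Decay of the Hamiltonian constraint function at the rate of the lapse -/

/-- A function whose derivative decays exponentially and which tends to zero decays at the rate of
its derivative. -/
theorem abs_le_of_deriv_decay {f f' : ℝ → ℝ} {C m T : ℝ} (hm : 0 < m)
    (hf : ∀ t > T, HasDerivAt f (f' t) t) (h : ∀ t > T, |f' t| ≤ C * Real.exp (-m * t))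
    (hlim : Tendsto f atTop (𝓝 0)) : ∀ t > T, |f t| ≤ C / m * Real.exp (-m * t) := by
  have hexp (t : ℝ) : HasDerivAt (fun s : ℝ => C / m * Real.exp (-m * s))
      (-(C * Real.exp (-m * t))) t := by
    have h1 := (((hasDerivAt_id t).const_mul (-m)).exp).const_mul (C / m)
    refine h1.congr_deriv ?_
    simp only [id]
    field_simp
  have hexp0 := tendsto_mul_exp_neg hm (C / m)
  have key {g g' : ℝ → ℝ} (hg : ∀ t > T, HasDerivAt g (g' t) t)
      (h : ∀ t > T, -(C * Real.exp (-m * t)) ≤ g' t) (hlim : Tendsto g atTop (𝓝 0)) :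
      ∀ t > T, g t ≤ C / m * Real.exp (-m * t) := by
    intro t ht
    have h1 := nonpos_of_deriv_ge (C := 0) one_pos (fun t ht => (hg t ht).fun_sub (hexp t))
      (fun t ht => by linarith [h t ht]) (by simpa only [sub_zero] using hlim.sub hexp0) t ht
    exact sub_nonpos.mp h1
  intro t ht
  refine abs_le.mpr ⟨?_, key hf (fun t ht => (abs_le.mp (h t ht)).1) hlim t ht⟩
  have h2 := key (fun t ht => (hf t ht).fun_neg) (fun t ht => by linarith [(abs_le.mp (h t ht)).2])
    (by simpa using hlim.neg) t ht
  linarith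

namespace IsLocalAVTD

variable {ε : Exponents} {D : LocalData} {L : LocalState} {T : ℝ} {V : Set Plane}

/-- `∂_t σ_{ab} = -2 x_a^c σ_{cb}`, where `x` is the deviation of `e^λ k` from its limit. -/
theorem hasDerivAt_sig_devK (h : IsLocalAVTD ε D L T V) {t : ℝ} (ht : t > T) {u : Plane}
    (hu : u ∈ V) (a b : Fin 2) :
    HasDerivAt (fun s => L.sig s u a b) (-2 * ∑ c, devK D L a c t u * L.sig t u c b) t := by
  refine (h.hasDerivAt_sig ht hu a b).congr_deriv ?_
  have e1 (c : Fin 2) : Real.exp (L.lam t u) * L.kMixed t u a c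
      = ∑ d, L.k t u a d * (L.sig t u)⁻¹ d c := by
    have e0 : Real.exp (L.lam t u) * Real.exp (-L.lam t u) = 1 := by
      rw [← Real.exp_add]
      simp
    simp only [LocalState.kMixed, Matrix.of_apply, h.gam_inv ht hu, Matrix.smul_apply,
      smul_eq_mul, Fin.sum_univ_two, h.sig_inv_symm ht hu c]
    linear_combination (L.k t u a 0 * (L.sig t u)⁻¹ 0 c + L.k t u a 1 * (L.sig t u)⁻¹ 1 c) * e0
  have e2 : ∑ c, (∑ d, L.k t u a d * (L.sig t u)⁻¹ d c) * L.sig t u c b = L.k t u a b := by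
    have e3 : L.k t u * (L.sig t u)⁻¹ * L.sig t u = L.k t u := by
      rw [Matrix.mul_assoc, Matrix.nonsing_inv_mul _ (h.isUnit_det_sig ht hu), Matrix.mul_one]
    exact congrFun (congrFun e3 a) b
  have e4 : ∑ c, (1 : Matrix (Fin 2) (Fin 2) ℝ) a c * L.sig t u c b = L.sig t u a b :=
    congrFun (congrFun (Matrix.one_mul (L.sig t u)) a) b
  rw [← e2]
  simp only [devK, e1, sub_mul, Finset.sum_sub_distrib]
  simp only [mul_assoc, ← Finset.mul_sum, e4]
  ring

theorem hasDerivAt_det_sig (h : IsLocalAVTD ε D L T V) {t : ℝ} (ht : t > T) {u : Plane}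
    (hu : u ∈ V) :
    HasDerivAt (fun s => (L.sig s u).det) (-2 * (∑ a, devK D L a a t u) * (L.sig t u).det) t := by
  have d := h.hasDerivAt_sig_devK ht hu
  simp only [Matrix.det_fin_two]
  refine (((d 0 0).fun_mul (d 1 1)).fun_sub ((d 0 1).fun_mul (d 1 0))).congr_deriv ?_
  simp only [Fin.sum_univ_two]
  ring

/-- `∂_t σ^{ab} = 2 σ^{ac} x_c^b`. -/
theorem hasDerivAt_sig_inv (h : IsLocalAVTD ε D L T V) {t : ℝ} (ht : t > T) {u : Plane}
    (hu : u ∈ V) (a b : Fin 2) :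
    HasDerivAt (fun s => (L.sig s u)⁻¹ a b) (2 * ∑ c, (L.sig t u)⁻¹ a c * devK D L c b t u) t := by
  have hd a b := hasDerivAt_fst_of_analyticAt (f := fun t u => (L.sig t u)⁻¹ a b)
    (h.analytic_sig_inv a b (t, u) ⟨ht, hu⟩)
  refine (hd a b).congr_deriv ?_
  set X : Matrix (Fin 2) (Fin 2) ℝ := Matrix.of fun a b => devK D L a b t u
  set S' : Matrix (Fin 2) (Fin 2) ℝ := Matrix.of fun a b => deriv (fun s => (L.sig s u)⁻¹ a b) t
  have e1 : (S' - (2 : ℝ) • ((L.sig t u)⁻¹ * X)) * L.sig t u = 0 := by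
    ext i j
    have e2 : (fun s => ∑ c, (L.sig s u)⁻¹ i c * L.sig s u c j)
        =ᶠ[𝓝 t] fun _ => (1 : Matrix (Fin 2) (Fin 2) ℝ) i j := by
      filter_upwards [isOpen_Ioi.mem_nhds ht] with s hs
      exact congrFun (congrFun (Matrix.nonsing_inv_mul _ (h.isUnit_det_sig hs hu)) i) j
    have e3 := (HasDerivAt.fun_sum (u := Finset.univ) fun c _ =>
      (hd i c).fun_mul (h.hasDerivAt_sig_devK ht hu c j)).unique
        ((hasDerivAt_const t _).congr_of_eventuallyEq e2)
    simp only [Matrix.mul_apply, Matrix.sub_apply, Matrix.smul_apply, smul_eq_mul,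
      Matrix.zero_apply,
      Fin.sum_univ_two, X, S', Matrix.of_apply] at e3 ⊢
    linear_combination e3
  have e4 : S' - (2 : ℝ) • ((L.sig t u)⁻¹ * X) = 0 := by
    have := congrArg (· * (L.sig t u)⁻¹) e1
    simpa [Matrix.mul_assoc, Matrix.mul_nonsing_inv _ (h.isUnit_det_sig ht hu)] using this
  exact congrFun (congrFun (sub_eq_zero.mp e4) a) b

theorem hasDerivAt_E0 (h : IsLocalAVTD ε D L T V) {t : ℝ} (ht : t > T) {u : Plane} (hu : u ∈ V) :
    HasDerivAt (fun s => L.E0 s u) (2 * (∑ a, devK D L a a t u) * L.E0 t u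
      - Real.exp (L.lam t u) * ((∑ a, ∑ b, (L.sig t u)⁻¹ a b
          * partialD a (fun y => L.Evec t y b) u)
        + ∑ c, lowerCoeff L c t u * L.Evec t u c)) t := by
  refine (hasDerivAt_fst_of_analyticAt (h.analytic_E0 (t, u) ⟨ht, hu⟩)).congr_deriv ?_
  have e1 := h.solvesPropagation.eq0 t ht u hu
  rw [propagation_source] at e1
  rw [← exp_mul_tau_sub]
  linear_combination e1

theorem hasDerivAt_Evec (h : IsLocalAVTD ε D L T V) {t : ℝ} (ht : t > T) {u : Plane} (hu : u ∈ V)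
    (a : Fin 2) :
    HasDerivAt (fun s => L.Evec s u a) ((∑ a, devK D L a a t u) * L.Evec t u a
      - partialD a (L.E0 t) u) t := by
  refine (hasDerivAt_fst_of_analyticAt (f := fun t u => L.Evec t u a)
    (h.analytic_Evec a (t, u) ⟨ht, hu⟩)).congr_deriv ?_
  have e1 := h.solvesPropagation.eqa t ht u hu a
  rw [← exp_mul_tau_sub]
  linear_combination e1

theorem rate_det_sig_inv (h : IsLocalAVTD ε D L T V) :
    Rate T V 0 0 fun t u => ((L.sig t u)⁻¹).det := by
  have hs := h.rate_sig_inv 0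
  simp only [Matrix.det_fin_two]
  exact ((hs 0 0).mul_le h.isOpen (hs 1 1) (by simp)).sub h.isOpen
    ((hs 0 1).mul_le h.isOpen (hs 1 0) (by simp))

/-- The Hamiltonian constraint quantity decays almost as fast as the lapse. Indeed `E₀ det σ` is an
integral over `(t, ∞)` of a source which has `e^λ` as a factor. -/
theorem expBound_exp_mul_E0 (h : IsLocalAVTD ε D L T V) {δ : ℝ} (hδ : 0 < δ) (hδk : δ < ε.k) :
    ExpBound V δ fun t u => Real.exp (D.v u * t) * L.E0 t u := by
  have hV := h.isOpen
  have hη := decay_pos (ε := ε)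
  -- `∂_t (E₀ det σ)` contains no multiple of `E₀`, because `∂_t log det σ = -2 (e^λ τ - v)`.
  have hP : ExpBound V δ fun t u => Real.exp (D.v u * t) * (L.E0 t u * (L.sig t u).det) := by
    have hq : Rate T V 0 δ fun t u => Real.exp (D.lam u) * (((∑ a, ∑ b, (L.sig t u)⁻¹ a b
          * partialD a (fun y => L.Evec t y b) u)
        + ∑ c, lowerCoeff L c t u * L.Evec t u c) * (L.sig t u).det) :=
      (Rate.of_space 0 h.data_lam.rexp).mul_le hV (Rate.mul_le hV (Rate.add hV
        (Rate.sum hV _ fun a _ => Rate.sum hV _ fun b _ =>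
          (h.rate_sig_inv 0 a b).mul_le hV ((h.rate_Evec 1 b).dx a) (q := δ) (by linarith))
        (Rate.sum hV _ fun c _ => (h.rate_lowerCoeff 0 hδ c).mul_le hV (h.rate_Evec 0 c)
          (by linarith))) (h.rate_det_sig 0) (add_zero δ).le) (zero_add δ).le
    have hlim : ExpBound V (-decay ε) fun t u => L.E0 t u * (L.sig t u).det :=
      ((h.rate_E0).mul_le hV (h.rate_det_sig 0) (add_zero _).le).expBound
    intro K hK hKc
    obtain ⟨C, T₁, hC, hT, hb⟩ := hq.expBound.exists_nonneg hK hKc T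
    refine ⟨C / (ε.k - δ), T₁ + 1, fun t ht u hu => ?_⟩
    have hv := h.lt_v u (hK hu)
    have hm : 0 < D.v u - δ := by linarith
    have e1 := abs_le_of_deriv_decay (T := T₁) (C := C) hm
      (f := fun s => L.E0 s u * (L.sig s u).det)
      (fun s hs => (h.hasDerivAt_E0 (hT.trans hs) (hK hu)).fun_mul
        (h.hasDerivAt_det_sig (hT.trans hs) (hK hu))) (fun s hs => ?_) ?_ t (by linarith)
    · rw [abs_mul, Real.abs_exp]
      have e2 : Real.exp (δ * t) = Real.exp (D.v u * t) * Real.exp (-(D.v u - δ) * t) := by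
        rw [← Real.exp_add]
        ring_nf
      rw [e2, mul_left_comm]
      refine mul_le_mul_of_nonneg_left (e1.trans ?_) (Real.exp_pos _).le
      gcongr
    · have e3 := hb s hs.le u hu
      have e4 := h.exp_lam_mul s u
      have e5 : Real.exp (-(D.v u - δ) * s) * Real.exp (D.v u * s) = Real.exp (δ * s) := by
        rw [← Real.exp_add]
        ring_nf
      rw [← e4, ← e5] at e3
      refine le_of_mul_le_mul_right ?_ (Real.exp_pos (D.v u * s))
      rw [mul_assoc C]
      refine le_trans (le_of_eq ?_) e3
      rw [← Real.abs_exp (D.v u * s), ← abs_mul, Real.abs_exp, ← abs_neg]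
      congr 1
      ring
    · exact (hlim.tendstoUniformlyOn hη (K := {u}) (by simpa using hK hu)
        isCompact_singleton).tendsto_at (mem_singleton u)
  refine ((hP.mul h.rate_det_sig_inv.expBound).congr T fun t ht u hu => ?_).mono (add_zero δ).le
  rw [Matrix.det_nonsing_inv, Ring.inverse_eq_inv']
  have := (h.sig_posDef t ht u hu).det_pos.ne'
  field_simp

end IsLocalAVTD

/-! ### Vanishing of the constraint functions -/

/-- A function of time which is analytic for `t > T` and vanishes for large times vanishes. -/
theorem eq_zero_of_eventually_zero {T : ℝ} {f : ℝ → ℝ} (hf : AnalyticOnNhd ℝ f (Ioi T)) {T' : ℝ}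
    (h0 : ∀ t > T', f t = 0) : ∀ t > T, f t = 0 := by
  have hT : max T T' + 1 ∈ Ioi T := (le_max_left T T').trans_lt (lt_add_one _)
  have hT' : max T T' + 1 ∈ Ioi T' := (le_max_right T T').trans_lt (lt_add_one _)
  exact hf.eqOn_zero_of_preconnected_of_eventuallyEq_zero isPreconnected_Ioi hT
    (by filter_upwards [isOpen_Ioi.mem_nhds hT'] with t ht using h0 t ht)

/-- `f = O(e^{rt}) e` as `t → ∞`, locally uniformly on `V`. -/
def RelBound (V : Set Plane) (e : ℝ → Plane → ℝ) (r : ℝ) (f : ℝ → Plane → ℝ) : Prop :=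
  ∀ K ⊆ V, IsCompact K → ∃ C T₁ : ℝ, 0 ≤ C ∧ ∀ t ≥ T₁, ∀ u ∈ K,
    |f t u| ≤ C * Real.exp (r * t) * e t u

namespace RelBound

variable {V : Set Plane} {r s q : ℝ} {e f g : ℝ → Plane → ℝ}

theorem add (hf : RelBound V e r f) (hg : RelBound V e r g) :
    RelBound V e r fun t u => f t u + g t u := by
  intro K hK hc
  obtain ⟨C, T₁, h0, h⟩ := hf K hK hc
  obtain ⟨C', T₁', h0', h'⟩ := hg K hK hc
  refine ⟨C + C', max T₁ T₁', add_nonneg h0 h0', fun t ht u hu => (abs_add_le _ _).trans ?_⟩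
  rw [add_mul, add_mul]
  exact add_le_add (h t ((le_max_left _ _).trans ht) u hu) (h' t ((le_max_right _ _).trans ht) u hu)

theorem mul_le (hg : ExpBound V s g) (hf : RelBound V e r f) {T : ℝ}
    (he : ∀ t > T, ∀ u ∈ V, 0 ≤ e t u) (h : s + r ≤ q) :
    RelBound V e q fun t u => g t u * f t u := by
  intro K hK hc
  obtain ⟨C, T₁, h0, h1⟩ := hf K hK hc
  obtain ⟨C', T₁', h0', -, h1'⟩ := hg.exists_nonneg hK hc 0
  refine ⟨C' * C, max (max T₁ T₁') (max 0 (T + 1)), mul_nonneg h0' h0, fun t ht u hu => ?_⟩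
  have ht1 := (le_max_left _ _).trans ht
  have ht2 := (le_max_right _ _).trans ht
  have ht0 : 0 ≤ t := (le_max_left _ _).trans ht2
  have het := he t ((lt_add_one T).trans_le ((le_max_right _ _).trans ht2)) u (hK hu)
  rw [abs_mul]
  calc |g t u| * |f t u| ≤ (C' * Real.exp (s * t)) * (C * Real.exp (r * t) * e t u) :=
        mul_le_mul (h1' t ((le_max_right _ _).trans ht1) u hu)
          (h1 t ((le_max_left _ _).trans ht1) u hu) (abs_nonneg _) (by positivity)
    _ = C' * C * Real.exp ((s + r) * t) * e t u := by
        rw [add_mul, Real.exp_add]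
        ring
    _ ≤ C' * C * Real.exp (q * t) * e t u := by gcongr

theorem sum {ι : Type*} (t : Finset ι) {F : ι → ℝ → Plane → ℝ}
    (hF : ∀ i ∈ t, RelBound V e r (F i)) : RelBound V e r fun s u => ∑ i ∈ t, F i s u := by
  classical
  induction t using Finset.induction_on with
  | empty => exact fun _ _ _ => ⟨0, 0, le_rfl, by simp⟩
  | insert i t hi ih =>
    simp only [Finset.sum_insert hi]
    exact add (hF i (Finset.mem_insert_self _ _))
      (ih fun j hj => hF j (Finset.mem_insert_of_mem hj))

theorem of_abs_le {T : ℝ} (hf : RelBound V e r f) (h : ∀ t > T, ∀ u ∈ V, |g t u| ≤ f t u) :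
    RelBound V e r g := by
  intro K hK hc
  obtain ⟨C, T₁, h0, h1⟩ := hf K hK hc
  refine ⟨C, max T₁ (T + 1), h0, fun t ht u hu => ?_⟩
  exact (h t ((lt_add_one T).trans_le ((le_max_right _ _).trans ht)) u (hK hu)).trans
    ((le_abs_self _).trans (h1 t ((le_max_left _ _).trans ht) u hu))

end RelBound

/-- The Cauchy–Schwarz inequality `E_c² ≤ σ_cc σ^{ab} E_a E_b`. -/
theorem Matrix.PosDef.sq_le_mul_inv {σ : Matrix (Fin 2) (Fin 2) ℝ} (h : σ.PosDef) (E : Fin 2 → ℝ)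
    (c : Fin 2) : E c ^ 2 ≤ σ c c * ∑ a, ∑ b, σ⁻¹ a b * (E a * E b) := by
  have hd := h.det_pos
  have hs : σ 1 0 = σ 0 1 := by simpa using h.1.apply 0 1
  rw [Matrix.det_fin_two, hs] at hd
  have hn := hd.ne'
  have key : ∀ x y : ℝ, 0 ≤ (σ 0 0 * σ 1 1 - σ 0 1 * σ 0 1)⁻¹ * (x - y) ^ 2 := fun x y =>
    mul_nonneg (inv_nonneg.mpr hd.le) (sq_nonneg _)
  have e1 : (σ 0 0 * σ 1 1 - σ 0 1 * σ 0 1)⁻¹ * (σ 0 0 * σ 1 1 - σ 0 1 * σ 0 1) = 1 :=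
    inv_mul_cancel₀ hn
  simp only [Matrix.inv_fin_two_apply, Fin.sum_univ_two, Matrix.adjugate_fin_two, hs]
  have hc : c = 0 ∨ c = 1 := by omega
  rcases hc with rfl | rfl
  · have := key (σ 0 1 * E 0) (σ 0 0 * E 1)
    simp only [Matrix.of_apply, Matrix.cons_val]
    linear_combination this - E 0 ^ 2 * e1
  · have := key (σ 0 1 * E 1) (σ 1 1 * E 0)
    simp only [Matrix.of_apply, Matrix.cons_val]
    linear_combination this - E 1 ^ 2 * e1

theorem Matrix.PosDef.sum_inv_nonneg {σ : Matrix (Fin 2) (Fin 2) ℝ} (h : σ.PosDef)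
    (E : Fin 2 → ℝ) : 0 ≤ ∑ a, ∑ b, σ⁻¹ a b * (E a * E b) :=
  nonneg_of_mul_nonneg_right ((sq_nonneg _).trans (h.sq_le_mul_inv E 0)) h.diag_pos

namespace IsLocalAVTD

variable {ε : Exponents} {D : LocalData} {L : LocalState} {T : ℝ} {V : Set Plane}

/-- The energy density `e^{-λ} E₀² + σ^{ab} E_a E_b` of the constraint quantities. The weight
`e^{-λ}` symmetrizes the constraint propagation system. -/
def energy (L : LocalState) (t : ℝ) (u : Plane) : ℝ :=
  Real.exp (-L.lam t u) * (L.E0 t u * L.E0 t u)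
    + ∑ a, ∑ b, (L.sig t u)⁻¹ a b * (L.Evec t u a * L.Evec t u b)

/-- The energy flux `2 σ^{ab} E₀ E_b`. -/
def flux (L : LocalState) (a : Fin 2) (t : ℝ) (u : Plane) : ℝ :=
  2 * ∑ b, (L.sig t u)⁻¹ a b * (L.E0 t u * L.Evec t u b)

/-- The indefinite part of the energy production. -/
def production (D : LocalData) (L : LocalState) (t : ℝ) (u : Plane) : ℝ :=
  4 * (∑ a, devK D L a a t u) * (Real.exp (-L.lam t u) * (L.E0 t u * L.E0 t u))
    + (∑ c, (-2 * lowerCoeff L c t u) * (L.E0 t u * L.Evec t u c)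
    + (∑ a, ∑ b, (∑ c, 2 * ((L.sig t u)⁻¹ a c * devK D L c b t u)) * (L.Evec t u a * L.Evec t u b)
    + (∑ a, ∑ b, (2 * (∑ c, devK D L c c t u) * (L.sig t u)⁻¹ a b)
        * (L.Evec t u a * L.Evec t u b)
    + ∑ a, ∑ b, (2 * partialD a (fun y => (L.sig t y)⁻¹ a b) u) * (L.E0 t u * L.Evec t u b))))

/-- The energy identity: the principal terms of the constraint propagation system form a
divergence. -/
theorem deriv_energy (h : IsLocalAVTD ε D L T V) {t : ℝ} (ht : t > T) {u : Plane} (hu : u ∈ V) :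
    deriv (fun s => energy L s u) t + ∑ a, partialD a (flux L a t) u
      = D.v u * (Real.exp (-L.lam t u) * (L.E0 t u * L.E0 t u)) + production D L t u := by
  have hE0 := h.hasDerivAt_E0 ht hu
  have hE := h.hasDerivAt_Evec ht hu
  have hS := h.hasDerivAt_sig_inv ht hu
  have hl : HasDerivAt (fun s => Real.exp (-L.lam s u)) (D.v u * Real.exp (-L.lam t u)) t := by
    refine ((h.hasDerivAt_lam ht hu).fun_neg.exp).congr_deriv ?_
    ring
  have d1 := (hl.fun_mul (hE0.fun_mul hE0)).fun_add (HasDerivAt.fun_sum (u := Finset.univ)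
    fun a _ => HasDerivAt.fun_sum (u := Finset.univ) fun b _ =>
      (hS a b).fun_mul ((hE a).fun_mul (hE b)))
  have x0 := differentiableAt_snd_of_analyticAt (f := L.E0) (h.analytic_E0 (t, u) ⟨ht, hu⟩)
  have xE a := differentiableAt_snd_of_analyticAt (f := fun t u => L.Evec t u a)
    (h.analytic_Evec a (t, u) ⟨ht, hu⟩)
  have xS a b := differentiableAt_snd_of_analyticAt (f := fun t u => (L.sig t u)⁻¹ a b)
    (h.analytic_sig_inv a b (t, u) ⟨ht, hu⟩)
  have d2 (a : Fin 2) : partialD a (flux L a t) u = 2 * ∑ b,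
      (partialD a (fun y => (L.sig t y)⁻¹ a b) u * (L.E0 t u * L.Evec t u b)
        + (L.sig t u)⁻¹ a b * (partialD a (L.E0 t) u * L.Evec t u b
          + L.E0 t u * partialD a (fun y => L.Evec t y b) u)) := by
    have e1 b : DifferentiableAt ℝ (fun y => L.E0 t y * L.Evec t y b) u := x0.mul (xE b)
    have e2 b : DifferentiableAt ℝ (fun y => (L.sig t y)⁻¹ a b * (L.E0 t y * L.Evec t y b)) u :=
      (xS a b).mul (e1 b)
    have e3 : flux L a t = fun y => 2 * ∑ b, (L.sig t y)⁻¹ a b * (L.E0 t y * L.Evec t y b) := rfl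
    simp only [partialD, e3]
    rw [fderiv_const_mul (DifferentiableAt.fun_sum fun b _ => e2 b), fderiv_fun_sum fun b _ => e2 b]
    simp only [fderiv_fun_mul (xS a _) (e1 _), fderiv_fun_mul x0 (xE _), smul_apply, add_apply,
      sum_apply, smul_eq_mul]
    congr 1
    refine Finset.sum_congr rfl fun b _ => ?_
    ring
  have e0 : Real.exp (-L.lam t u) * Real.exp (L.lam t u) = 1 := by
    rw [← Real.exp_add]
    simp
  have hs := h.sig_inv_symm ht hu 1 0
  simp only [energy]
  rw [d1.deriv]
  simp only [d2, production, Fin.sum_univ_two, hs]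
  linear_combination (-2 * L.E0 t u * ((L.sig t u)⁻¹ 0 0 * partialD 0 (fun y => L.Evec t y 0) u
    + (L.sig t u)⁻¹ 0 1 * partialD 0 (fun y => L.Evec t y 1) u
    + (L.sig t u)⁻¹ 0 1 * partialD 1 (fun y => L.Evec t y 0) u
    + (L.sig t u)⁻¹ 1 1 * partialD 1 (fun y => L.Evec t y 1) u
    + lowerCoeff L 0 t u * L.Evec t u 0 + lowerCoeff L 1 t u * L.Evec t u 1)) * e0

theorem energy_parts_nonneg (h : IsLocalAVTD ε D L T V) {t : ℝ} (ht : t > T) {u : Plane}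
    (hu : u ∈ V) : 0 ≤ Real.exp (-L.lam t u) * (L.E0 t u * L.E0 t u)
      ∧ 0 ≤ ∑ a, ∑ b, (L.sig t u)⁻¹ a b * (L.Evec t u a * L.Evec t u b) :=
  ⟨mul_nonneg (Real.exp_pos _).le (mul_self_nonneg _), (h.sig_posDef t ht u hu).sum_inv_nonneg _⟩

theorem energy_nonneg (h : IsLocalAVTD ε D L T V) : ∀ t > T, ∀ u ∈ V, 0 ≤ energy L t u :=
  fun _ ht _ hu => add_nonneg (h.energy_parts_nonneg ht hu).1 (h.energy_parts_nonneg ht hu).2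

theorem relBound_energy (h : IsLocalAVTD ε D L T V) : RelBound V (energy L) 0 (energy L) := by
  refine fun K hK _ => ⟨1, T + 1, zero_le_one, fun t ht u hu => ?_⟩
  rw [abs_of_nonneg (h.energy_nonneg t ((lt_add_one T).trans_le ht) u (hK hu))]
  simp

theorem relBound_exp_neg_mul_E0_sq (h : IsLocalAVTD ε D L T V) :
    RelBound V (energy L) 0 fun t u => Real.exp (-L.lam t u) * (L.E0 t u * L.E0 t u) := by
  refine h.relBound_energy.of_abs_le (T := T) fun t ht u hu => ?_
  obtain ⟨h1, h2⟩ := h.energy_parts_nonneg ht hu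
  rw [abs_of_nonneg h1]
  exact le_add_of_nonneg_right h2

theorem relBound_Evec_sq (h : IsLocalAVTD ε D L T V) (c : Fin 2) :
    RelBound V (energy L) 0 fun t u => L.Evec t u c ^ 2 := by
  have h0 : RelBound V (energy L) 0 fun t u =>
      ∑ a, ∑ b, (L.sig t u)⁻¹ a b * (L.Evec t u a * L.Evec t u b) := by
    refine h.relBound_energy.of_abs_le (T := T) fun t ht u hu => ?_
    obtain ⟨h1, h2⟩ := h.energy_parts_nonneg ht hu
    rw [abs_of_nonneg h2]
    exact le_add_of_nonneg_left h1
  refine (RelBound.mul_le (h.rate_sig 0 c c).expBound h0 h.energy_nonneg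
    (add_zero 0).le).of_abs_le (T := T) fun t ht u hu => ?_
  rw [abs_of_nonneg (sq_nonneg _)]
  exact (h.sig_posDef t ht u hu).sq_le_mul_inv _ c

theorem relBound_Evec_mul_Evec (h : IsLocalAVTD ε D L T V) (a b : Fin 2) :
    RelBound V (energy L) 0 fun t u => L.Evec t u a * L.Evec t u b := by
  refine ((h.relBound_Evec_sq a).add (h.relBound_Evec_sq b)).of_abs_le (T := T) fun t _ u _ => ?_
  rw [abs_le]
  constructor <;> nlinarith [sq_nonneg (L.Evec t u a + L.Evec t u b),
    sq_nonneg (L.Evec t u a - L.Evec t u b), sq_nonneg (L.Evec t u a), sq_nonneg (L.Evec t u b)]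

/-- The mixed products `E₀ E_c` gain a factor `e^{λ/2}` over the energy density. -/
theorem relBound_E0_mul_Evec (h : IsLocalAVTD ε D L T V) (c : Fin 2) :
    RelBound V (energy L) (-(ε.k / 2)) fun t u => L.E0 t u * L.Evec t u c := by
  have h1 : RelBound V (energy L) (-ε.k) fun t u =>
      Real.exp (L.lam t u) * (Real.exp (-L.lam t u) * (L.E0 t u * L.E0 t u)) :=
    RelBound.mul_le h.rate_exp_lam.expBound h.relBound_exp_neg_mul_E0_sq h.energy_nonneg
      (add_zero _).le
  have h2 := RelBound.mul_le (q := -(ε.k / 2))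
    (Rate.exp (T := T) (V := V) 0 (ε.k / 2)).expBound h1 h.energy_nonneg (by linarith)
  have h3 := RelBound.mul_le (q := -(ε.k / 2))
    (Rate.exp (T := T) (V := V) 0 (-(ε.k / 2))).expBound (h.relBound_Evec_sq c) h.energy_nonneg
    (by linarith)
  refine (h2.add h3).of_abs_le (T := T) fun t _ u _ => ?_
  have e1 : Real.exp (ε.k / 2 * t) * Real.exp (-(ε.k / 2) * t) = 1 := by
    rw [← Real.exp_add]
    simp
  have e2 : Real.exp (L.lam t u) * (Real.exp (-L.lam t u) * (L.E0 t u * L.E0 t u))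
      = L.E0 t u ^ 2 := by
    rw [← mul_assoc, ← Real.exp_add]
    simp [sq]
  rw [e2]
  generalize Real.exp (ε.k / 2 * t) = p at e1
  have hr := Real.exp_pos (-(ε.k / 2) * t)
  generalize Real.exp (-(ε.k / 2) * t) = r at e1 hr
  generalize L.E0 t u = x
  generalize L.Evec t u c = y
  have k1 : 0 ≤ r * ((p * x - y / 2) ^ 2 + 3 / 4 * y ^ 2) := by positivity
  have k2 : 0 ≤ r * ((p * x + y / 2) ^ 2 + 3 / 4 * y ^ 2) := by positivity
  rw [abs_le]
  constructor
  · linear_combination k2 + (p * x ^ 2 + x * y) * e1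
  · linear_combination k1 + (p * x ^ 2 - x * y) * e1

theorem relBound_flux (h : IsLocalAVTD ε D L T V) (a : Fin 2) :
    RelBound V (energy L) (-(ε.k / 4)) (flux L a) :=
  RelBound.mul_le (Rate.const (T := T) 0 2).expBound (RelBound.sum _ fun b _ =>
    RelBound.mul_le (h.rate_sig_inv 0 a b).expBound (h.relBound_E0_mul_Evec b) h.energy_nonneg
      le_rfl) h.energy_nonneg (by linarith [ε.k_pos])

theorem relBound_production (h : IsLocalAVTD ε D L T V) :
    RelBound V (energy L) (-(ε.k / 4)) (production D L) := by
  have hV := h.isOpen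
  have hk := ε.k_pos
  have he := h.energy_nonneg
  have x := h.rate_devK 0
  have θ : Rate T V 0 (-ε.k) fun t u => ∑ a, devK D L a a t u := Rate.sum hV _ fun a _ => x a a
  refine RelBound.add (RelBound.mul_le (θ.const_mul hV 4).expBound h.relBound_exp_neg_mul_E0_sq he
      (by linarith)) (RelBound.add ?_ (RelBound.add ?_ (RelBound.add ?_ ?_)))
  · exact RelBound.sum _ fun c _ => RelBound.mul_le
      ((h.rate_lowerCoeff 0 (δ := ε.k / 4) (by linarith) c).const_mul hV (-2)).expBound
      (h.relBound_E0_mul_Evec c) he (by linarith)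
  · exact RelBound.sum _ fun a _ => RelBound.sum _ fun b _ => RelBound.mul_le
      (Rate.sum hV _ fun c _ =>
        Rate.const_mul hV 2 ((h.rate_sig_inv 0 a c).mul hV (x c b))).expBound
      (h.relBound_Evec_mul_Evec a b) he (by linarith)
  · exact RelBound.sum _ fun a _ => RelBound.sum _ fun b _ => RelBound.mul_le
      ((θ.const_mul hV 2).mul hV (h.rate_sig_inv 0 a b)).expBound
      (h.relBound_Evec_mul_Evec a b) he (by linarith)
  · exact RelBound.sum _ fun a _ => RelBound.sum _ fun b _ => RelBound.mul_le
      (((h.rate_sig_inv 1 a b).dx a).const_mul hV 2).expBound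
      (h.relBound_E0_mul_Evec b) he (by linarith)

theorem analytic_exp_neg_lam (h : IsLocalAVTD ε D L T V) :
    AnalyticOnNhd ℝ (fun q : ℝ × Plane => Real.exp (-L.lam q.1 q.2)) (Ioi T ×ˢ V) :=
  h.lam.neg.rexp

theorem analytic_energy (h : IsLocalAVTD ε D L T V) :
    AnalyticOnNhd ℝ (fun q : ℝ × Plane => energy L q.1 q.2) (Ioi T ×ˢ V) :=
  (h.analytic_exp_neg_lam.mul (h.analytic_E0.mul h.analytic_E0)).add
    (Finset.analyticOnNhd_fun_sum _ fun a _ => Finset.analyticOnNhd_fun_sum _ fun b _ =>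
      (h.analytic_sig_inv a b).mul ((h.analytic_Evec a).mul (h.analytic_Evec b)))

theorem analytic_flux (h : IsLocalAVTD ε D L T V) (a : Fin 2) :
    AnalyticOnNhd ℝ (fun q : ℝ × Plane => flux L a q.1 q.2) (Ioi T ×ˢ V) :=
  analyticOnNhd_const.mul (Finset.analyticOnNhd_fun_sum _ fun b _ =>
    (h.analytic_sig_inv a b).mul (h.analytic_E0.mul (h.analytic_Evec b)))

/-- The energy density decays: `e^{-λ} E₀²` does because `E₀` decays almost as fast as `e^λ`. -/
theorem expBound_energy (h : IsLocalAVTD ε D L T V) : ExpBound V (-(decay ε / 2)) (energy L) := by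
  have hV := h.isOpen
  have hη := decay_pos (ε := ε)
  have hk := decay_le_k (ε := ε)
  have h1 := (h.expBound_exp_mul_E0 (half_pos hη) (by linarith)).mul h.rate_E0.expBound
  have h2 := ((Rate.of_space (T := T) 0 h.data_lam.neg.rexp).expBound.mul h1).mono
    (s := -(decay ε / 2)) (by linarith)
  have h3 : Rate T V 0 (-(decay ε / 2)) fun t u =>
      ∑ a, ∑ b, (L.sig t u)⁻¹ a b * (L.Evec t u a * L.Evec t u b) :=
    Rate.sum hV _ fun a _ => Rate.sum hV _ fun b _ => (h.rate_sig_inv 0 a b).mul_le hV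
      ((h.rate_Evec 0 a).mul hV (h.rate_Evec 0 b)) (by linarith)
  refine (h2.congr T fun t _ u _ => ?_).add h3.expBound
  have e1 : Real.exp (-L.lam t u) = Real.exp (-D.lam u) * Real.exp (D.v u * t) := by
    rw [← Real.exp_add, h.lam_eq]
    ring_nf
  rw [e1]
  simp only [Pi.neg_apply]
  ring

theorem energy_eventually_zero (h : IsLocalAVTD ε D L T V) {u₀ : Plane} (hu : u₀ ∈ V) :
    ∃ T', ∀ t > T', energy L t u₀ = 0 := by
  obtain ⟨ρ, hρ, hB⟩ := Metric.nhds_basis_closedBall.mem_iff.mp (h.isOpen.mem_nhds hu)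
  have hc := isCompact_closedBall u₀ ρ
  have hmono {T' : ℝ} (hT : T ≤ T') : Ioi T' ×ˢ V ⊆ Ioi T ×ˢ V :=
    prod_mono (Ioi_subset_Ioi hT) subset_rfl
  choose C₁ T₁ hC₁ h₁ using fun a => h.relBound_flux a _ hB hc
  obtain ⟨C₂, T₂, hC₂, h₂⟩ := h.relBound_production _ hB hc
  set C := C₁ 0 + C₁ 1 + C₂ with hCdef
  set T' := max (max T (T₁ 0)) (max (T₁ 1) T₂) with hT'
  have hT : T ≤ T' := (le_max_left _ _).trans (le_max_left _ _)
  have hT1 (a : Fin 2) : T₁ a ≤ T' := by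
    have ha : a = 0 ∨ a = 1 := by omega
    rcases ha with rfl | rfl
    exacts [(le_max_right _ _).trans (le_max_left _ _), (le_max_left _ _).trans (le_max_right _ _)]
  have hT2 : T₂ ≤ T' := (le_max_right _ _).trans (le_max_right _ _)
  have hC1 (a : Fin 2) : C₁ a ≤ C := by
    have ha : a = 0 ∨ a = 1 := by omega
    rcases ha with rfl | rfl <;> linarith [hC₁ 0, hC₁ 1]
  have hC2 : C₂ ≤ C := by linarith [hC₁ 0, hC₁ 1]
  have he {t : ℝ} (ht : t > T') {u : Plane} (hu : u ∈ Metric.closedBall u₀ ρ) :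
      0 ≤ energy L t u := h.energy_nonneg t (hT.trans_lt ht) u (hB hu)
  refine energy_eq_zero h.isOpen (T := T') (C := C) (c := ε.k / 4) (j := flux L) hρ hB
    (hC₂.trans hC2) (by linarith [ε.k_pos]) (h.analytic_energy.mono (hmono hT))
    (fun a => (h.analytic_flux a).mono (hmono hT)) (fun t ht u hu => he ht hu) ?_ ?_ ?_
  · intro t ht u hu a
    refine (h₁ a t ((hT1 a).trans ht.le) u hu).trans ?_
    have := he ht hu
    gcongr
    exact hC1 a
  · intro t ht u hu
    rw [h.deriv_energy (hT.trans_lt ht) (hB hu)]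
    have k1 := (abs_le.mp (h₂ t (hT2.trans ht.le) u hu)).1
    have k2 : C₂ * Real.exp (-(ε.k / 4) * t) * energy L t u
        ≤ C * Real.exp (-(ε.k / 4) * t) * energy L t u := by
      have := he ht hu
      gcongr
    have k3 := mul_nonneg (ε.k_pos.le.trans (h.lt_v u (hB hu)).le)
      (h.energy_parts_nonneg (hT.trans_lt ht) (hB hu)).1
    linarith
  · exact h.expBound_energy.tendstoUniformlyOn (half_pos decay_pos) hB hc

/-- The constraint functions vanish at large times by the energy estimate, hence at all times by
analyticity. -/
theorem constraints_eq_zero (h : IsLocalAVTD ε D L T V) {t : ℝ} (ht : t > T) {u : Plane}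
    (hu : u ∈ V) : L.C0 t u = 0 ∧ ∀ a, L.Cvec t u a = 0 := by
  obtain ⟨T', h0⟩ := h.energy_eventually_zero hu
  have hsec {f : ℝ → Plane → ℝ} (hf : AnalyticOnNhd ℝ (fun q : ℝ × Plane => f q.1 q.2)
      (Ioi T ×ˢ V)) : AnalyticOnNhd ℝ (fun s => f s u) (Ioi T) := fun s hs =>
    (hf (s, u) ⟨hs, hu⟩).comp_of_eq (f := fun s : ℝ => (s, u)) (by fun_prop) rfl
  have key {s : ℝ} (hs : s > max T T') : L.E0 s u = 0 ∧ ∀ a, L.Evec s u a = 0 := by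
    have hsT : s > T := (le_max_left _ _).trans_lt hs
    obtain ⟨h1, h2⟩ := h.energy_parts_nonneg hsT hu
    obtain ⟨h3, h4⟩ := (add_eq_zero_iff_of_nonneg h1 h2).mp (h0 s ((le_max_right _ _).trans_lt hs))
    refine ⟨mul_self_eq_zero.mp ((mul_eq_zero.mp h3).resolve_left (Real.exp_ne_zero _)),
      fun a => ?_⟩
    have h5 := (h.sig_posDef s hsT u hu).sq_le_mul_inv (L.Evec s u) a
    rw [h4, mul_zero] at h5
    exact pow_eq_zero_iff two_ne_zero |>.mp (le_antisymm h5 (sq_nonneg _))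
  have hE0 := eq_zero_of_eventually_zero (hsec h.analytic_E0) (fun s hs => (key hs).1) t ht
  have hE a := eq_zero_of_eventually_zero
    (hsec (f := fun t u => L.Evec t u a) (h.analytic_Evec a)) (fun s hs => (key hs).2 a) t ht
  exact ⟨(mul_eq_zero.mp hE0).resolve_left (Real.exp_ne_zero _),
    fun a => (mul_eq_zero.mp (hE a)).resolve_left (Real.exp_ne_zero _)⟩

end IsLocalAVTD

/-! ### From the surface to coordinate domains -/

section Surface

variable {M : Type*} [TopologicalSpace M] [ChartedSpace Plane M]

/-- The components of a metric in a coordinate system form a positive definite matrix, because the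
differential of the inverse chart is injective. -/
theorem Tensor2.IsMetric.comp_posDef {g : Tensor2 M} (hg : g.IsMetric)
    {e : OpenPartialHomeomorph M Plane} (he : e ∈ coords M) {u : Plane} (hu : u ∈ e.target) :
    (g.comp e u).PosDef := by
  have hd : e.MDifferentiable (𝓡 2) (𝓡 2) :=
    ⟨(contMDiffOn_of_mem_maximalAtlas he).mdifferentiableOn (by simp),
      (contMDiffOn_symm_of_mem_maximalAtlas he).mdifferentiableOn (by simp)⟩
  have hinj := hd.symm.mfderiv_injective hu
  refine Matrix.PosDef.of_dotProduct_mulVec_pos ?_ fun x hx => ?_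
  · ext a b
    exact hg.1 _ _ _
  · set A := mfderiv (𝓡 2) (𝓡 2) e.symm u with hA
    let X : Plane := ∑ a, x a • EuclideanSpace.single a (1 : ℝ)
    have hXa (a : Fin 2) : X a = x a := by
      fin_cases a <;> simp [X, Fin.sum_univ_two]
    have hX : X ≠ 0 := fun h0 => hx (funext fun a => by rw [← hXa, h0]; rfl)
    have hAX : A X ≠ 0 := fun h0 => hX (hinj (h0.trans (map_zero A).symm))
    have hpos := hg.2 _ (A X) hAX
    have e1 : A X = x 0 • A (EuclideanSpace.single 0 (1 : ℝ) : Plane)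
        + x 1 • A (EuclideanSpace.single 1 (1 : ℝ) : Plane) := by
      simp only [X, Fin.sum_univ_two]
      exact (map_add A _ _).trans (congrArg₂ (· + ·) (map_smul A _ _) (map_smul A _ _))
    rw [e1] at hpos
    simp only [map_add, map_smul, add_apply, smul_apply, smul_eq_mul] at hpos
    refine hpos.trans_le (le_of_eq ?_)
    simp only [dotProduct, Matrix.mulVec, Fin.sum_univ_two, Pi.star_apply, star_trivial,
      Tensor2.comp, Matrix.of_apply]
    ring

/-- An AVTD solution on the surface is one in every coordinate domain. -/
theorem IsAVTDSolution.isLocalAVTD {ε : Exponents} {A : AsymptoticData M} (hA : A.IsAnalytic)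
    (hv : ∀ x, ε.k < A.v x) (hC : A.SatisfiesConstraints) {T : ℝ} {S : SurfaceState M}
    (hS : IsAVTDSolution ε A T S) {e : OpenPartialHomeomorph M Plane} (he : e ∈ coords M) :
    IsLocalAVTD ε (A.toLocal e) (S.toLocal A e) T e.target where
  isOpen := e.open_target
  sig := hS.analytic_sig e he
  k := hS.analytic_k e he
  phi := hS.analytic_phi e he
  p := hS.analytic_p e he
  lam := ((hA.lam e he).comp analyticOnNhd_snd fun _ hq => hq.2).sub
    (((hA.v e he).comp analyticOnNhd_snd fun _ hq => hq.2).mul analyticOnNhd_fst)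
  deriv_lam := fun t _ u _ => by
    have h1 := ((hasDerivAt_id t).const_mul (A.v (e.symm u))).const_sub (A.lam (e.symm u))
    have h2 := h1.deriv
    rw [mul_one] at h2
    exact h2
  sig_posDef := fun t ht u hu => (hS.metric t ht).comp_posDef he hu
  evolution := hS.evolution e he
  data_sig := hA.sig e he
  data_phi := hA.phi e he
  data_lam := hA.lam e he
  data_v := hA.v e he
  data_w := hA.w e he
  data_posDef := fun u hu => hA.metric.comp_posDef he hu
  lam_eq := fun _ _ => rfl
  lt_v := fun u _ => hv (e.symm u)
  ham := fun u _ => (mul_eq_zero.mp (hC.ham (e.symm u) 0)).resolve_left (Real.exp_ne_zero _)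
  mom := fun u hu t b => by
    have h1 := (hA.phi e he u hu).differentiableAt
    have h2 := (hA.w e he u hu).differentiableAt
    have h3 := hC.mom e he u hu t b
    have h4 : partialD b (fun y => (A.toLocal e).phi y - (A.toLocal e).w y * t) u
        = partialD b (A.toLocal e).phi u - partialD b (A.toLocal e).w u * t := by
      simp only [partialD]
      rw [fderiv_fun_sub h1 (h2.mul_const t), fderiv_mul_const h2]
      simp [mul_comm]
    rwa [h4] at h3
  remainders := hS.remainders e he

end Surface

end

theorem lemma2 {M : Type*} [TopologicalSpace M] [ChartedSpace Plane M] [IsManifold (𝓡 2) ω M]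
    (ε : Exponents) (A : AsymptoticData M) (hA : A.IsAnalytic) (hv : ∀ x, ε.k < A.v x)
    (hC : A.SatisfiesConstraints)
    (T : ℝ) (S : SurfaceState M) (hS : IsAVTDSolution ε A T S) :
    (∀ e ∈ coords M,
      (S.toLocal A e).SolvesPropagation (A.toLocal e).v T e.target
        (S.toLocal A e).E0 (S.toLocal A e).Evec) ∧
    (∀ ε₀ ε₁ : ℝ, 0 < ε₁ → ε₁ < ε₀ → ε₀ < ε.k →
      ∃ μ : ℝ, ∀ e ∈ coords M,
        IsFuchsianSystem T e.target μ
          ((S.toLocal A e).RescaledPropagation (A.toLocal e).v T e.target ε₀ ε₁)) ∧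
    (∀ e ∈ coords M, ∀ t > T, ∀ u ∈ e.target,
      (S.toLocal A e).C0 t u = 0 ∧ ∀ a, (S.toLocal A e).Cvec t u a = 0) := by
  have h {e : OpenPartialHomeomorph M Plane} (he : e ∈ coords M) := hS.isLocalAVTD hA hv hC he
  exact ⟨fun e he => (h he).solvesPropagation,
    fun ε₀ ε₁ h1 h01 h0 => ⟨min (ε₀ - ε₁) ε₁, fun e he => (h he).isFuchsianSystem h1 h01 h0⟩,
    fun e he t ht u hu => (h he).constraints_eq_zero ht hu⟩
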